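/- **Setting.** Let $\mathbb K=\mathbb R$ or $\mathbb C$, let $T>0$ and $k\ge 1$, and let $A\in\mathbb K^{d\times d}$ be diagonalizable over $\mathbb C$ with all its eigenvalues purely imaginary and nonzero; put $\mu=\min|\lambda(A)|>0$. Let $\mathbf F:\mathbb K^d\times[0,T]\to\mathbb K^d$ have partial derivatives (over $\mathbb K$ in the components of $\mathbf u$, over $\mathbb R$ in $t$) of all orders up to $k$, which are, together with $\mathbf F$, Lipschitz continuous in $(\mathbf u,t)$ on bounded sets. Let $\mathbf u_{\rm in}\in\mathbb K^d$. For $\varepsilon>0$ and $\nu\in\mathbb R$ consider $$\dot{\mathbf u}=\tfrac1\varepsilon A\mathbf u+\mathbf F(\mathbf u,t),\quad t\in[0,T],\qquad \mathbf u(0)=\varepsilon^\nu\mathbf u_{\rm in}.$$ **The integrator.** Write $\mathbf x=(\mathbf u,t)\in\mathbb K^d\times\mathbb R$ with coordinates $x_1,\dots,x_{d+1}$, $x_{d+1}=t$, and put $A_1=\operatorname{diag}(A,0)$, $\mathbf f(\mathbf x)=(\mathbf F(\mathbf u,t),1)$. Given $\hat{\mathbf x}$, the extension variables are the monomials $(\mathbf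 x-\hat{\mathbf x})^\alpha=\prod_{l}(x_{\alpha_l}-\hat x_{\alpha_l})$ of degree $|\alpha|\le k$, where $\alpha$ runs over the multi-indices with entries in $\{1,\dots,d+1\}$ up to permutation; their order is immaterial, and vectors and matrices are indexed by them. Let $\chi(\alpha;l)$ be $\alpha$ with its $l$-th entry removed. The matrices $A_1^{[k]}(\hat{\mathbf x})$ and $A_0^{[k]}(\hat{\mathbf x})$ have in the row of $\alpha$ the coefficients of the monomials in, respectively, $$\sum_{l=1}^{|\alpha|}\sum_{m=1}^{d+1}(A_1)_{\alpha_l m}\,(\mathbf x-\hat{\mathbf x})^{\chi(\alpha;l)}\big((x_m-\hat x_m)+\hat x_m\big) \quad\text{and}\quad \sum_{l=1}^{|\alpha|}\ \sum_{|\gamma|\le k-|\alpha|+1}\frac{\partial^{\gamma}f_{\alpha_l}(\hat{\mathbf x})}{\gamma!}\,(\mathbf x-\hat{\mathbf x})^{\chi(\alpha;l)}(\mathbf x-\hat{\mathbf x})^{\gamma},$$ where $\gamma$ runs over multi-indices up to permutation and $\gamma!$ is the product of the factorials of the multiplicities of its entries. Let $e_1$ be the unit vector of the constant monomial $1$. With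 $h=T/N$ ($N\ge1$ an integer) and $t_n=nh$, put $\mathbf X_0=(\varepsilon^\nu\mathbf u_{\rm in},0)$ and let $\mathbf X_{n+1}-\mathbf X_n$ be the vector of the $d+1$ components, at the monomials $x_i-\hat x_i$, of $$\exp\!\Big(\big(\tfrac1\varepsilon A_1^{[k]}(\mathbf X_n)+A_0^{[k]}(\mathbf X_n)\big)h\Big)e_1 .$$ Let $\mathbf U_n$ consist of the first $d$ components of $\mathbf X_n$. **Theorem 4.3.** There is a constant $C>0$, depending only on $A$, $T$, $k$, $\mathbf u_{\rm in}$ and $\mathbf F$, such that for all $\nu\ge1$, all $\varepsilon>0$, every solution $\mathbf u$ of the problem on $[0,T]$ and every step size $h=T/N$ with $$\frac{2\pi\varepsilon}{\mu}<h<\frac1{C\varepsilon},$$ one has $$\|\mathbf U_n-\mathbf u(t_n)\|\le C\,\varepsilon\,h^k,\qquad n=0,1,\dots,N,$$ where $\|\cdot\|$ is the Euclidean norm. -/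

import Mathlib

open scoped Nat NNReal

noncomputable section

namespace LLE

/-- The state space `𝕜^d` (with `𝕜 = ℝ` or `ℂ`) with the Euclidean norm. -/
abbrev State (𝕜 : Type*) [RCLike 𝕜] (d : ℕ) : Type _ := EuclideanSpace 𝕜 (Fin d)

/-- A matrix over `𝕜`, regarded as a complex matrix. -/
def complexify {𝕜 : Type*} [RCLike 𝕜] {d : ℕ} (A : Matrix (Fin d) (Fin d) 𝕜) :
    Matrix (Fin d) (Fin d) ℂ :=
  A.map (RCLike.map 𝕜 ℂ)

/-- Diagonalizability over `ℂ`: `Q⁻¹ A Q = Λ` with `Q` invertible and `Λ` diagonal. -/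
def IsDiagonalizable {d : ℕ} (A : Matrix (Fin d) (Fin d) ℂ) : Prop :=
  ∃ (Q : Matrix (Fin d) (Fin d) ℂ) (Λ : Fin d → ℂ), IsUnit Q ∧ Q⁻¹ * A * Q = Matrix.diagonal Λ

/-- All eigenvalues are purely imaginary: of the form `i ω` with `ω` real and nonzero. -/
def HasPurelyImaginarySpectrum {d : ℕ} (A : Matrix (Fin d) (Fin d) ℂ) : Prop :=
  ∀ z ∈ spectrum ℂ A, z.re = 0 ∧ z ≠ 0

/-- `u` solves `u' = ε⁻¹ A u + F(u, t)` on `[0, T]` with `u(0) = u₀`. -/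
def IsSolution {𝕜 : Type*} [RCLike 𝕜] {d : ℕ} (A : Matrix (Fin d) (Fin d) 𝕜)
    (F : State 𝕜 d → ℝ → State 𝕜 d) (T ε : ℝ) (u₀ : State 𝕜 d) (u : ℝ → State 𝕜 d) : Prop :=
  u 0 = u₀ ∧ ∀ t ∈ Set.Icc (0 : ℝ) T,
    HasDerivWithinAt u (ε⁻¹ • Matrix.toEuclideanLin A (u t) + F (u t) t) (Set.Icc 0 T) t

/-! ### The augmented system

The augmented variable is `x = (u, t)`; its coordinates are indexed by `Fin (d + 1)`, the last
coordinate being the time. -/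

/-- The augmented matrix, with blocks `A, 0` and `0, 0`. -/
def augMatrix {𝕜 : Type*} [RCLike 𝕜] {d : ℕ} (A : Matrix (Fin d) (Fin d) 𝕜) :
    Matrix (Fin (d + 1)) (Fin (d + 1)) 𝕜 :=
  Matrix.of fun i => Fin.lastCases (motive := fun _ => Fin (d + 1) → 𝕜)
    (fun _ => 0) (fun p => Fin.snoc (α := fun _ => 𝕜) (A p) 0) i

/-- The coordinates of the augmented variable `x = (u, t)`. -/
def augCoord {𝕜 : Type*} [RCLike 𝕜] {d : ℕ} (x : State 𝕜 d × ℝ) : Fin (d + 1) → 𝕜 :=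
  Fin.snoc (α := fun _ => 𝕜) (fun p => x.1 p) (x.2 : 𝕜)

/-- The components of the augmented nonlinearity `f(x) = (F(u, t), 1)`. -/
def augField {𝕜 : Type*} [RCLike 𝕜] {d : ℕ} (F : State 𝕜 d → ℝ → State 𝕜 d) :
    Fin (d + 1) → State 𝕜 d × ℝ → 𝕜 :=
  Fin.snoc (α := fun _ => State 𝕜 d × ℝ → 𝕜) (fun p x => F x.1 x.2 p) (fun _ => 1)

/-- The partial derivative `∂g/∂xᵢ` of a function on `𝕜^d × [0, T]`: a derivative over `𝕜` in the
coordinates of `u`, and a derivative over `ℝ` (one-sided at the two end points) in the time. -/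
def partialD {𝕜 : Type*} [RCLike 𝕜] {d : ℕ} (T : ℝ) (i : Fin (d + 1))
    (g : State 𝕜 d × ℝ → 𝕜) : State 𝕜 d × ℝ → 𝕜 := fun x =>
  Fin.lastCases (motive := fun _ => 𝕜)
    (derivWithin (fun s : ℝ => g (x.1, s)) (Set.Icc 0 T) x.2)
    (fun p => lineDeriv 𝕜 (fun v : State 𝕜 d => g (v, x.2)) x.1 (EuclideanSpace.single p 1)) i

/-- The iterated partial derivative `∂ʲg / ∂x_{α₁} ⋯ ∂x_{αⱼ}` for `α = (α₁, …, αⱼ)`. -/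
def iterPartialD {𝕜 : Type*} [RCLike 𝕜] {d : ℕ} (T : ℝ) (α : List (Fin (d + 1)))
    (g : State 𝕜 d × ℝ → 𝕜) : State 𝕜 d × ℝ → 𝕜 :=
  α.foldr (partialD T) g

/-- All partial derivatives of `F` up to order `k` exist on `𝕜^d × [0, T]`, and they are (with `F`
itself) Lipschitz in `(u, t)` on bounded sets. -/
structure LipschitzDerivatives {𝕜 : Type*} [RCLike 𝕜] {d : ℕ} (k : ℕ) (T : ℝ)
    (F : State 𝕜 d → ℝ → State 𝕜 d) : Prop where
  /-- the derivatives in the coordinates of `u` exist -/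
  differentiable_state : ∀ (q p : Fin d) (α : List (Fin (d + 1))), α.length < k →
    ∀ u : State 𝕜 d, ∀ t ∈ Set.Icc (0 : ℝ) T,
      LineDifferentiableAt 𝕜
        (fun v : State 𝕜 d => iterPartialD T α (fun x => F x.1 x.2 q) (v, t)) u
        (EuclideanSpace.single p 1)
  /-- the derivatives in the time exist -/
  differentiable_time : ∀ (q : Fin d) (α : List (Fin (d + 1))), α.length < k →
    ∀ u : State 𝕜 d, ∀ t ∈ Set.Icc (0 : ℝ) T,
      DifferentiableWithinAt ℝ
        (fun s : ℝ => iterPartialD T α (fun x => F x.1 x.2 q) (u, s)) (Set.Icc 0 T) t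
  /-- the derivatives are Lipschitz -/
  lipschitz : ∀ (q : Fin d) (α : List (Fin (d + 1))), α.length ≤ k → ∀ R : ℝ, ∃ L : ℝ≥0,
    LipschitzOnWith L (iterPartialD T α (fun x => F x.1 x.2 q))
      (Metric.closedBall (0 : State 𝕜 d) R ×ˢ Set.Icc (0 : ℝ) T)

/-- The Taylor coefficient `(1 / γ!) ∂^γ g (x̂)` of the monomial `(x - x̂)^γ`; the multi-index `γ`
is a multiset of coordinates, represented by its ascending list. -/
def taylorCoeff {𝕜 : Type*} [RCLike 𝕜] {d : ℕ} (T : ℝ) (g : State 𝕜 d × ℝ → 𝕜)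
    (xhat : State 𝕜 d × ℝ) (γ : Multiset (Fin (d + 1))) : 𝕜 :=
  iterPartialD T (γ.sort (· ≤ ·)) g xhat / ((∏ i, (γ.count i)! : ℕ) : 𝕜)

/-! ### The local linear extension -/

/-- The index set of the `k`-th order local linear extension variable: the monomials `(x - x̂)^α`
of degree at most `k`, that is, the multi-indices `α ∈ {1, …, d+1}^j` (`0 ≤ j ≤ k`) modulo
permutation of their entries. Vectors and matrices are indexed by the monomials themselves, which
fixes the scheme for any ordering of them. -/
abbrev ExtIndex (d k : ℕ) : Type := Σ j : Fin (k + 1), Sym (Fin (d + 1)) j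

/-- The multiset of entries of a multi-index. -/
def ExtIndex.entries {d k : ℕ} (α : ExtIndex d k) : Multiset (Fin (d + 1)) :=
  (α.2 : Multiset (Fin (d + 1)))

/-- The constant monomial `1`. -/
def ExtIndex.const (d k : ℕ) : ExtIndex d k := ⟨⟨0, k.succ_pos⟩, Sym.nil⟩

/-- The monomial `xᵢ - x̂ᵢ` of degree one. -/
def ExtIndex.linear {d k : ℕ} (hk : 1 ≤ k) (i : Fin (d + 1)) : ExtIndex d k :=
  ⟨⟨1, Nat.lt_succ_of_le hk⟩, i ::ₛ Sym.nil⟩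

/-- The matrix `A₁^[k](x̂)` of the `O(1/ε)` terms. With `χ = α` minus one entry `i`, the row of `α`
collects, for each entry `i` of `α` (with multiplicity), the terms
`∑ₘ (A₁)ᵢₘ (x - x̂)^χ (xₘ - x̂ₘ) + ∑ₘ (A₁)ᵢₘ x̂ₘ (x - x̂)^χ`. -/
def extMatrixOne {𝕜 : Type*} [RCLike 𝕜] {d : ℕ} (k : ℕ) (A : Matrix (Fin d) (Fin d) 𝕜)
    (xhat : State 𝕜 d × ℝ) : Matrix (ExtIndex d k) (ExtIndex d k) 𝕜 :=
  Matrix.of fun α β => (α.entries.map fun i => ∑ m : Fin (d + 1), augMatrix A i m *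
    ((if β.entries = m ::ₘ α.entries.erase i then 1 else 0) +
      (if β.entries = α.entries.erase i then augCoord xhat m else 0))).sum

/-- The matrix `A₀^[k](x̂)` of the `O(1)` terms. With `χ = α` minus one entry `i`, the row of `α`
collects, for each entry `i` of `α` (with multiplicity), the terms
`∑_γ (1 / γ!) ∂^γ fᵢ(x̂) (x - x̂)^(χ + γ)` over the `γ` with `|χ| + |γ| ≤ k`;
the column of `β = χ + γ` receives the coefficient of `γ = β - χ`. -/
def extMatrixZero {𝕜 : Type*} [RCLike 𝕜] {d : ℕ} (k : ℕ) (T : ℝ)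
    (F : State 𝕜 d → ℝ → State 𝕜 d) (xhat : State 𝕜 d × ℝ) :
    Matrix (ExtIndex d k) (ExtIndex d k) 𝕜 :=
  Matrix.of fun α β => (α.entries.map fun i =>
    if α.entries.erase i ≤ β.entries then
      taylorCoeff T (augField F i) xhat (β.entries - α.entries.erase i) else 0).sum

/-- The extension variable at the end of a step: `exp ((ε⁻¹ A₁^[k](x̂) + A₀^[k](x̂)) h) e₁`, the
value at time `h` of the solution of the truncated linear system started at `e₁`. -/
def extStep {𝕜 : Type*} [RCLike 𝕜] {d : ℕ} (k : ℕ) (A : Matrix (Fin d) (Fin d) 𝕜)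
    (F : State 𝕜 d → ℝ → State 𝕜 d) (T ε h : ℝ) (xhat : State 𝕜 d × ℝ) : ExtIndex d k → 𝕜 :=
  Matrix.mulVec
    (NormedSpace.exp (h • (ε⁻¹ • extMatrixOne k A xhat + extMatrixZero k T F xhat)))
    (Pi.single (ExtIndex.const d k) 1)

/-- One step `Xₙ ↦ Xₙ₊₁` of the integrator: the components of degree one of the extension variable
are added to `Xₙ`. (The time component is real, being equal to `h`.) -/
def step {𝕜 : Type*} [RCLike 𝕜] {d k : ℕ} (hk : 1 ≤ k) (A : Matrix (Fin d) (Fin d) 𝕜)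
    (F : State 𝕜 d → ℝ → State 𝕜 d) (T ε h : ℝ) (X : State 𝕜 d × ℝ) : State 𝕜 d × ℝ :=
  (X.1 + WithLp.toLp 2 (fun p : Fin d =>
      extStep k A F T ε h X (ExtIndex.linear hk p.castSucc)),
    X.2 + RCLike.re (extStep k A F T ε h X (ExtIndex.linear hk (Fin.last d))))

/-- The numerical solution `Xₙ`, started at `X₀ = (u₀, 0)`. -/
def augNumSol {𝕜 : Type*} [RCLike 𝕜] {d k : ℕ} (hk : 1 ≤ k) (A : Matrix (Fin d) (Fin d) 𝕜)
    (F : State 𝕜 d → ℝ → State 𝕜 d) (T ε h : ℝ) (u₀ : State 𝕜 d) (n : ℕ) : State 𝕜 d × ℝ :=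
  (step hk A F T ε h)^[n] (u₀, 0)

/-- The numerical solution `Uₙ`. -/
def numSol {𝕜 : Type*} [RCLike 𝕜] {d k : ℕ} (hk : 1 ≤ k) (A : Matrix (Fin d) (Fin d) 𝕜)
    (F : State 𝕜 d → ℝ → State 𝕜 d) (T ε h : ℝ) (u₀ : State 𝕜 d) (n : ℕ) : State 𝕜 d :=
  (augNumSol hk A F T ε h u₀ n).1

end LLE

end

/-! Along the exact solution, the monomials in x - x̂ satisfy the linear system that defines the
integrator, except for a forcing by Taylor remainders of f. The difference between exact and
numerical monomials therefore solves a linear system made of three pieces: the action of A₁/ε,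
lower-order coefficients, and that forcing.

The action of A₁/ε is harmless despite its size: in eigencoordinates it is diagonal in every degree,
with sums of imaginary eigenvalues on the diagonal (`coordChange_linearAction`), and such rotations
drop out of Gronwall's inequality (`norm_le_of_rotating`). The remaining coefficients are bounded
because A₁x̂/ε is: the exact solution is O(ε) (`exists_solution_bound`), and so is the numerical one
as long as it stays within O(ε) of it.

The factor ε in the error comes from the forcing. Since u - x̂ is O(ε) and ε is O(h), the Taylor
remainder agrees up to O(ε h^k) with the remainder in time alone, taken at frozen u
(`norm_taylorRemainder_sub_le`). The latter has no factor ε, but it varies slowly, and A is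
invertible. Adding ε w to the error, where w solves A w = (slow forcing), removes it and leaves only
ε w' (`linearAction_correction`, `hasDerivWithinAt_correctedError`). The forcing is then O(ε h^k),
and one step adds O(ε h^(k+1)) to the error (`exists_step_bound`).

The constant of a step depends on the size of the current error in units of ε, so the errors are
summed by a bootstrap (`exists_accumulated_bound`). If h is small, the accumulated bound itself
keeps the error below ε. If h is not small, the number of steps is bounded, and constants that grow
from step to step do no harm.

The lower restriction on h gives ε ≤ c h, so powers of ε are dominated by powers of h; combined with
the upper restriction it forces ε to be small. -/

noncomputable section

namespace LLE

/-! ### Monomials and sums over the entries of a multi-index -/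

section Monom

variable {σ R : Type*}

/-- The monomial `ξ^α`. -/
def monom [CommMonoid R] (ξ : σ → R) (α : Multiset σ) : R := (α.map ξ).prod

theorem monom_cons [CommMonoid R] (ξ : σ → R) (i : σ) (α : Multiset σ) :
    monom ξ (i ::ₘ α) = ξ i * monom ξ α := by simp [monom]

theorem monom_add [CommMonoid R] (ξ : σ → R) (α β : Multiset σ) :
    monom ξ (α + β) = monom ξ α * monom ξ β := by simp [monom]

theorem norm_monom_le [NormedField R] {ξ : σ → R} {η : ℝ} (hη : ∀ i, ‖ξ i‖ ≤ η)
    (α : Multiset σ) : ‖monom ξ α‖ ≤ η ^ α.card := by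
  induction α using Multiset.induction_on with
  | empty => simp [monom]
  | cons a α ih =>
    have h0 : 0 ≤ η := (norm_nonneg _).trans (hη a)
    rw [monom_cons, norm_mul, Multiset.card_cons, pow_succ']
    exact mul_le_mul (hη a) ih (norm_nonneg _) h0

end Monom

section EntrySum

variable {σ R : Type*} [DecidableEq σ]

/-- The sum `∑ κ i (α - i)` over the entries `i` of the multi-index `α`. -/
def entrySum [AddCommMonoid R] (κ : σ → Multiset σ → R) (α : Multiset σ) : R :=
  (α.map fun i => κ i (α.erase i)).sum

theorem entrySum_zero [AddCommMonoid R] (κ : σ → Multiset σ → R) : entrySum κ 0 = 0 := by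
  simp [entrySum]

/-- A product rule: either the new entry `m` is the one removed, or it stays in the monomial while
another entry is removed. -/
theorem entrySum_cons [AddCommMonoid R] (κ : σ → Multiset σ → R) (m : σ) (χ : Multiset σ) :
    entrySum κ (m ::ₘ χ) = κ m χ + entrySum (fun j β => κ j (m ::ₘ β)) χ := by
  unfold entrySum
  rw [Multiset.map_cons, Multiset.sum_cons, Multiset.erase_cons_head]
  congr 2
  exact Multiset.map_congr rfl fun j hj => by rw [Multiset.erase_cons_tail_of_mem hj]

theorem entrySum_congr [AddCommMonoid R] {κ κ' : σ → Multiset σ → R} {α : Multiset σ}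
    (h : ∀ i ∈ α, κ i (α.erase i) = κ' i (α.erase i)) : entrySum κ α = entrySum κ' α := by
  unfold entrySum
  rw [Multiset.map_congr rfl h]

theorem entrySum_add [AddCommMonoid R] (κ κ' : σ → Multiset σ → R) (α : Multiset σ) :
    entrySum (fun i χ => κ i χ + κ' i χ) α = entrySum κ α + entrySum κ' α :=
  Multiset.sum_map_add

theorem entrySum_sub [AddCommGroup R] (κ κ' : σ → Multiset σ → R) (α : Multiset σ) :
    entrySum (fun i χ => κ i χ - κ' i χ) α = entrySum κ α - entrySum κ' α :=
  Multiset.sum_map_sub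

theorem entrySum_mul_left [NonUnitalNonAssocSemiring R] (c : R) (κ : σ → Multiset σ → R)
    (α : Multiset σ) : entrySum (fun i χ => c * κ i χ) α = c * entrySum κ α :=
  Multiset.sum_map_mul_left

theorem entrySum_eq_zero [AddCommMonoid R] {κ : σ → Multiset σ → R} {α : Multiset σ}
    (h : ∀ i ∈ α, κ i (α.erase i) = 0) : entrySum κ α = 0 := by
  rw [entrySum_congr (κ' := fun _ _ => 0) h]
  simp [entrySum]

theorem entrySum_finset_sum [AddCommMonoid R] {ι : Type*} (s : Finset ι)
    (κ : ι → σ → Multiset σ → R) (α : Multiset σ) :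
    entrySum (fun i χ => ∑ m ∈ s, κ m i χ) α = ∑ m ∈ s, entrySum (κ m) α :=
  Multiset.sum_map_sum_map _ _ |>.trans rfl

theorem map_entrySum {S : Type*} [AddCommMonoid R] [AddCommMonoid S] (f : R →+ S)
    (κ : σ → Multiset σ → R) (α : Multiset σ) :
    f (entrySum κ α) = entrySum (fun i χ => f (κ i χ)) α := by
  unfold entrySum
  rw [map_multiset_sum, Multiset.map_map]
  rfl

theorem norm_entrySum_le [SeminormedAddCommGroup R] {κ : σ → Multiset σ → R} {α : Multiset σ}
    {b : ℝ} (h : ∀ i ∈ α, ‖κ i (α.erase i)‖ ≤ b) : ‖entrySum κ α‖ ≤ α.card * b := by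
  unfold entrySum
  have key : ∀ β : Multiset σ, (∀ i ∈ β, i ∈ α) →
      ‖(β.map fun i => κ i (α.erase i)).sum‖ ≤ β.card * b := by
    intro β
    induction β using Multiset.induction_on with
    | empty => intro _; simp
    | cons a β ih =>
      intro hβ
      simp only [Multiset.map_cons, Multiset.sum_cons, Multiset.card_cons, Nat.cast_add,
        Nat.cast_one]
      have h1 := h a (hβ a (Multiset.mem_cons_self _ _))
      have h2 := ih fun i hi => hβ i (Multiset.mem_cons_of_mem hi)
      exact (norm_add_le _ _).trans (by linarith)
  exact key α fun _ h => h

theorem hasDerivWithinAt_entrySum {𝕜 : Type*} [RCLike 𝕜] {κ κ' : ℝ → σ → Multiset σ → 𝕜}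
    {α : Multiset σ} {s : ℝ} {I : Set ℝ}
    (h : ∀ i ∈ α, HasDerivWithinAt (fun τ => κ τ i (α.erase i)) (κ' s i (α.erase i)) I s) :
    HasDerivWithinAt (fun τ => entrySum (κ τ) α) (entrySum (κ' s) α) I s := by
  unfold entrySum
  have key : ∀ β : Multiset σ, (∀ i ∈ β, i ∈ α) →
      HasDerivWithinAt (fun τ => (β.map fun i => κ τ i (α.erase i)).sum)
        ((β.map fun i => κ' s i (α.erase i)).sum) I s := by
    intro β
    induction β using Multiset.induction_on with
    | empty => intro _; simpa using hasDerivWithinAt_const s I (0 : 𝕜)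
    | cons a β ih =>
      intro hβ
      simp only [Multiset.map_cons, Multiset.sum_cons]
      exact (h a (hβ a (Multiset.mem_cons_self _ _))).add
        (ih fun i hi => hβ i (Multiset.mem_cons_of_mem hi))
  exact key α fun _ h => h

theorem hasDerivWithinAt_monom {𝕜 : Type*} [RCLike 𝕜] {ξ : ℝ → σ → 𝕜} {ξ' : σ → 𝕜}
    {s : ℝ} {I : Set ℝ} (h : ∀ i, HasDerivWithinAt (fun τ => ξ τ i) (ξ' i) I s)
    (α : Multiset σ) :
    HasDerivWithinAt (fun τ => monom (ξ τ) α)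
      (entrySum (fun i χ => monom (ξ s) χ * ξ' i) α) I s := by
  induction α using Multiset.induction_on with
  | empty => simpa [monom, entrySum] using hasDerivWithinAt_const s I (1 : 𝕜)
  | cons a α ih =>
    simp only [monom_cons, entrySum_cons]
    convert! (h a).mul ih using 1
    rw [← entrySum_mul_left]
    simp only [mul_comm, mul_left_comm]

/-- The action of the linear vector field `x ↦ A x` on families indexed by monomials. -/
def linearAction [Fintype σ] [Semiring R] (A : Matrix σ σ R) (e : Multiset σ → R)
    (α : Multiset σ) : R :=
  entrySum (fun i χ => ∑ m, A i m * e (m ::ₘ χ)) α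

theorem linearAction_cons [Fintype σ] [Semiring R] (A : Matrix σ σ R) (e : Multiset σ → R)
    (i : σ) (α : Multiset σ) :
    linearAction A e (i ::ₘ α) =
      ∑ m, A i m * e (m ::ₘ α) + linearAction A (fun β => e (i ::ₘ β)) α := by
  unfold linearAction
  rw [entrySum_cons]
  simp only [Multiset.cons_swap]

end EntrySum

/-! ### Linear change of the coordinates in families indexed by monomials -/

section CoordChange

variable {σ R : Type*} [Fintype σ]

/-- If `e` is regarded as a linear functional on polynomials, given by its values on monomials,
this is its value on the product of the linear forms `∑ i, P a i xᵢ` over the entries `a` of a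
list. -/
def coordChange [Semiring R] (P : Matrix σ σ R) : (Multiset σ → R) → List σ → R
  | e, [] => e 0
  | e, a :: l => ∑ i, P a i * coordChange P (fun α => e (i ::ₘ α)) l

theorem coordChange_add [Semiring R] (P : Matrix σ σ R) (e e' : Multiset σ → R) (l : List σ) :
    coordChange P (fun α => e α + e' α) l = coordChange P e l + coordChange P e' l := by
  induction l generalizing e e' with
  | nil => rfl
  | cons a l ih => simp only [coordChange, ih, mul_add, Finset.sum_add_distrib]

theorem coordChange_mul [CommSemiring R] (P : Matrix σ σ R) (c : R) (e : Multiset σ → R)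
    (l : List σ) : coordChange P (fun α => c * e α) l = c * coordChange P e l := by
  induction l generalizing e with
  | nil => rfl
  | cons a l ih => simp only [coordChange, ih, Finset.mul_sum, mul_left_comm]

theorem coordChange_zero [Semiring R] (P : Matrix σ σ R) (l : List σ) :
    coordChange P (fun _ => 0) l = 0 := by
  induction l with
  | nil => rfl
  | cons a l ih => simp [coordChange, ih]

theorem coordChange_sum [CommSemiring R] {ι : Type*} (P : Matrix σ σ R) (s : Finset ι)
    (c : ι → R) (e : ι → Multiset σ → R) (l : List σ) :
    coordChange P (fun α => ∑ m ∈ s, c m * e m α) l = ∑ m ∈ s, c m * coordChange P (e m) l := by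
  classical
  induction s using Finset.induction_on with
  | empty => simp [coordChange_zero]
  | insert a s ha ih => simp only [Finset.sum_insert ha, coordChange_add, coordChange_mul, ih]

/-- The linear field acts on polynomials as a derivation, and the rows of `P` are left eigenvectors,
so each linear form is an eigenvector. By the product rule a product of such forms is again one, and
the eigenvalues add up. -/
theorem coordChange_linearAction [DecidableEq σ] [CommRing R] {P A : Matrix σ σ R} {Λ : σ → R}
    (h : P * A = Matrix.diagonal Λ * P) (e : Multiset σ → R) (l : List σ) :
    coordChange P (linearAction A e) l = (l.map Λ).sum * coordChange P e l := by
  induction l generalizing e with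
  | nil => simp [coordChange, linearAction, entrySum]
  | cons a l ih =>
    have hP : ∀ m, ∑ i, P a i * A i m = Λ a * P a m := fun m => by
      have := congrFun (congrFun h a) m
      rwa [Matrix.diagonal_mul, Matrix.mul_apply] at this
    simp only [coordChange, linearAction_cons, coordChange_add, coordChange_sum, ih, mul_add,
      Finset.sum_add_distrib, List.map_cons, List.sum_cons, add_mul, Finset.mul_sum]
    congr 1
    · rw [Finset.sum_comm]
      refine Finset.sum_congr rfl fun m _ => ?_
      rw [← mul_assoc, ← hP, Finset.sum_mul]
      simp only [mul_assoc]
    · exact Finset.sum_congr rfl fun m _ => by ring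

theorem coordChange_congr [Semiring R] (P : Matrix σ σ R) {e e' : Multiset σ → R} (l : List σ)
    (h : ∀ α, α.card = l.length → e α = e' α) : coordChange P e l = coordChange P e' l := by
  induction l generalizing e e' with
  | nil => exact h 0 rfl
  | cons a l ih =>
    refine Finset.sum_congr rfl fun i _ => ?_
    rw [ih fun α hα => h (i ::ₘ α) (by simp [hα])]

theorem coordChange_monom [CommSemiring R] (P : Matrix σ σ R) (ξ : σ → R) (l : List σ) :
    coordChange P (monom ξ) l = (l.map (P.mulVec ξ)).prod := by
  induction l with
  | nil => simp [coordChange, monom]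
  | cons a l ih =>
    have h : ∀ i, (fun α => monom ξ (i ::ₘ α)) = fun α => ξ i * monom ξ α := fun i =>
      funext fun α => monom_cons ξ i α
    simp only [coordChange, h, coordChange_mul, ih, List.map_cons, List.prod_cons,
      Matrix.mulVec, dotProduct, Finset.sum_mul, mul_assoc]

theorem norm_coordChange_le [NormedField R] {P : Matrix σ σ R} {p b : ℝ}
    (hP : ∀ a, ∑ i, ‖P a i‖ ≤ p) {e : Multiset σ → R} {l : List σ}
    (h : ∀ α, α.card = l.length → ‖e α‖ ≤ b) : ‖coordChange P e l‖ ≤ p ^ l.length * b := by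
  induction l generalizing e with
  | nil => simpa [coordChange] using h 0 rfl
  | cons a l ih =>
    have hb : ∀ i, ‖coordChange P (fun α => e (i ::ₘ α)) l‖ ≤ p ^ l.length * b :=
      fun i => ih fun α hα => h (i ::ₘ α) (by simp [hα])
    have h0 : 0 ≤ p ^ l.length * b := (norm_nonneg _).trans (hb a)
    calc ‖coordChange P e (a :: l)‖ ≤ ∑ i, ‖P a i‖ * (p ^ l.length * b) := by
          refine (norm_sum_le _ _).trans (Finset.sum_le_sum fun i _ => ?_)
          rw [norm_mul]
          exact mul_le_mul_of_nonneg_left (hb i) (norm_nonneg _)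
      _ ≤ p * (p ^ l.length * b) := by
          rw [← Finset.sum_mul]
          exact mul_le_mul_of_nonneg_right (hP a) h0
      _ = p ^ (a :: l).length * b := by rw [List.length_cons]; ring

/-- The change of coordinates is undone one entry at a time: weighting the values at `a :: l'` by `Q
j a` and summing frees the entry `j`, because `Q * P = 1`. With `norm_coordChange_le` it makes both
descriptions equivalent up to factors that do not involve ε. -/
theorem norm_le_of_coordChange_le [DecidableEq σ] [NormedField R] {P Q : Matrix σ σ R} {q b : ℝ}
    (hQP : Q * P = 1) (hQ : ∀ a, ∑ i, ‖Q a i‖ ≤ q) {e : Multiset σ → R} {l : List σ}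
    (h : ∀ l' : List σ, l'.length = l.length → ‖coordChange P e l'‖ ≤ b) :
    ‖e l‖ ≤ q ^ l.length * b := by
  induction l generalizing e b with
  | nil => simpa [coordChange] using h [] rfl
  | cons j l ih =>
    have key : ∀ l', coordChange P (fun α => e (j ::ₘ α)) l' =
        ∑ a, Q j a * coordChange P e (a :: l') := fun l' => by
      simp only [coordChange, Finset.mul_sum]
      rw [Finset.sum_comm]
      have hQPj : ∀ i, ∑ a, Q j a * P a i = if j = i then 1 else 0 := fun i => by
        rw [← Matrix.mul_apply, hQP, Matrix.one_apply]
      simp_rw [← mul_assoc, ← Finset.sum_mul, hQPj]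
      simp
    have := ih (e := fun α => e (j ::ₘ α)) (b := q * b) fun l' hl' => by
      rw [key]
      have hb : 0 ≤ b := (norm_nonneg _).trans (h (j :: l) rfl)
      refine (norm_sum_le _ _).trans ?_
      refine le_trans (Finset.sum_le_sum (g := fun a => ‖Q j a‖ * b) fun a _ => ?_) ?_
      · rw [norm_mul]
        exact mul_le_mul_of_nonneg_left (h _ (by simp [hl'])) (norm_nonneg _)
      · rw [← Finset.sum_mul]
        exact mul_le_mul_of_nonneg_right (hQ j) hb
    refine this.trans (le_of_eq ?_)
    rw [List.length_cons]; ring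

theorem hasDerivWithinAt_coordChange {P : Matrix σ σ ℂ} {e : ℝ → Multiset σ → ℂ}
    {e' : Multiset σ → ℂ} {s : ℝ} {I : Set ℝ} {l : List σ}
    (h : ∀ α, α.card = l.length → HasDerivWithinAt (fun τ => e τ α) (e' α) I s) :
    HasDerivWithinAt (fun τ => coordChange P (e τ) l) (coordChange P e' l) I s := by
  induction l generalizing e e' with
  | nil => exact h 0 rfl
  | cons a l ih =>
    simp only [coordChange]
    exact HasDerivWithinAt.fun_sum fun i _ =>
      (ih fun α hα => h (i ::ₘ α) (by simp [hα])).const_mul (P a i)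

end CoordChange

/-! ### A Gronwall estimate for rapidly rotating systems -/

/-- Multiplying component j by exp(-ω_j s), which has modulus 1, removes ω_j G_j from the equation
and leaves the maximum norm unchanged; the usual Gronwall inequality then applies. The bound does
not see the size of ω, which will be of order 1/ε. -/
theorem norm_le_of_rotating {J : Type*} [Fintype J] {h L δ : ℝ} (hL : 0 ≤ L) (hδ : 0 ≤ δ)
    {ω : J → ℂ} (hω : ∀ j, (ω j).re = 0) {G b : ℝ → J → ℂ}
    (hcont : ∀ j, ContinuousOn (fun s => G s j) (Set.Icc 0 h))
    (hG : ∀ s ∈ Set.Ico 0 h, ∀ j,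
      HasDerivWithinAt (fun τ => G τ j) (ω j * G s j + b s j) (Set.Icc 0 h) s)
    (hb : ∀ s ∈ Set.Ico 0 h, ∀ j, ‖b s j‖ ≤ L * ‖G s‖ + δ) :
    ∀ s ∈ Set.Icc 0 h, ‖G s‖ ≤ Real.exp (L * s) * (‖G 0‖ + δ * s) := by
  set θ : ℝ → J → ℂ := fun s j => Complex.exp (-(ω j * s)) with hθ
  have hθn : ∀ s j, ‖θ s j‖ = 1 := fun s j => by
    rw [hθ, Complex.norm_exp]
    simp [hω j]
  have hθd : ∀ s j, HasDerivAt (fun τ : ℝ => θ τ j) (θ s j * -(ω j)) s := fun s j => by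
    have h1 : HasDerivAt (fun τ : ℝ => -(ω j * (τ : ℂ))) (-(ω j)) s := by
      simpa using (Complex.ofRealCLM.hasDerivAt (x := s)).const_mul (-(ω j))
    exact h1.cexp
  set H : ℝ → J → ℂ := fun s j => θ s j * G s j with hH
  have hHn : ∀ s, ‖H s‖ = ‖G s‖ := fun s => by
    simp only [Pi.norm_def, hH, nnnorm_mul]
    congr 2
    funext j
    rw [show ‖θ s j‖₊ = 1 from NNReal.eq (hθn s j), one_mul]
  have hHc : ContinuousOn H (Set.Icc 0 h) := continuousOn_pi.2 fun j =>
    ContinuousOn.mul (fun s _ => (hθd s j).continuousAt.continuousWithinAt) (hcont j)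
  have hHd : ∀ s ∈ Set.Ico 0 h,
      HasDerivWithinAt H (fun j => θ s j * b s j) (Set.Ici s) s := fun s hs => by
    refine hasDerivWithinAt_pi.2 fun j => ?_
    have h1 := ((hθd s j).hasDerivWithinAt (s := Set.Icc 0 h)).mul (hG s hs j)
    have h2 := h1.mono_of_mem_nhdsWithin (Icc_mem_nhdsGE_of_mem hs)
    convert! h2 using 1
    ring
  intro s hs
  have := norm_le_gronwallBound_of_norm_deriv_right_le (δ := ‖G 0‖) (K := L) (ε := δ) hHc hHd
    (hHn 0).le (fun τ hτ => by
      have h0 : 0 ≤ L * ‖H τ‖ + δ := by positivity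
      refine (pi_norm_le_iff_of_nonneg h0).2 fun j => ?_
      rw [norm_mul, hθn, one_mul, hHn]
      exact hb τ hτ j) s hs
  rw [hHn, sub_zero] at this
  refine this.trans ?_
  have hs0 := hs.1
  rcases hL.eq_or_lt with rfl | hL
  · simp [gronwallBound_K0]
  · rw [gronwallBound_of_K_ne_0 hL.ne', mul_add, mul_comm (Real.exp _) ‖G 0‖]
    beta_reduce
    refine add_le_add le_rfl ?_
    -- The inequality exp(x) - 1 ≤ x exp(x) cancels the division by `L`, so the cases of zero and
    -- positive `L` share one bound.
    have h1 : Real.exp (L * s) - 1 ≤ Real.exp (L * s) * (L * s) := by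
      have h2 := Real.add_one_le_exp (-(L * s))
      have h3 : Real.exp (L * s) * Real.exp (-(L * s)) = 1 := by
        rw [← Real.exp_add]; simp
      nlinarith [Real.exp_pos (L * s)]
    calc δ / L * (Real.exp (L * s) - 1) ≤ δ / L * (Real.exp (L * s) * (L * s)) := by gcongr
      _ = Real.exp (L * s) * (δ * s) := by field_simp

/-! ### Taylor expansion along a segment -/

/-- Here `f a` stands for the `a`-th derivative along a segment, with the increment `c` factored
out. The remainder vanishes at 0, and its derivative is `c` times the remainder of one order less
for the shifted sequence; the mean value inequality thus gains a factor ‖c‖ per order. Only the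
oscillation of `f m` enters, so a Lipschitz bound replaces a derivative of order m + 1. -/
theorem norm_sub_taylor_segment_le {𝕜 : Type*} [RCLike 𝕜] {m : ℕ} {f : ℕ → ℝ → 𝕜} {c : 𝕜} {B : ℝ}
    (hd : ∀ a < m, ∀ σ ∈ Set.Icc (0 : ℝ) 1,
      HasDerivWithinAt (f a) (c * f (a + 1) σ) (Set.Icc 0 1) σ)
    (hB : ∀ σ ∈ Set.Icc (0 : ℝ) 1, ‖f m σ - f m 0‖ ≤ B) :
    ∀ σ ∈ Set.Icc (0 : ℝ) 1,
      ‖f 0 σ - ∑ a ∈ Finset.range (m + 1), f a 0 * ((σ * c) ^ a / (a ! : 𝕜))‖ ≤ B * ‖c‖ ^ m := by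
  induction m generalizing f with
  | zero =>
    intro σ hσ
    simpa using hB σ hσ
  | succ m ih =>
    have ih' := ih (f := fun a => f (a + 1)) (fun a ha => hd (a + 1) (by omega)) hB
    set ψ : ℝ → 𝕜 := fun σ =>
      f 0 σ - ∑ a ∈ Finset.range (m + 1 + 1), f a 0 * ((σ * c) ^ a / (a ! : 𝕜)) with hψ
    have hlin : ∀ σ : ℝ, HasDerivAt (fun τ : ℝ => (τ : 𝕜) * c) c σ := fun σ => by
      simpa using ((RCLike.ofRealCLM (K := 𝕜)).hasDerivAt (x := σ)).mul_const c
    have hψd : ∀ σ ∈ Set.Icc (0 : ℝ) 1, HasDerivWithinAt ψ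
        (c * (f 1 σ - ∑ a ∈ Finset.range (m + 1), f (a + 1) 0 * ((σ * c) ^ a / (a ! : 𝕜))))
        (Set.Icc 0 1) σ := by
      intro σ hσ
      have h1 : HasDerivAt (fun τ : ℝ => ∑ a ∈ Finset.range (m + 1 + 1),
          f a 0 * (((τ : 𝕜) * c) ^ a / (a ! : 𝕜)))
          (∑ a ∈ Finset.range (m + 1 + 1),
            f a 0 * (((a : ℕ) * ((σ : 𝕜) * c) ^ (a - 1) * c) / (a ! : 𝕜))) σ :=
        HasDerivAt.fun_sum fun a _ => (((hlin σ).fun_pow a).div_const _).const_mul _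
      convert! (hd 0 (by omega) σ hσ).sub h1.hasDerivWithinAt using 1
      rw [Finset.sum_range_succ' _ (m + 1), mul_sub, Finset.mul_sum]
      simp only [zero_add, Nat.cast_zero, zero_mul, zero_div, mul_zero, add_zero]
      congr 1
      refine Finset.sum_congr rfl fun a _ => ?_
      rw [Nat.factorial_succ, Nat.add_sub_cancel]
      have h2 : (a ! : 𝕜) ≠ 0 := by exact_mod_cast a.factorial_ne_zero
      have h3 : ((a : 𝕜) + 1) ≠ 0 := by exact_mod_cast a.succ_ne_zero
      push_cast
      field_simp
    have hψ0 : ψ 0 = 0 := by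
      simp only [hψ, Finset.sum_range_succ' _ (m + 1)]
      simp
    intro σ hσ
    have hB0 : 0 ≤ B := (norm_nonneg _).trans (hB 0 (by simp))
    have := (convex_Icc (0 : ℝ) 1).norm_image_sub_le_of_norm_hasDerivWithin_le hψd
      (C := B * ‖c‖ ^ (m + 1)) (fun τ hτ => by
        rw [norm_mul, pow_succ, ← mul_assoc, mul_comm]
        exact mul_le_mul_of_nonneg_right (ih' τ hτ) (norm_nonneg _)) (x := 0) (y := σ) (by simp) hσ
    rw [hψ0, sub_zero] at this
    refine this.trans ?_
    rw [sub_zero, Real.norm_of_nonneg hσ.1]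
    exact mul_le_of_le_one_right (by positivity) hσ.2

/-! ### The monomials of bounded degree -/

/-- The multi-indices of degree at most `m`. -/
def multiIndices (d m : ℕ) : Finset (Multiset (Fin (d + 1))) :=
  (Finset.univ : Finset (ExtIndex d m)).image ExtIndex.entries

theorem mem_multiIndices {d m : ℕ} {γ : Multiset (Fin (d + 1))} :
    γ ∈ multiIndices d m ↔ γ.card ≤ m := by
  simp only [multiIndices, Finset.mem_image, Finset.mem_univ, true_and]
  constructor
  · rintro ⟨⟨j, s⟩, rfl⟩
    have : (s : Multiset (Fin (d + 1))).card = j := s.2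
    simp only [ExtIndex.entries, this]
    omega
  · intro h
    exact ⟨⟨⟨γ.card, by omega⟩, ⟨γ, rfl⟩⟩, rfl⟩

theorem entries_injective {d k : ℕ} : Function.Injective (ExtIndex.entries (d := d) (k := k)) := by
  rintro ⟨⟨i, hi⟩, ⟨s, hs⟩⟩ ⟨⟨j, hj⟩, ⟨t, ht⟩⟩ h
  change s = t at h
  simp only at hs ht
  subst h hs ht
  rfl

theorem card_entries_le {d k : ℕ} (α : ExtIndex d k) : α.entries.card ≤ k :=
  mem_multiIndices.1 (Finset.mem_image_of_mem _ (Finset.mem_univ α))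

/-- The multi-indices of degree at most `m` all of whose entries are at least `j`. -/
def multiIndicesFrom (d j m : ℕ) : Finset (Multiset (Fin (d + 1))) :=
  (multiIndices d m).filter fun γ => ∀ i ∈ γ, j ≤ i.val

theorem mem_multiIndicesFrom {d j m : ℕ} {γ : Multiset (Fin (d + 1))} :
    γ ∈ multiIndicesFrom d j m ↔ γ.card ≤ m ∧ ∀ i ∈ γ, j ≤ i.val := by
  simp [multiIndicesFrom, mem_multiIndices]

theorem multiIndicesFrom_zero (d m : ℕ) : multiIndicesFrom d 0 m = multiIndices d m := by
  ext; simp [mem_multiIndicesFrom, mem_multiIndices]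

theorem multiIndicesFrom_top (d m : ℕ) : multiIndicesFrom d (d + 1) m = {0} := by
  ext γ
  simp only [mem_multiIndicesFrom, Finset.mem_singleton]
  constructor
  · rintro ⟨_, h⟩
    refine Multiset.eq_zero_of_forall_notMem fun i hi => ?_
    have := h i hi
    omega
  · rintro rfl
    simp

/-- A multi-index with entries at least `i` is the multiplicity of `i` together with a multi-index
whose entries are larger. This unrolls a Taylor polynomial one coordinate at a time. -/
theorem sum_multiIndicesFrom {M : Type*} [AddCommMonoid M] {d m : ℕ} (i : Fin (d + 1))
    (g : Multiset (Fin (d + 1)) → M) :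
    ∑ γ ∈ multiIndicesFrom d i m, g γ = ∑ γ ∈ multiIndicesFrom d (i + 1) m,
      ∑ a ∈ Finset.range (m - γ.card + 1), g (Multiset.replicate a i + γ) := by
  rw [Finset.sum_sigma']
  symm
  have hcount : ∀ γ : Multiset (Fin (d + 1)), (∀ x ∈ γ, i.val + 1 ≤ x.val) → i ∉ γ :=
    fun γ h hi => by have := h i hi; omega
  refine Finset.sum_bij' (fun x _ => Multiset.replicate x.2 i + x.1)
    (fun γ _ => ⟨γ.filter (· ≠ i), γ.count i⟩) ?_ ?_ ?_ ?_ ?_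
  · rintro ⟨γ, a⟩ h
    simp only [Finset.mem_sigma, mem_multiIndicesFrom, Finset.mem_range] at h
    simp only [mem_multiIndicesFrom, Multiset.card_add, Multiset.card_replicate,
      Multiset.mem_add]
    refine ⟨by omega, fun x hx => ?_⟩
    rcases hx with hx | hx
    · rw [Multiset.eq_of_mem_replicate hx]
    · have := h.1.2 x hx; omega
  · intro γ h
    rw [mem_multiIndicesFrom] at h
    have h1 : (γ.filter (· ≠ i)).card + γ.count i = γ.card := by
      have := congrArg Multiset.card (Multiset.filter_add_not (fun x => x = i) γ)
      rw [Multiset.card_add, Multiset.filter_eq', Multiset.card_replicate] at this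
      simp only [ne_eq]
      omega
    simp only [Finset.mem_sigma, mem_multiIndicesFrom, Finset.mem_range, Multiset.mem_filter]
    refine ⟨⟨by omega, fun x hx => ?_⟩, by omega⟩
    have h2 := h.2 x hx.1
    have h3 : x.val ≠ i.val := fun h => hx.2 (Fin.ext h)
    omega
  · rintro ⟨γ, a⟩ h
    simp only [Finset.mem_sigma, mem_multiIndicesFrom, Finset.mem_range] at h
    have hi := hcount γ h.1.2
    have h1 : (Multiset.replicate a i).filter (· ≠ i) = 0 := by
      rw [Multiset.filter_eq_nil]
      intro x hx
      simp [Multiset.eq_of_mem_replicate hx]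
    have h2 : γ.filter (· ≠ i) = γ := by
      rw [Multiset.filter_eq_self]
      rintro x hx rfl
      exact hi hx
    simp only [Multiset.filter_add, h1, h2, Multiset.count_add, Multiset.count_replicate_self,
      Multiset.count_eq_zero_of_notMem hi, zero_add, add_zero]
  · intro γ _
    have := Multiset.filter_add_not (fun x => x = i) γ
    rwa [Multiset.filter_eq'] at this
  · intros; rfl

/-- In the ascending list the smallest coordinate comes first, so its derivatives are the outermost
ones. That is the order produced by expanding a derivative in larger coordinates with respect to a
smaller one, and the symmetry of mixed derivatives is not needed. -/
theorem sort_replicate_add {d : ℕ} (i : Fin (d + 1)) (a : ℕ) {γ : Multiset (Fin (d + 1))}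
    (h : ∀ x ∈ γ, i ≤ x) :
    (Multiset.replicate a i + γ).sort (· ≤ ·) = List.replicate a i ++ γ.sort (· ≤ ·) := by
  induction a with
  | zero => simp
  | succ a ih =>
    rw [Multiset.replicate_succ, Multiset.cons_add, Multiset.sort_cons, ih, List.replicate_succ,
      List.cons_append]
    intro x hx
    rcases Multiset.mem_add.1 hx with hx | hx
    · exact (Multiset.eq_of_mem_replicate hx).ge
    · exact h x hx

theorem prod_factorial_replicate_add {d : ℕ} (i : Fin (d + 1)) (a : ℕ)
    {γ : Multiset (Fin (d + 1))} (h : i ∉ γ) :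
    ∏ x, ((Multiset.replicate a i + γ).count x)! = a ! * ∏ x, (γ.count x)! := by
  have h1 : ∀ x, ((Multiset.replicate a i + γ).count x)! =
      (if x = i then a ! else 1) * (γ.count x)! := fun x => by
    rw [Multiset.count_add, Multiset.count_replicate]
    by_cases hx : x = i
    · subst hx; simp [Multiset.count_eq_zero_of_notMem h]
    · simp [hx, Ne.symm hx]
  simp only [h1, Finset.prod_mul_distrib, Finset.prod_ite_eq', Finset.mem_univ, if_true]

section

variable {𝕜 : Type*} [RCLike 𝕜] {d k : ℕ} {T : ℝ}

/-! ### Scalar fields with Lipschitz partial derivatives -/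

/-- All partial derivatives of the scalar field `g` up to order `k` exist on `𝕜^d × [0, T]` and are
Lipschitz on bounded sets. -/
structure IsLipschitzField (k : ℕ) (T : ℝ) (g : State 𝕜 d × ℝ → 𝕜) : Prop where
  /-- the derivatives in the coordinates of `u` exist -/
  differentiable_state : ∀ (p : Fin d) (α : List (Fin (d + 1))), α.length < k →
    ∀ u : State 𝕜 d, ∀ t ∈ Set.Icc (0 : ℝ) T,
      LineDifferentiableAt 𝕜 (fun v : State 𝕜 d => iterPartialD T α g (v, t)) u
        (EuclideanSpace.single p 1)
  /-- the derivatives in the time exist -/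
  differentiable_time : ∀ α : List (Fin (d + 1)), α.length < k →
    ∀ u : State 𝕜 d, ∀ t ∈ Set.Icc (0 : ℝ) T,
      DifferentiableWithinAt ℝ (fun s : ℝ => iterPartialD T α g (u, s)) (Set.Icc 0 T) t
  /-- the derivatives are Lipschitz -/
  lipschitz : ∀ α : List (Fin (d + 1)), α.length ≤ k → ∀ R : ℝ, ∃ L : ℝ≥0,
    LipschitzOnWith L (iterPartialD T α g)
      (Metric.closedBall (0 : State 𝕜 d) R ×ˢ Set.Icc (0 : ℝ) T)

theorem iterPartialD_const (T : ℝ) (α : List (Fin (d + 1))) (hα : α ≠ []) (c : 𝕜) :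
    iterPartialD T α (fun _ : State 𝕜 d × ℝ => c) = fun _ => 0 := by
  have hstep : ∀ (i : Fin (d + 1)) (c : 𝕜),
      partialD T i (fun _ : State 𝕜 d × ℝ => c) = fun _ => 0 := by
    intro i c
    funext x
    induction i using Fin.lastCases with
    | last => simp [partialD]
    | cast p => simp [partialD, lineDeriv]
  induction α with
  | nil => exact absurd rfl hα
  | cons i α ih =>
    change partialD T i (iterPartialD T α fun _ => c) = _
    by_cases h : α = []
    · subst h; exact hstep i c
    · rw [ih h]; exact hstep i 0

theorem isLipschitzField_const (k : ℕ) (T : ℝ) (c : 𝕜) :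
    IsLipschitzField k T (fun _ : State 𝕜 d × ℝ => c) := by
  have h : ∀ α : List (Fin (d + 1)), ∃ c' : 𝕜,
      iterPartialD T α (fun _ : State 𝕜 d × ℝ => c) = fun _ => c' := fun α => by
    by_cases hα : α = []
    · subst hα; exact ⟨c, rfl⟩
    · exact ⟨0, iterPartialD_const T α hα c⟩
  refine ⟨fun p α _ u t _ => ?_, fun α _ u t _ => ?_, fun α _ R => ?_⟩ <;>
    obtain ⟨c', hc'⟩ := h α <;> rw [hc']
  · simp [LineDifferentiableAt]
  · exact differentiableWithinAt_const c'
  · exact ⟨0, (LipschitzWith.const c').lipschitzOnWith⟩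

theorem isLipschitzField_augField {F : State 𝕜 d → ℝ → State 𝕜 d}
    (hF : LipschitzDerivatives k T F) (i : Fin (d + 1)) : IsLipschitzField k T (augField F i) := by
  induction i using Fin.lastCases with
  | last => simpa [augField] using isLipschitzField_const k T (1 : 𝕜)
  | cast q =>
    simp only [augField, Fin.snoc_castSucc]
    exact ⟨hF.differentiable_state q, hF.differentiable_time q, hF.lipschitz q⟩

namespace IsLipschitzField

variable {g : State 𝕜 d × ℝ → 𝕜}

theorem hasDerivWithinAt_time (hg : IsLipschitzField k T g) {α : List (Fin (d + 1))}
    (hα : α.length < k) (u : State 𝕜 d) {t : ℝ} (ht : t ∈ Set.Icc (0 : ℝ) T) :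
    HasDerivWithinAt (fun s => iterPartialD T α g (u, s))
      (iterPartialD T (Fin.last d :: α) g (u, t)) (Set.Icc 0 T) t := by
  have := (hg.differentiable_time α hα u t ht).hasDerivWithinAt
  convert! this using 1
  change partialD T (Fin.last d) (iterPartialD T α g) (u, t) = _
  simp [partialD]

theorem hasDerivAt_state (hg : IsLipschitzField k T g) {α : List (Fin (d + 1))}
    (hα : α.length < k) (p : Fin d) (u : State 𝕜 d) {t : ℝ} (ht : t ∈ Set.Icc (0 : ℝ) T) :
    HasDerivAt (fun τ : 𝕜 => iterPartialD T α g (u + τ • EuclideanSpace.single p 1, t))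
      (iterPartialD T (p.castSucc :: α) g (u, t)) 0 := by
  have := (hg.differentiable_state p α hα u t ht).hasLineDerivAt
  unfold HasLineDerivAt at this
  convert! this using 1
  change partialD T p.castSucc (iterPartialD T α g) (u, t) = _
  simp [partialD]

/-- Uniform Lipschitz and upper bounds of all the partial derivatives on a bounded set. -/
theorem exists_bound (hg : IsLipschitzField k T g) (hT : 0 ≤ T) (R : ℝ) :
    ∃ L : ℝ, 0 ≤ L ∧ ∀ α : List (Fin (d + 1)), α.length ≤ k →
      (∀ u v : State 𝕜 d, ‖u‖ ≤ R → ‖v‖ ≤ R → ∀ s ∈ Set.Icc (0 : ℝ) T, ∀ t ∈ Set.Icc (0 : ℝ) T,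
        ‖iterPartialD T α g (u, s) - iterPartialD T α g (v, t)‖ ≤ L * max ‖u - v‖ |s - t|) ∧
      ∀ u : State 𝕜 d, ‖u‖ ≤ R → ∀ s ∈ Set.Icc (0 : ℝ) T, ‖iterPartialD T α g (u, s)‖ ≤ L := by
  have hone : ∀ α : List (Fin (d + 1)), ∃ L : ℝ, 0 ≤ L ∧ (α.length ≤ k →
      (∀ u v : State 𝕜 d, ‖u‖ ≤ R → ‖v‖ ≤ R → ∀ s ∈ Set.Icc (0 : ℝ) T, ∀ t ∈ Set.Icc (0 : ℝ) T,
        ‖iterPartialD T α g (u, s) - iterPartialD T α g (v, t)‖ ≤ L * max ‖u - v‖ |s - t|) ∧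
      ∀ u : State 𝕜 d, ‖u‖ ≤ R → ∀ s ∈ Set.Icc (0 : ℝ) T,
        ‖iterPartialD T α g (u, s)‖ ≤ L) := by
    intro α
    by_cases hα : α.length ≤ k
    swap
    · exact ⟨0, le_rfl, fun h => absurd h hα⟩
    obtain ⟨L, hL⟩ := hg.lipschitz α hα R
    have h1 : ∀ u v : State 𝕜 d, ‖u‖ ≤ R → ‖v‖ ≤ R → ∀ s ∈ Set.Icc (0 : ℝ) T,
        ∀ t ∈ Set.Icc (0 : ℝ) T,
        ‖iterPartialD T α g (u, s) - iterPartialD T α g (v, t)‖ ≤ L * max ‖u - v‖ |s - t| := by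
      intro u v hu hv s hs t ht
      have := hL.dist_le_mul (u, s) ⟨by simpa using hu, hs⟩ (v, t) ⟨by simpa using hv, ht⟩
      rwa [dist_eq_norm, Prod.dist_eq, dist_eq_norm, Real.dist_eq] at this
    set b : ℝ := ‖iterPartialD T α g (0, 0)‖ + L * max R T with hb
    refine ⟨max L b, le_max_of_le_left L.2, fun _ => ⟨fun u v hu hv s hs t ht => ?_,
      fun u hu s hs => ?_⟩⟩
    · refine (h1 u v hu hv s hs t ht).trans ?_
      gcongr
      exact le_max_left _ _
    · have hR : 0 ≤ R := (norm_nonneg _).trans hu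
      have := h1 u 0 hu (by simpa using hR) s hs 0 ⟨le_rfl, hT⟩
      refine le_trans ?_ (le_max_right _ _)
      have h2 : (L : ℝ) * max ‖u - 0‖ |s - 0| ≤ L * max R T := by
        rw [sub_zero, sub_zero, abs_of_nonneg hs.1]
        gcongr
        exact hs.2
      have h3 := norm_le_norm_add_norm_sub' (iterPartialD T α g (u, s)) (iterPartialD T α g (0, 0))
      linarith
  choose L hL0 hL using hone
  -- Only finitely many lists have length at most `k`, so the sum of the individual constants serves
  -- for all of them.
  have hfin : {α : List (Fin (d + 1)) | α.length ≤ k}.Finite := List.finite_length_le _ _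
  set Lm : ℝ := ∑ α ∈ hfin.toFinset, L α with hLm
  have hle : ∀ α : List (Fin (d + 1)), α.length ≤ k → L α ≤ Lm := fun α hα =>
    Finset.single_le_sum (f := L) (fun β _ => hL0 β) (hfin.mem_toFinset.2 hα)
  refine ⟨Lm, Finset.sum_nonneg fun β _ => hL0 β, fun α hα => ⟨fun u v hu hv s hs t ht => ?_,
    fun u hu s hs => ?_⟩⟩
  · refine ((hL α hα).1 u v hu hv s hs t ht).trans ?_
    gcongr
    exact hle α hα
  · exact ((hL α hα).2 u hu s hs).trans (hle α hα)

/-- Taylor expansion in one coordinate of the state. -/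
theorem norm_sub_taylor_coord_le (hg : IsLipschitzField k T g) {R L : ℝ}
    (hL : ∀ α : List (Fin (d + 1)), α.length ≤ k → ∀ u v : State 𝕜 d, ‖u‖ ≤ R → ‖v‖ ≤ R →
      ∀ s ∈ Set.Icc (0 : ℝ) T, ∀ t ∈ Set.Icc (0 : ℝ) T,
        ‖iterPartialD T α g (u, s) - iterPartialD T α g (v, t)‖ ≤ L * max ‖u - v‖ |s - t|)
    (hL0 : 0 ≤ L) {m : ℕ} {α : List (Fin (d + 1))} (hα : α.length + m ≤ k) (p : Fin d)
    {u : State 𝕜 d} {c : 𝕜} (hu : ‖u‖ ≤ R) (hu' : ‖u + c • EuclideanSpace.single p 1‖ ≤ R)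
    {t : ℝ} (ht : t ∈ Set.Icc (0 : ℝ) T) :
    ‖iterPartialD T α g (u + c • EuclideanSpace.single p 1, t) -
      ∑ a ∈ Finset.range (m + 1),
        iterPartialD T (List.replicate a p.castSucc ++ α) g (u, t) * (c ^ a / (a ! : 𝕜))‖
      ≤ L * ‖c‖ ^ (m + 1) := by
  set e : State 𝕜 d := EuclideanSpace.single p 1 with he
  have hmem : ∀ σ ∈ Set.Icc (0 : ℝ) 1, ‖u + ((σ : 𝕜) * c) • e‖ ≤ R := by
    intro σ hσ
    have h1 : u + ((σ : 𝕜) * c) • e = ((1 - σ : ℝ) : 𝕜) • u + (σ : 𝕜) • (u + c • e) := by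
      rw [smul_add, smul_smul]
      push_cast
      module
    rw [h1]
    refine (norm_add_le _ _).trans ?_
    rw [norm_smul, norm_smul, RCLike.norm_ofReal, RCLike.norm_ofReal, abs_of_nonneg hσ.1,
      abs_of_nonneg (by linarith [hσ.2])]
    nlinarith [hσ.1, hσ.2]
  have hd : ∀ a < m, ∀ σ ∈ Set.Icc (0 : ℝ) 1,
      HasDerivWithinAt (fun σ : ℝ =>
        iterPartialD T (List.replicate a p.castSucc ++ α) g (u + ((σ : 𝕜) * c) • e, t))
        (c * iterPartialD T (List.replicate (a + 1) p.castSucc ++ α) g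
          (u + ((σ : 𝕜) * c) • e, t)) (Set.Icc 0 1) σ := by
    intro a ha σ _
    have h1 := hg.hasDerivAt_state (α := List.replicate a p.castSucc ++ α)
      (by simp; omega) p (u + ((σ : 𝕜) * c) • e) ht
    have h2 : HasDerivAt (fun τ : ℝ => ((τ : 𝕜) - σ) * c) c σ := by
      simpa using (((RCLike.ofRealCLM (K := 𝕜)).hasDerivAt (x := σ)).sub_const (σ : 𝕜)).mul_const c
    have h3 := HasDerivAt.scomp (h := fun τ : ℝ => ((τ : 𝕜) - σ) * c) σ
      (by simpa using h1) h2
    refine (h3.congr_of_eventuallyEq (Filter.Eventually.of_forall fun τ => ?_)).hasDerivWithinAt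
    change _ = iterPartialD T (List.replicate a p.castSucc ++ α) g
      (u + ((σ : 𝕜) * c) • e + (((τ : 𝕜) - σ) * c) • e, t)
    congr 2
    module
  have := norm_sub_taylor_segment_le (m := m) (c := c) (B := L * ‖c‖) hd (fun σ hσ => by
    refine (hL _ (by simp; omega) _ _ (hmem σ hσ) (hmem 0 (by simp)) t ht t ht).trans ?_
    gcongr
    simp only [sub_self, abs_zero, map_zero, zero_mul, zero_smul, add_zero, add_sub_cancel_left]
    rw [norm_smul, norm_mul, RCLike.norm_ofReal, abs_of_nonneg hσ.1, he,
      PiLp.norm_single, norm_one, mul_one]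
    exact max_le (mul_le_of_le_one_left (norm_nonneg _) hσ.2) (norm_nonneg _)) 1 (by simp)
  simpa [pow_succ', mul_assoc] using this

end IsLipschitzField

/-! ### Taylor expansion of a scalar field -/

/-- The remainder of the Taylor expansion of order `m` in the time alone. -/
def timeRemainder (T : ℝ) (g : State 𝕜 d × ℝ → 𝕜) (m : ℕ) (x : State 𝕜 d × ℝ) (s : ℝ) : 𝕜 :=
  g (x.1, x.2 + s) - ∑ b ∈ Finset.range (m + 1),
    iterPartialD T (List.replicate b (Fin.last d)) g x * ((s : 𝕜) ^ b / (b ! : 𝕜))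

/-- The derivative of `timeRemainder`. -/
def timeRemainderDeriv (T : ℝ) (g : State 𝕜 d × ℝ → 𝕜) (m : ℕ) (x : State 𝕜 d × ℝ) (s : ℝ) : 𝕜 :=
  iterPartialD T [Fin.last d] g (x.1, x.2 + s) - ∑ b ∈ Finset.range m,
    iterPartialD T (List.replicate (b + 1) (Fin.last d)) g x * ((s : 𝕜) ^ b / (b ! : 𝕜))

/-- The uniform bounds on a bounded set that are used in the Taylor estimates. -/
def HasLipschitzBound (k : ℕ) (T : ℝ) (g : State 𝕜 d × ℝ → 𝕜) (R L : ℝ) : Prop :=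
  ∀ α : List (Fin (d + 1)), α.length ≤ k → ∀ u v : State 𝕜 d, ‖u‖ ≤ R → ‖v‖ ≤ R →
    ∀ s ∈ Set.Icc (0 : ℝ) T, ∀ t ∈ Set.Icc (0 : ℝ) T,
      ‖iterPartialD T α g (u, s) - iterPartialD T α g (v, t)‖ ≤ L * max ‖u - v‖ |s - t|

/-- The point with the first `j` coordinates of `u` and the others of `v`. -/
def mixedState (j : ℕ) (u v : State 𝕜 d) : State 𝕜 d :=
  WithLp.toLp 2 fun p => if p.val < j then u p else v p

theorem mixedState_zero (u v : State 𝕜 d) : mixedState 0 u v = v := by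
  ext p; simp [mixedState]

theorem mixedState_self (u v : State 𝕜 d) : mixedState d u v = u := by
  ext p; simp [mixedState]

theorem mixedState_succ (p : Fin d) (u v : State 𝕜 d) :
    mixedState (p + 1) u v = mixedState p u v + (u p - v p) • EuclideanSpace.single p 1 := by
  ext q
  simp only [mixedState, PiLp.add_apply, PiLp.smul_apply, PiLp.single_apply, smul_eq_mul]
  rcases lt_trichotomy q p with h | h | h
  · have h1 : q.val < p.val := h
    simp [h1, h1.trans (Nat.lt_succ_self _), h.ne]
  · subst h; simp
  · have h1 : p.val < q.val := h
    have h2 : ¬ q.val < p.val + 1 := by omega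
    have h3 : ¬ q.val < p.val := by omega
    simp [h2, h3, h.ne']

theorem norm_mixedState_le (j : ℕ) (u v : State 𝕜 d) : ‖mixedState j u v‖ ≤ ‖u‖ + ‖v‖ := by
  refine le_of_sq_le_sq ?_ (by positivity)
  have h1 : ‖mixedState j u v‖ ^ 2 ≤ ‖u‖ ^ 2 + ‖v‖ ^ 2 := by
    rw [EuclideanSpace.norm_sq_eq, EuclideanSpace.norm_sq_eq, EuclideanSpace.norm_sq_eq,
      ← Finset.sum_add_distrib]
    refine Finset.sum_le_sum fun p _ => ?_
    simp only [mixedState]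
    split_ifs
    · exact le_add_of_nonneg_right (sq_nonneg _)
    · exact le_add_of_nonneg_left (sq_nonneg _)
  nlinarith [norm_nonneg u, norm_nonneg v]

/-! ### Taylor remainders in time and in all coordinates -/

namespace IsLipschitzField

variable {g : State 𝕜 d × ℝ → 𝕜}

theorem hasDerivWithinAt_time_segment (hg : IsLipschitzField k T g) {α : List (Fin (d + 1))}
    (hα : α.length < k) (u : State 𝕜 d) {t s : ℝ} (ht : 0 ≤ t) (hs : 0 ≤ s) (hts : t + s ≤ T) :
    ∀ σ ∈ Set.Icc (0 : ℝ) 1,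
      HasDerivWithinAt (fun σ => iterPartialD T α g (u, t + σ * s))
        ((s : 𝕜) * iterPartialD T (Fin.last d :: α) g (u, t + σ * s)) (Set.Icc 0 1) σ := by
  intro σ hσ
  have hmaps : ∀ σ ∈ Set.Icc (0 : ℝ) 1, t + σ * s ∈ Set.Icc 0 T := fun σ hσ =>
    ⟨add_nonneg ht (mul_nonneg hσ.1 hs), by nlinarith [hσ.2]⟩
  have h1 := hg.hasDerivWithinAt_time hα u (hmaps σ hσ)
  have h2 : HasDerivWithinAt (fun σ : ℝ => t + σ * s) s (Set.Icc 0 1) σ := by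
    simpa using (((hasDerivAt_id σ).mul_const s).const_add t).hasDerivWithinAt
  have h3 := HasDerivWithinAt.scomp (h := fun σ : ℝ => t + σ * s) σ h1 h2 hmaps
  rwa [RCLike.real_smul_eq_coe_mul] at h3

theorem norm_timeRemainder_le (hg : IsLipschitzField k T g) {R L : ℝ}
    (hL : HasLipschitzBound k T g R L) (hL0 : 0 ≤ L) {m : ℕ} (hm : m ≤ k) {u : State 𝕜 d}
    (hu : ‖u‖ ≤ R) {t s : ℝ} (ht : 0 ≤ t) (hs : 0 ≤ s) (hts : t + s ≤ T) :
    ‖timeRemainder T g m (u, t) s‖ ≤ L * s ^ (m + 1) := by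
  have := norm_sub_taylor_segment_le (m := m) (c := (s : 𝕜)) (B := L * s)
    (f := fun a σ => iterPartialD T (List.replicate a (Fin.last d)) g (u, t + σ * s))
    (fun a ha => hg.hasDerivWithinAt_time_segment (by simp; omega) u ht hs hts) (fun σ hσ => by
      have h0 := mul_nonneg hσ.1 hs
      have h1 : σ * s ≤ s := mul_le_of_le_one_left hs hσ.2
      refine (hL _ (by simpa using hm) u u hu hu _ ⟨by linarith, by linarith⟩ _
        ⟨by linarith, by linarith⟩).trans ?_
      gcongr
      rw [sub_self, norm_zero, zero_mul, add_zero, add_sub_cancel_left, abs_of_nonneg h0]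
      exact max_le hs h1) 1 (by simp)
  rw [RCLike.norm_ofReal, abs_of_nonneg hs] at this
  rw [pow_succ', ← mul_assoc]
  simpa [timeRemainder, iterPartialD] using this

/-- The difference is the time remainder of g(u, ·) - g(v, ·), whose m-th time derivative is at most
L ‖u - v‖. Compared with `norm_timeRemainder_le`, one power of `s` is traded for the factor ‖u - v‖.
-/
theorem norm_timeRemainder_sub_le (hg : IsLipschitzField k T g) {R L : ℝ}
    (hL : HasLipschitzBound k T g R L) {m : ℕ} (hm : m ≤ k)
    {u v : State 𝕜 d} (hu : ‖u‖ ≤ R) (hv : ‖v‖ ≤ R) {t s : ℝ} (ht : 0 ≤ t) (hs : 0 ≤ s)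
    (hts : t + s ≤ T) :
    ‖timeRemainder T g m (u, t) s - timeRemainder T g m (v, t) s‖ ≤ 2 * L * ‖u - v‖ * s ^ m := by
  have hb : ∀ τ ∈ Set.Icc (0 : ℝ) T, ‖iterPartialD T (List.replicate m (Fin.last d)) g (u, τ) -
      iterPartialD T (List.replicate m (Fin.last d)) g (v, τ)‖ ≤ L * ‖u - v‖ := fun τ hτ => by
    simpa using hL (List.replicate m (Fin.last d)) (by simpa using hm) u v hu hv τ hτ τ hτ
  have := norm_sub_taylor_segment_le (m := m) (c := (s : 𝕜)) (B := 2 * L * ‖u - v‖)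
    (f := fun a σ => iterPartialD T (List.replicate a (Fin.last d)) g (u, t + σ * s) -
      iterPartialD T (List.replicate a (Fin.last d)) g (v, t + σ * s))
    (fun a ha σ hσ => by
      rw [mul_sub]
      exact (hg.hasDerivWithinAt_time_segment (by simp; omega) u ht hs hts σ hσ).sub
        (hg.hasDerivWithinAt_time_segment (by simp; omega) v ht hs hts σ hσ)) (fun σ hσ => by
      have h0 := mul_nonneg hσ.1 hs
      have h1 : σ * s ≤ s := mul_le_of_le_one_left hs hσ.2
      refine (norm_sub_le _ _).trans ?_
      have h2 := hb (t + σ * s) ⟨by linarith, by linarith⟩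
      have h3 := hb (t + 0 * s) ⟨by linarith, by linarith⟩
      linarith) 1 (by simp)
  rw [RCLike.norm_ofReal, abs_of_nonneg hs] at this
  refine le_trans (le_of_eq ?_) this
  congr 1
  simp only [timeRemainder, sub_mul, Finset.sum_sub_distrib, List.replicate_zero, iterPartialD,
    List.foldr_nil, one_mul, RCLike.ofReal_one, zero_mul, add_zero]
  ring

theorem hasDerivWithinAt_timeRemainder (hg : IsLipschitzField k T g) (hk : 1 ≤ k) (m : ℕ)
    (u : State 𝕜 d) {t h : ℝ} (ht : 0 ≤ t) (hth : t + h ≤ T) :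
    ∀ s ∈ Set.Icc 0 h, HasDerivWithinAt (timeRemainder T g m (u, t))
      (timeRemainderDeriv T g m (u, t) s) (Set.Icc 0 h) s := by
  intro s hs
  have hmaps : ∀ s ∈ Set.Icc (0 : ℝ) h, t + s ∈ Set.Icc 0 T := fun s hs =>
    ⟨add_nonneg ht hs.1, by linarith [hs.2]⟩
  have h1 : HasDerivWithinAt (fun s => g (u, t + s)) (iterPartialD T [Fin.last d] g (u, t + s))
      (Set.Icc 0 h) s := by
    have h2 := hg.hasDerivWithinAt_time (α := []) (by simpa using Nat.lt_of_lt_of_le Nat.zero_lt_one hk) u (hmaps s hs)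
    have h3 : HasDerivWithinAt (fun s : ℝ => t + s) 1 (Set.Icc 0 h) s :=
      ((hasDerivAt_id s).const_add t).hasDerivWithinAt
    have h4 := HasDerivWithinAt.scomp (h := fun s : ℝ => t + s) s h2 h3 hmaps
    rw [one_smul] at h4
    exact h4
  have h4 : HasDerivAt (fun τ : ℝ => ∑ b ∈ Finset.range (m + 1),
      iterPartialD T (List.replicate b (Fin.last d)) g (u, t) * ((τ : 𝕜) ^ b / (b ! : 𝕜)))
      (∑ b ∈ Finset.range (m + 1), iterPartialD T (List.replicate b (Fin.last d)) g (u, t) *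
        ((b : ℕ) * (s : 𝕜) ^ (b - 1) * 1 / (b ! : 𝕜))) s :=
    HasDerivAt.fun_sum fun b _ => ((((RCLike.ofRealCLM (K := 𝕜)).hasDerivAt (x := s)).congr_deriv
      (by simp)).fun_pow b |>.div_const _).const_mul _
  convert! h1.sub h4.hasDerivWithinAt using 1
  rw [Finset.sum_range_succ' _ m, timeRemainderDeriv]
  simp only [Nat.cast_zero, zero_mul, zero_div, mul_zero, add_zero]
  congr 1
  refine Finset.sum_congr rfl fun a _ => ?_
  rw [Nat.factorial_succ, Nat.add_sub_cancel]
  have h2 : (a ! : 𝕜) ≠ 0 := by exact_mod_cast a.factorial_ne_zero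
  have h3 : ((a : 𝕜) + 1) ≠ 0 := by exact_mod_cast a.succ_ne_zero
  push_cast
  field_simp

/-- This is the time remainder of order m - 1 of ∂g/∂t. For `m = 0` it would be ∂g/∂t itself, which
need not be bounded by the Lipschitz constant of its order; hence `1 ≤ m`. -/
theorem norm_timeRemainderDeriv_le (hg : IsLipschitzField k T g) {R L : ℝ}
    (hL : HasLipschitzBound k T g R L) (hL0 : 0 ≤ L) {m : ℕ} (hm1 : 1 ≤ m) (hm : m ≤ k)
    {u : State 𝕜 d} (hu : ‖u‖ ≤ R) {t s : ℝ} (ht : 0 ≤ t) (hs : 0 ≤ s) (hts : t + s ≤ T) :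
    ‖timeRemainderDeriv T g m (u, t) s‖ ≤ L * s ^ m := by
  obtain ⟨m, rfl⟩ : ∃ n, m = n + 1 := ⟨m - 1, by omega⟩
  have := norm_sub_taylor_segment_le (m := m) (c := (s : 𝕜)) (B := L * s)
    (f := fun a σ => iterPartialD T (List.replicate (a + 1) (Fin.last d)) g (u, t + σ * s))
    (fun a ha => hg.hasDerivWithinAt_time_segment (by simp; omega) u ht hs hts) (fun σ hσ => by
      have h0 := mul_nonneg hσ.1 hs
      have h1 : σ * s ≤ s := mul_le_of_le_one_left hs hσ.2
      refine (hL _ (by simpa using hm) u u hu hu _ ⟨by linarith, by linarith⟩ _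
        ⟨by linarith, by linarith⟩).trans ?_
      gcongr
      rw [sub_self, norm_zero, zero_mul, add_zero, add_sub_cancel_left, abs_of_nonneg h0]
      exact max_le hs h1) 1 (by simp)
  rw [RCLike.norm_ofReal, abs_of_nonneg hs] at this
  rw [pow_succ', ← mul_assoc]
  simpa [timeRemainderDeriv, iterPartialD] using this

/-- A telescoping sum over the coordinates of the state. In `τ j` the first `j` coordinates already
have their values from `u`, and the polynomial expands in the others and in time; so `τ 0` is the
full Taylor polynomial at `v` and `τ d` the polynomial in time at `u`. Passing from `τ j` to `τ (j +
1)` is a one-variable Taylor expansion of each coefficient. -/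
theorem norm_sub_taylor_state_le (hg : IsLipschitzField k T g) {R L : ℝ}
    (hL : HasLipschitzBound k T g R L) (hL0 : 0 ≤ L) {m : ℕ} (hm : m ≤ k) {u v : State 𝕜 d}
    (huv : ‖u‖ + ‖v‖ ≤ R) {t η : ℝ} (ht : t ∈ Set.Icc (0 : ℝ) T) {ξ : Fin (d + 1) → 𝕜}
    (hξ : ∀ p : Fin d, ξ p.castSucc = u p - v p) (hη : ∀ i, ‖ξ i‖ ≤ η) :
    ‖∑ b ∈ Finset.range (m + 1), iterPartialD T (List.replicate b (Fin.last d)) g (u, t) *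
        (ξ (Fin.last d) ^ b / (b ! : 𝕜)) -
      ∑ γ ∈ multiIndices d m, taylorCoeff T g (v, t) γ * monom ξ γ‖
      ≤ d * ((multiIndices d m).card * (L * ‖u - v‖ * η ^ m)) := by
  set τ : ℕ → 𝕜 := fun j => ∑ γ ∈ multiIndicesFrom d j m,
    taylorCoeff T g (mixedState j u v, t) γ * monom ξ γ with hτ
  have hη0 : 0 ≤ η := (norm_nonneg _).trans (hη 0)
  have hcoeff : ∀ (i : Fin (d + 1)) (a : ℕ) (γ : Multiset (Fin (d + 1))) (x : State 𝕜 d × ℝ),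
      (∀ x ∈ γ, i.val + 1 ≤ x.val) →
      taylorCoeff T g x (Multiset.replicate a i + γ) * monom ξ (Multiset.replicate a i + γ) =
        monom ξ γ / ((∏ i, (γ.count i)! : ℕ) : 𝕜) *
          (iterPartialD T (List.replicate a i ++ γ.sort (· ≤ ·)) g x *
            (ξ i ^ a / (a ! : 𝕜))) := by
    intro i a γ x hγ
    have hi : i ∉ γ := fun h => by have := hγ i h; omega
    rw [taylorCoeff, sort_replicate_add i a fun x hx => by
      have := hγ x hx; exact Fin.le_def.2 (by omega), prod_factorial_replicate_add i a hi, monom_add]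
    simp only [monom, Multiset.map_replicate, Multiset.prod_replicate]
    push_cast
    rw [mul_comm (a ! : 𝕜), div_mul_eq_div_div]
    ring
  have htop : τ d = ∑ b ∈ Finset.range (m + 1),
      iterPartialD T (List.replicate b (Fin.last d)) g (u, t) *
        (ξ (Fin.last d) ^ b / (b ! : 𝕜)) := by
    simp only [hτ, mixedState_self]
    have := sum_multiIndicesFrom (m := m) (Fin.last d)
      fun γ => taylorCoeff T g (u, t) γ * monom ξ γ
    rw [Fin.val_last] at this
    rw [this, multiIndicesFrom_top, Finset.sum_singleton]
    refine Finset.sum_congr rfl fun a _ => ?_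
    rw [hcoeff (Fin.last d) a 0 _ (by simp)]
    simp [monom]
  have hzero : τ 0 = ∑ γ ∈ multiIndices d m, taylorCoeff T g (v, t) γ * monom ξ γ := by
    simp only [hτ, mixedState_zero, multiIndicesFrom_zero]
  have hstep : ∀ j ∈ Finset.range d,
      ‖τ (j + 1) - τ j‖ ≤ (multiIndices d m).card * (L * ‖u - v‖ * η ^ m) := by
    intro j hj
    have hj' : j < d := Finset.mem_range.1 hj
    set p : Fin d := ⟨j, hj'⟩ with hp
    have h1 : τ j = ∑ γ ∈ multiIndicesFrom d (j + 1) m, ∑ a ∈ Finset.range (m - γ.card + 1),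
        taylorCoeff T g (mixedState j u v, t) (Multiset.replicate a p.castSucc + γ) *
          monom ξ (Multiset.replicate a p.castSucc + γ) :=
      sum_multiIndicesFrom (m := m) p.castSucc
        fun γ => taylorCoeff T g (mixedState j u v, t) γ * monom ξ γ
    rw [h1, ← Finset.sum_sub_distrib]
    have h2 : ∀ γ ∈ multiIndicesFrom d (j + 1) m,
        ‖taylorCoeff T g (mixedState (j + 1) u v, t) γ * monom ξ γ -
          ∑ a ∈ Finset.range (m - γ.card + 1),
            taylorCoeff T g (mixedState j u v, t) (Multiset.replicate a p.castSucc + γ) *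
              monom ξ (Multiset.replicate a p.castSucc + γ)‖ ≤ L * ‖u - v‖ * η ^ m := by
      intro γ hγ
      rw [mem_multiIndicesFrom] at hγ
      rw [Finset.sum_congr rfl fun a _ => hcoeff p.castSucc a γ _ hγ.2, ← Finset.mul_sum]
      have h3 : taylorCoeff T g (mixedState (j + 1) u v, t) γ * monom ξ γ =
          monom ξ γ / ((∏ i, (γ.count i)! : ℕ) : 𝕜) *
            iterPartialD T (γ.sort (· ≤ ·)) g (mixedState (j + 1) u v, t) := by
        rw [taylorCoeff]; ring
      rw [h3, ← mul_sub, norm_mul]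
      have hmix : mixedState (j + 1) u v =
          mixedState j u v + (u p - v p) • EuclideanSpace.single p 1 := mixedState_succ p u v
      have h4 := hg.norm_sub_taylor_coord_le hL hL0 (m := m - γ.card) (α := γ.sort (· ≤ ·))
        (by rw [Multiset.length_sort]; omega) p (u := mixedState j u v) (c := u p - v p)
        ((norm_mixedState_le _ _ _).trans huv)
        (by rw [← hmix]; exact (norm_mixedState_le _ _ _).trans huv) ht
      rw [← hmix, ← hξ] at h4
      have h5 : ‖monom ξ γ / ((∏ i, (γ.count i)! : ℕ) : 𝕜)‖ ≤ η ^ γ.card := by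
        rw [norm_div, RCLike.norm_natCast]
        refine (div_le_self (norm_nonneg _) ?_).trans (norm_monom_le hη γ)
        exact_mod_cast Finset.prod_pos fun i _ => Nat.factorial_pos _
      have h6 : ‖ξ p.castSucc‖ ≤ ‖u - v‖ := by
        rw [hξ]; exact PiLp.norm_apply_le (u - v) p
      -- Of the factors ‖ξ_p‖ in the one-variable remainder, a single one is kept as ‖u - v‖ and the
      -- others are bounded by `η`.
      calc _ ≤ η ^ γ.card * (L * ‖ξ p.castSucc‖ ^ (m - γ.card + 1)) :=
            mul_le_mul h5 h4 (norm_nonneg _) (by positivity)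
        _ ≤ η ^ γ.card * (L * (η ^ (m - γ.card) * ‖u - v‖)) := by
            rw [pow_succ]
            gcongr
            exact hη _
        _ = L * ‖u - v‖ * (η ^ γ.card * η ^ (m - γ.card)) := by ring
        _ = L * ‖u - v‖ * η ^ m := by rw [← pow_add, Nat.add_sub_cancel' hγ.1]
    refine (norm_sum_le_of_le _ h2).trans ?_
    rw [Finset.sum_const, nsmul_eq_mul]
    gcongr
    exact Finset.filter_subset _ _
  rw [← htop, ← hzero, ← Finset.sum_range_sub]
  refine (norm_sum_le_of_le _ hstep).trans (le_of_eq ?_)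
  simp

/-- The remainder of the Taylor expansion is, up to a small term, the one in the time alone. -/
theorem norm_taylorRemainder_sub_le (hg : IsLipschitzField k T g) {R L : ℝ}
    (hL : HasLipschitzBound k T g R L) (hL0 : 0 ≤ L) {m : ℕ} (hm : m ≤ k) {u v : State 𝕜 d}
    (huv : ‖u‖ + ‖v‖ ≤ R) {t s η : ℝ} (ht : 0 ≤ t) (hs : 0 ≤ s) (hts : t + s ≤ T)
    (hη : ‖u - v‖ ≤ η) (hsη : s ≤ η) {ξ : Fin (d + 1) → 𝕜}
    (hξ : ξ = augCoord (u, t + s) - augCoord (v, t)) :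
    ‖g (u, t + s) - ∑ γ ∈ multiIndices d m, taylorCoeff T g (v, t) γ * monom ξ γ -
        timeRemainder T g m (v, t) s‖ ≤
      (2 + d * (multiIndices d m).card) * L * ‖u - v‖ * η ^ m := by
  have hξp : ∀ p : Fin d, ξ p.castSucc = u p - v p := fun p => by simp [hξ, augCoord]
  have hξt : ξ (Fin.last d) = s := by simp [hξ, augCoord]
  have hξη : ∀ i, ‖ξ i‖ ≤ η := fun i => by
    induction i using Fin.lastCases with
    | last => rwa [hξt, RCLike.norm_ofReal, abs_of_nonneg hs]
    | cast p => rw [hξp]; exact (PiLp.norm_apply_le (u - v) p).trans hη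
  have hu : ‖u‖ ≤ R := by linarith [norm_nonneg v]
  have hv : ‖v‖ ≤ R := by linarith [norm_nonneg u]
  have h1 := hg.norm_timeRemainder_sub_le hL hm hu hv ht hs hts
  have h2 := hg.norm_sub_taylor_state_le hL hL0 hm huv (t := t) ⟨ht, by linarith⟩ hξp hξη
  rw [hξt] at h2
  have h3 : s ^ m ≤ η ^ m := pow_le_pow_left₀ hs hsη m
  have h4 : 2 * L * ‖u - v‖ * s ^ m ≤ 2 * L * ‖u - v‖ * η ^ m := by gcongr
  have h5 := norm_add_le_of_le (h1.trans h4) h2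
  refine le_trans (le_of_eq ?_) (h5.trans (le_of_eq (by ring)))
  congr 1
  simp only [timeRemainder]
  ring

end IsLipschitzField

end

section

variable {𝕜 : Type*} [RCLike 𝕜] {d k : ℕ}

/-! ### The truncated linear system -/

/-- A vector indexed by the monomials of degree at most `k`, as a family indexed by all multi-indices
(extended by zero). -/
def extendFamily (y : ExtIndex d k → 𝕜) (α : Multiset (Fin (d + 1))) : 𝕜 :=
  ∑ β, (if β.entries = α then 1 else 0) * y β

theorem extendFamily_entries (y : ExtIndex d k → 𝕜) (α : ExtIndex d k) :
    extendFamily y α.entries = y α := by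
  simp [extendFamily, entries_injective.eq_iff]

theorem exists_entries_eq {α : Multiset (Fin (d + 1))} (hα : α.card ≤ k) :
    ∃ β : ExtIndex d k, β.entries = α :=
  ⟨⟨⟨α.card, Nat.lt_succ_of_le hα⟩, ⟨α, rfl⟩⟩, rfl⟩

/-- Substitutes γ = β - χ. The condition |γ| ≤ k - |χ| says exactly that χ + γ is an admissible
index, so the columns of the matrix and the terms of the Taylor polynomial correspond. -/
theorem sum_mul_extendFamily (y : ExtIndex d k → 𝕜) (χ : Multiset (Fin (d + 1)))
    (c : Multiset (Fin (d + 1)) → 𝕜) :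
    ∑ γ ∈ multiIndices d (k - χ.card), c γ * extendFamily y (χ + γ) =
      ∑ β : ExtIndex d k, (if χ ≤ β.entries then c (β.entries - χ) else 0) * y β := by
  simp only [extendFamily, Finset.mul_sum]
  rw [Finset.sum_comm]
  refine Finset.sum_congr rfl fun β _ => ?_
  split_ifs with h
  · have h1 : β.entries - χ ∈ multiIndices d (k - χ.card) := by
      rw [mem_multiIndices, Multiset.card_sub h]
      exact Nat.sub_le_sub_right (card_entries_le β) _
    rw [Finset.sum_eq_single_of_mem _ h1, if_pos (add_tsub_cancel_of_le h).symm, one_mul]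
    · intro γ _ hγ
      rw [if_neg, zero_mul, mul_zero]
      rintro h2
      exact hγ (by rw [h2, add_tsub_cancel_left])
  · rw [zero_mul]
    refine Finset.sum_eq_zero fun γ _ => ?_
    rw [if_neg, zero_mul, mul_zero]
    rintro h2
    exact h (h2 ▸ Multiset.le_add_right _ _)

theorem entrySum_mul_right {σ R : Type*} [DecidableEq σ] [NonUnitalNonAssocSemiring R]
    (κ : σ → Multiset σ → R) (α : Multiset σ) (c : R) :
    entrySum (fun i χ => κ i χ * c) α = entrySum κ α * c :=
  Multiset.sum_map_mul_right

theorem extMatrixOne_mulVec (A : Matrix (Fin d) (Fin d) 𝕜) (x : State 𝕜 d × ℝ)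
    (y : ExtIndex d k → 𝕜) (α : ExtIndex d k) :
    (extMatrixOne k A x).mulVec y α =
      entrySum (fun i χ => ∑ m, augMatrix A i m *
        (extendFamily y (m ::ₘ χ) + augCoord x m * extendFamily y χ)) α.entries := by
  change ∑ β, entrySum (fun i χ => ∑ m, augMatrix A i m * ((if β.entries = m ::ₘ χ then 1 else 0) +
      (if β.entries = χ then augCoord x m else 0))) α.entries * y β = _
  simp only [← entrySum_mul_right, ← entrySum_finset_sum]
  refine entrySum_congr fun i _ => ?_
  simp only [Finset.sum_mul]
  rw [Finset.sum_comm]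
  refine Finset.sum_congr rfl fun m _ => ?_
  simp only [extendFamily, Finset.mul_sum, ← Finset.sum_add_distrib]
  refine Finset.sum_congr rfl fun β _ => ?_
  split_ifs <;> ring

theorem extMatrixZero_mulVec (T : ℝ) (F : State 𝕜 d → ℝ → State 𝕜 d) (x : State 𝕜 d × ℝ)
    (y : ExtIndex d k → 𝕜) (α : ExtIndex d k) :
    (extMatrixZero k T F x).mulVec y α =
      entrySum (fun i χ => ∑ γ ∈ multiIndices d (k - χ.card),
        taylorCoeff T (augField F i) x γ * extendFamily y (χ + γ)) α.entries := by
  change ∑ β, entrySum (fun i χ => if χ ≤ β.entries then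
      taylorCoeff T (augField F i) x (β.entries - χ) else 0) α.entries * y β = _
  simp only [← entrySum_mul_right, ← entrySum_finset_sum]
  refine entrySum_congr fun i _ => ?_
  rw [sum_mul_extendFamily]

/-- The right-hand side of the truncated linear system, in the row of `α`. -/
def truncatedField (k : ℕ) (A : Matrix (Fin d) (Fin d) 𝕜) (F : State 𝕜 d → ℝ → State 𝕜 d) (T ε : ℝ)
    (x : State 𝕜 d × ℝ) (e : Multiset (Fin (d + 1)) → 𝕜) (i : Fin (d + 1))
    (χ : Multiset (Fin (d + 1))) : 𝕜 :=
  (ε⁻¹ : ℝ) * (∑ m, augMatrix A i m * (e (m ::ₘ χ) + augCoord x m * e χ)) +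
    ∑ γ ∈ multiIndices d (k - χ.card), taylorCoeff T (augField F i) x γ * e (χ + γ)

/-- The analysis uses the matrix exponential only through this differential equation and the initial
value in `extStep_zero`. -/
theorem hasDerivAt_extStep (A : Matrix (Fin d) (Fin d) 𝕜) (F : State 𝕜 d → ℝ → State 𝕜 d)
    (T ε : ℝ) (x : State 𝕜 d × ℝ) (α : ExtIndex d k) (s : ℝ) :
    HasDerivAt (fun τ => extStep k A F T ε τ x α)
      (entrySum (truncatedField k A F T ε x (extendFamily (extStep k A F T ε s x)))
        α.entries) s := by
  set M := ε⁻¹ • extMatrixOne k A x + extMatrixZero k T F x with hM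
  have h1 : HasDerivAt (fun τ : ℝ => NormedSpace.exp (τ • M) α (ExtIndex.const d k))
      ((M * NormedSpace.exp (s • M)) α (ExtIndex.const d k)) s := by
    have : FiniteDimensional ℝ (Matrix (ExtIndex d k) (ExtIndex d k) 𝕜) := Module.Finite.matrix
    let : NormedRing (Matrix (ExtIndex d k) (ExtIndex d k) 𝕜) := Matrix.linftyOpNormedRing
    let : NormedAlgebra ℝ (Matrix (ExtIndex d k) (ExtIndex d k) 𝕜) :=
      Matrix.linftyOpNormedAlgebra
    have := FiniteDimensional.complete ℝ (Matrix (ExtIndex d k) (ExtIndex d k) 𝕜)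
    have h2 := hasDerivAt_exp_smul_const' (𝕂 := ℝ) M s
    exact (LinearMap.toContinuousLinearMap
      (Matrix.entryLinearMap ℝ 𝕜 α (ExtIndex.const d k))).hasFDerivAt.comp_hasDerivAt s h2
  have h3 : ∀ τ : ℝ, extStep k A F T ε τ x =
      fun α => NormedSpace.exp (τ • M) α (ExtIndex.const d k) := fun τ => by
    funext α
    simp [extStep, hM, Matrix.col]
  have h4 : (M * NormedSpace.exp (s • M)) α (ExtIndex.const d k) =
      M.mulVec (extStep k A F T ε s x) α := by
    rw [h3]; rfl
  simp only [h3 _] at h1 ⊢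
  convert! h1 using 1
  rw [h4, hM, Matrix.add_mulVec, Matrix.smul_mulVec, Pi.add_apply, Pi.smul_apply,
    extMatrixOne_mulVec, extMatrixZero_mulVec, RCLike.real_smul_eq_coe_mul, ← entrySum_mul_left,
    ← entrySum_add, ← h3 s]
  rfl

theorem extStep_zero (A : Matrix (Fin d) (Fin d) 𝕜) (F : State 𝕜 d → ℝ → State 𝕜 d)
    (T ε : ℝ) (x : State 𝕜 d × ℝ) :
    extStep k A F T ε 0 x = Pi.single (ExtIndex.const d k) 1 := by
  ext α
  simp [extStep, Matrix.col, Matrix.one_apply, Pi.single_apply, eq_comm]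

/-- The numerical extension variable as a family indexed by multi-indices. -/
def numFamily (k : ℕ) (A : Matrix (Fin d) (Fin d) 𝕜) (F : State 𝕜 d → ℝ → State 𝕜 d) (T ε : ℝ)
    (x : State 𝕜 d × ℝ) (s : ℝ) : Multiset (Fin (d + 1)) → 𝕜 :=
  extendFamily (extStep k A F T ε s x)

theorem hasDerivAt_numFamily (A : Matrix (Fin d) (Fin d) 𝕜) (F : State 𝕜 d → ℝ → State 𝕜 d)
    (T ε : ℝ) (x : State 𝕜 d × ℝ) {α : Multiset (Fin (d + 1))} (hα : α.card ≤ k) (s : ℝ) :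
    HasDerivAt (fun τ => numFamily k A F T ε x τ α)
      (entrySum (truncatedField k A F T ε x (numFamily k A F T ε x s)) α) s := by
  obtain ⟨β, rfl⟩ := exists_entries_eq hα
  simpa only [numFamily, extendFamily_entries] using hasDerivAt_extStep A F T ε x β s

theorem numFamily_zero (A : Matrix (Fin d) (Fin d) 𝕜) (F : State 𝕜 d → ℝ → State 𝕜 d)
    (T ε : ℝ) (x : State 𝕜 d × ℝ) {α : Multiset (Fin (d + 1))} (hα : α.card ≤ k) :
    numFamily k A F T ε x 0 α = if α = 0 then 1 else 0 := by
  obtain ⟨β, rfl⟩ := exists_entries_eq hα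
  have h0 : (ExtIndex.const d k).entries = 0 := rfl
  rw [numFamily, extendFamily_entries, extStep_zero, Pi.single_apply, ← h0]
  simp [entries_injective.eq_iff]

/-! ### The constant and time components, and the step of the integrator -/

theorem augMatrix_last (A : Matrix (Fin d) (Fin d) 𝕜) (m : Fin (d + 1)) :
    augMatrix A (Fin.last d) m = 0 := by simp [augMatrix]

theorem augMatrix_castSucc_castSucc (A : Matrix (Fin d) (Fin d) 𝕜) (p q : Fin d) :
    augMatrix A p.castSucc q.castSucc = A p q := by simp [augMatrix]

theorem augMatrix_castSucc_last (A : Matrix (Fin d) (Fin d) 𝕜) (p : Fin d) :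
    augMatrix A p.castSucc (Fin.last d) = 0 := by simp [augMatrix]

theorem taylorCoeff_augField_last (T : ℝ) (F : State 𝕜 d → ℝ → State 𝕜 d) (x : State 𝕜 d × ℝ)
    (γ : Multiset (Fin (d + 1))) :
    taylorCoeff T (augField F (Fin.last d)) x γ = if γ = 0 then 1 else 0 := by
  have h1 : augField F (Fin.last d) = fun _ => 1 := by simp [augField]
  rw [h1, taylorCoeff]
  split_ifs with h
  · subst h; simp [iterPartialD]
  · rw [iterPartialD_const, zero_div]
    intro h2
    refine h ?_
    rw [← Multiset.card_eq_zero, ← Multiset.length_sort (r := (· ≤ ·)), h2, List.length_nil]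

theorem eq_of_hasDerivAt_zero {E : Type*} [NormedAddCommGroup E] [NormedSpace ℝ E] {f : ℝ → E}
    (h : ∀ s, HasDerivAt f 0 s) (s : ℝ) : f s = f 0 :=
  is_const_of_deriv_eq_zero (fun s => (h s).differentiableAt) (fun s => (h s).deriv) s 0

theorem numFamily_const (A : Matrix (Fin d) (Fin d) 𝕜) (F : State 𝕜 d → ℝ → State 𝕜 d)
    (T ε : ℝ) (x : State 𝕜 d × ℝ) (s : ℝ) : numFamily k A F T ε x s 0 = 1 := by
  rw [eq_of_hasDerivAt_zero (f := fun s => numFamily k A F T ε x s 0) _ s,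
    numFamily_zero A F T ε x (by simp), if_pos rfl]
  intro s
  simpa [entrySum_zero] using hasDerivAt_numFamily A F T ε x (α := 0) (k := k) (by simp) s

/-- The time component of the extension variable is exact. -/
theorem numFamily_time (hk : 1 ≤ k) (A : Matrix (Fin d) (Fin d) 𝕜)
    (F : State 𝕜 d → ℝ → State 𝕜 d) (T ε : ℝ) (x : State 𝕜 d × ℝ) (s : ℝ) :
    numFamily k A F T ε x s {Fin.last d} = s := by
  have hd : ∀ s, HasDerivAt (fun s : ℝ => numFamily k A F T ε x s {Fin.last d} - (s : 𝕜)) 0 s := by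
    intro s
    have h1 := hasDerivAt_numFamily A F T ε x (α := {Fin.last d}) (k := k) (by simpa using hk) s
    have h2 : entrySum (truncatedField k A F T ε x (numFamily k A F T ε x s)) {Fin.last d} = 1 := by
      rw [← Multiset.cons_zero, entrySum_cons, entrySum_zero, add_zero, truncatedField]
      simp only [augMatrix_last, zero_mul, Finset.sum_const_zero, mul_zero, zero_add,
        taylorCoeff_augField_last, ite_mul, one_mul]
      rw [Finset.sum_ite_eq', if_pos (mem_multiIndices.2 (by simp)), numFamily_const]
    rw [h2] at h1
    exact (h1.sub ((RCLike.ofRealCLM (K := 𝕜)).hasDerivAt (x := s))).congr_deriv (by simp)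
  have := eq_of_hasDerivAt_zero hd s
  rw [numFamily_zero A F T ε x (by simpa using hk)] at this
  simpa [sub_eq_zero] using this

theorem entries_linear (hk : 1 ≤ k) (i : Fin (d + 1)) :
    (ExtIndex.linear hk i : ExtIndex d k).entries = {i} := rfl

theorem step_fst_apply (hk : 1 ≤ k) (A : Matrix (Fin d) (Fin d) 𝕜)
    (F : State 𝕜 d → ℝ → State 𝕜 d) (T ε h : ℝ) (x : State 𝕜 d × ℝ) (p : Fin d) :
    (step hk A F T ε h x).1 p = x.1 p + numFamily k A F T ε x h {p.castSucc} := by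
  rw [numFamily, ← entries_linear hk, extendFamily_entries]
  simp [step]

theorem step_snd (hk : 1 ≤ k) (A : Matrix (Fin d) (Fin d) 𝕜)
    (F : State 𝕜 d → ℝ → State 𝕜 d) (T ε h : ℝ) (x : State 𝕜 d × ℝ) :
    (step hk A F T ε h x).2 = x.2 + h := by
  have := numFamily_time hk A F T ε x h
  rw [numFamily, ← entries_linear hk, extendFamily_entries] at this
  simp [step, this]

/-! ### The error family -/

/-- The displacement of the exact solution `u` from the expansion point. -/
def displacement (u : ℝ → State 𝕜 d) (x : State 𝕜 d × ℝ) (s : ℝ) : Fin (d + 1) → 𝕜 :=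
  augCoord (u (x.2 + s), x.2 + s) - augCoord x

/-- The error of the numerical extension variable with respect to the monomials of the exact
solution. -/
def errorFamily (k : ℕ) (A : Matrix (Fin d) (Fin d) 𝕜) (F : State 𝕜 d → ℝ → State 𝕜 d) (T ε : ℝ)
    (u : ℝ → State 𝕜 d) (x : State 𝕜 d × ℝ) (s : ℝ) (α : Multiset (Fin (d + 1))) : 𝕜 :=
  monom (displacement u x s) α - numFamily k A F T ε x s α

/-- The remainder of the Taylor expansion at `x` of order `m`, at the exact solution. -/
def taylorRemainder (F : State 𝕜 d → ℝ → State 𝕜 d) (T : ℝ) (u : ℝ → State 𝕜 d)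
    (x : State 𝕜 d × ℝ) (s : ℝ) (i : Fin (d + 1)) (m : ℕ) : 𝕜 :=
  augField F i (u (x.2 + s), x.2 + s) -
    ∑ γ ∈ multiIndices d m, taylorCoeff T (augField F i) x γ * monom (displacement u x s) γ

theorem hasDerivWithinAt_displacement {A : Matrix (Fin d) (Fin d) 𝕜}
    {F : State 𝕜 d → ℝ → State 𝕜 d} {T ε : ℝ} {u₀ : State 𝕜 d} {u : ℝ → State 𝕜 d}
    (hu : IsSolution A F T ε u₀ u) {x : State 𝕜 d × ℝ} (hx : 0 ≤ x.2) {h : ℝ} (hxh : x.2 + h ≤ T)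
    {s : ℝ} (hs : s ∈ Set.Icc 0 h) (i : Fin (d + 1)) :
    HasDerivWithinAt (fun τ => displacement u x τ i)
      ((ε⁻¹ : ℝ) * (∑ m, augMatrix A i m * (displacement u x s m + augCoord x m)) +
        augField F i (u (x.2 + s), x.2 + s)) (Set.Icc 0 h) s := by
  have hmaps : ∀ s ∈ Set.Icc (0 : ℝ) h, x.2 + s ∈ Set.Icc 0 T := fun s hs =>
    ⟨add_nonneg hx hs.1, by linarith [hs.2]⟩
  have hshift : HasDerivWithinAt (fun s : ℝ => x.2 + s) 1 (Set.Icc 0 h) s :=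
    ((hasDerivAt_id s).const_add x.2).hasDerivWithinAt
  induction i using Fin.lastCases with
  | last =>
    simp only [displacement, augCoord, augMatrix_last, augField, Pi.sub_apply, Fin.snoc_last,
      zero_mul, Finset.sum_const_zero, mul_zero, zero_add]
    have h1 := (RCLike.ofRealCLM (K := 𝕜)).hasFDerivAt.comp_hasDerivWithinAt s hshift
    simpa [Function.comp_def] using h1.sub_const (x.2 : 𝕜)
  | cast p =>
    have h1 := HasDerivWithinAt.scomp (h := fun s : ℝ => x.2 + s) s (hu.2 _ (hmaps s hs)) hshift
      hmaps
    rw [one_smul] at h1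
    have h2 := ((PiLp.proj (𝕜 := ℝ) 2 (fun _ : Fin d => 𝕜)
      p).hasFDerivAt.comp_hasDerivWithinAt s h1).sub_const (x.1 p)
    have h3 : ∑ m, augMatrix A p.castSucc m * (displacement u x s m + augCoord x m) =
        (Matrix.toEuclideanLin A (u (x.2 + s))) p := by
      rw [Fin.sum_univ_castSucc]
      simp [augMatrix_castSucc_castSucc, augMatrix_castSucc_last, displacement, augCoord,
        Matrix.toLpLin_apply, Matrix.mulVec, dotProduct]
    rw [h3]
    simp only [displacement, augCoord, augField, Pi.sub_apply, Fin.snoc_castSucc]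
    convert! h2 using 1
    simp [RCLike.real_smul_eq_coe_mul]

/-- By the product rule, each factor of an exact monomial is replaced in turn by its derivative,
A₁(ξ + x̂)/ε + f. Writing f_i as a Taylor polynomial of order k - |χ| plus remainder reproduces the
truncated system with the exact monomials inserted; subtracting the numerical system leaves the
remainder as the only forcing. -/
theorem hasDerivWithinAt_errorFamily {A : Matrix (Fin d) (Fin d) 𝕜}
    {F : State 𝕜 d → ℝ → State 𝕜 d} {T ε : ℝ} {u₀ : State 𝕜 d} {u : ℝ → State 𝕜 d}
    (hu : IsSolution A F T ε u₀ u) {x : State 𝕜 d × ℝ} (hx : 0 ≤ x.2) {h : ℝ} (hxh : x.2 + h ≤ T)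
    {s : ℝ} (hs : s ∈ Set.Icc 0 h) {α : Multiset (Fin (d + 1))} (hα : α.card ≤ k) :
    HasDerivWithinAt (fun τ => errorFamily k A F T ε u x τ α)
      (entrySum (fun i χ => truncatedField k A F T ε x (errorFamily k A F T ε u x s) i χ +
        monom (displacement u x s) χ * taylorRemainder F T u x s i (k - χ.card)) α)
      (Set.Icc 0 h) s := by
  have h1 := hasDerivWithinAt_monom (fun i => hasDerivWithinAt_displacement hu hx hxh hs i) α
  refine (h1.sub (hasDerivAt_numFamily A F T ε x hα s).hasDerivWithinAt).congr_deriv ?_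
  rw [← entrySum_sub]
  refine entrySum_congr fun i _ => ?_
  set χ := α.erase i
  simp only [truncatedField, errorFamily, taylorRemainder, mul_add, mul_sub, monom_cons, monom_add,
    Finset.sum_add_distrib, Finset.sum_sub_distrib, Finset.mul_sum]
  simp only [mul_comm, mul_left_comm, mul_assoc]
  ring

/-! ### Correction of the error family -/

/-- The monomial in the time alone: `s^|χ|` if all the entries of `χ` are the time, else `0`. -/
def timeMonom (d : ℕ) (s : 𝕜) (χ : Multiset (Fin (d + 1))) : 𝕜 :=
  monom (Pi.single (Fin.last d) s) χ

theorem timeMonom_castSucc_cons (s : 𝕜) (p : Fin d) (χ : Multiset (Fin (d + 1))) :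
    timeMonom d s (p.castSucc ::ₘ χ) = 0 := by
  rw [timeMonom, monom_cons, Pi.single_eq_of_ne (Fin.castSucc_lt_last p).ne, zero_mul]

theorem norm_single_last_le (s : 𝕜) (i : Fin (d + 1)) :
    ‖(Pi.single (Fin.last d) s : Fin (d + 1) → 𝕜) i‖ ≤ ‖s‖ := by
  rw [Pi.single_apply]
  split_ifs
  · exact le_rfl
  · simp

theorem norm_timeMonom_le (s : 𝕜) (χ : Multiset (Fin (d + 1))) :
    ‖timeMonom d s χ‖ ≤ ‖s‖ ^ χ.card :=
  norm_monom_le (norm_single_last_le s) χ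

/-- Factors are exchanged one at a time, each exchange costing θ η^(|χ| - 1). The additional factor
`η` on the left avoids the exponent |χ| - 1 at the empty multi-index; it will be supplied by the
time remainder. -/
theorem norm_monom_sub_mul_le {ξ ξ' : Fin (d + 1) → 𝕜} {η θ : ℝ} (hξ : ∀ i, ‖ξ i‖ ≤ η)
    (hξ' : ∀ i, ‖ξ' i‖ ≤ η) (h : ∀ i, ‖ξ i - ξ' i‖ ≤ θ) (χ : Multiset (Fin (d + 1))) :
    ‖monom ξ χ - monom ξ' χ‖ * η ≤ χ.card * θ * η ^ χ.card := by
  have hη : 0 ≤ η := (norm_nonneg _).trans (hξ 0)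
  have hθ : 0 ≤ θ := (norm_nonneg _).trans (h 0)
  induction χ using Multiset.induction_on with
  | empty => simp [monom]
  | cons a χ ih =>
    have h1 : monom ξ (a ::ₘ χ) - monom ξ' (a ::ₘ χ) =
        (ξ a - ξ' a) * monom ξ χ + ξ' a * (monom ξ χ - monom ξ' χ) := by
      simp only [monom_cons]; ring
    rw [h1, Multiset.card_cons]
    have h2 : ‖(ξ a - ξ' a) * monom ξ χ‖ ≤ θ * η ^ χ.card := by
      rw [norm_mul]
      exact mul_le_mul (h a) (norm_monom_le hξ χ) (norm_nonneg _) hθ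
    have h3 : ‖ξ' a * (monom ξ χ - monom ξ' χ)‖ ≤ χ.card * θ * η ^ χ.card := by
      rw [norm_mul]
      calc ‖ξ' a‖ * ‖monom ξ χ - monom ξ' χ‖ ≤ η * ‖monom ξ χ - monom ξ' χ‖ := by
            gcongr; exact hξ' a
        _ ≤ _ := by rw [mul_comm]; exact ih
    calc _ ≤ (θ * η ^ χ.card + χ.card * θ * η ^ χ.card) * η := by
          gcongr; exact norm_add_le_of_le h2 h3
      _ = _ := by push_cast; ring

/-- Essential for the correction: the augmented matrix has zero last row, so it could not absorb a
forcing in the time component. -/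
theorem timeRemainder_augField_last (F : State 𝕜 d → ℝ → State 𝕜 d) (T : ℝ) (m : ℕ)
    (x : State 𝕜 d × ℝ) (s : ℝ) : timeRemainder T (augField F (Fin.last d)) m x s = 0 := by
  have h1 : augField F (Fin.last d) = fun _ => 1 := by simp [augField]
  rw [h1, timeRemainder, Finset.sum_range_succ', Finset.sum_eq_zero]
  · simp [iterPartialD]
  · intro b _
    rw [iterPartialD_const _ _ (by simp), zero_mul]

/-- The family `w` with `A w` equal to the slowly varying part of the residual. -/
def correction (k : ℕ) (B : Matrix (Fin d) (Fin d) 𝕜) (F : State 𝕜 d → ℝ → State 𝕜 d) (T : ℝ)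
    (x : State 𝕜 d × ℝ) (s : ℝ) (α : Multiset (Fin (d + 1))) : 𝕜 :=
  entrySum (fun i χ => timeMonom d (s : 𝕜) χ *
    ∑ j, augMatrix B i j * timeRemainder T (augField F j) (k - χ.card) x s) α

/-- The derivative of `correction`. -/
def correctionDeriv (k : ℕ) (B : Matrix (Fin d) (Fin d) 𝕜) (F : State 𝕜 d → ℝ → State 𝕜 d) (T : ℝ)
    (x : State 𝕜 d × ℝ) (s : ℝ) (α : Multiset (Fin (d + 1))) : 𝕜 :=
  entrySum (fun i χ =>
    entrySum (fun l β => timeMonom d (s : 𝕜) β * (Pi.single (Fin.last d) 1 : Fin (d + 1) → 𝕜) l) χ *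
        ∑ j, augMatrix B i j * timeRemainder T (augField F j) (k - χ.card) x s +
      timeMonom d (s : 𝕜) χ *
        ∑ j, augMatrix B i j * timeRemainderDeriv T (augField F j) (k - χ.card) x s) α

theorem sum_augMatrix_mul_augMatrix {A B : Matrix (Fin d) (Fin d) 𝕜} (hAB : A * B = 1)
    {v : Fin (d + 1) → 𝕜} (hv : v (Fin.last d) = 0) (i : Fin (d + 1)) :
    ∑ m, augMatrix A i m * ∑ j, augMatrix B m j * v j = v i := by
  induction i using Fin.lastCases with
  | last => simp [augMatrix_last, hv]
  | cast p =>
    simp only [Fin.sum_univ_castSucc, augMatrix_castSucc_castSucc, augMatrix_castSucc_last,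
      zero_mul, add_zero]
    have h1 : A.mulVec (B.mulVec fun j => v j.castSucc) = fun j => v j.castSucc := by
      rw [Matrix.mulVec_mulVec, hAB, Matrix.one_mulVec]
    exact congrFun h1 p

/-- The action puts a state entry `m` in place of `i`, since the time column of the augmented matrix
vanishes. A monomial in time alone is zero as soon as it contains a state entry, so in the
correction at `m ::ₘ χ` only the term that removes `m` survives. What remains is A B applied to the
time remainder. -/
theorem linearAction_correction {A B : Matrix (Fin d) (Fin d) 𝕜} (hAB : A * B = 1)
    (F : State 𝕜 d → ℝ → State 𝕜 d) (T : ℝ) (x : State 𝕜 d × ℝ) (s : ℝ)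
    (α : Multiset (Fin (d + 1))) :
    linearAction (augMatrix A) (correction k B F T x s) α =
      entrySum (fun i χ => timeMonom d (s : 𝕜) χ *
        timeRemainder T (augField F i) (k - χ.card) x s) α := by
  refine entrySum_congr fun i _ => ?_
  set χ := α.erase i
  rw [← sum_augMatrix_mul_augMatrix hAB
    (v := fun j => timeRemainder T (augField F j) (k - χ.card) x s)
    (timeRemainder_augField_last F T _ x s) i, Finset.mul_sum]
  refine Finset.sum_congr rfl fun m _ => ?_
  induction m using Fin.lastCases with
  | last =>
    have h0 : augMatrix A i (Fin.last d) = 0 := by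
      induction i using Fin.lastCases with
      | last => exact augMatrix_last A _
      | cast p => exact augMatrix_castSucc_last A p
    rw [h0]; ring
  | cast p =>
    rw [correction, entrySum_cons, entrySum_eq_zero (α := χ), add_zero]
    · ring
    · intro j _
      rw [timeMonom_castSucc_cons, zero_mul]

theorem hasDerivWithinAt_correction {F : State 𝕜 d → ℝ → State 𝕜 d} {T : ℝ}
    (hF : LipschitzDerivatives k T F) (hk : 1 ≤ k) (B : Matrix (Fin d) (Fin d) 𝕜)
    {x : State 𝕜 d × ℝ} (hx : 0 ≤ x.2) {h : ℝ} (hxh : x.2 + h ≤ T)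
    {s : ℝ} (hs : s ∈ Set.Icc 0 h) (α : Multiset (Fin (d + 1))) :
    HasDerivWithinAt (fun τ => correction k B F T x τ α) (correctionDeriv k B F T x s α)
      (Set.Icc 0 h) s := by
  refine hasDerivWithinAt_entrySum (κ := fun s i χ => timeMonom d (s : 𝕜) χ *
    ∑ j, augMatrix B i j * timeRemainder T (augField F j) (k - χ.card) x s)
    (κ' := fun s i χ => entrySum (fun l β => timeMonom d (s : 𝕜) β *
      (Pi.single (Fin.last d) 1 : Fin (d + 1) → 𝕜) l) χ *
        ∑ j, augMatrix B i j * timeRemainder T (augField F j) (k - χ.card) x s +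
      timeMonom d (s : 𝕜) χ *
        ∑ j, augMatrix B i j * timeRemainderDeriv T (augField F j) (k - χ.card) x s) fun i _ => ?_
  refine HasDerivWithinAt.mul ?_ (HasDerivWithinAt.fun_sum fun j _ => ?_)
  · refine hasDerivWithinAt_monom
      (ξ := fun τ : ℝ => (Pi.single (Fin.last d) (τ : 𝕜) : Fin (d + 1) → 𝕜)) (fun i => ?_) _
    simp only [Pi.single_apply]
    split_ifs
    · simpa using ((RCLike.ofRealCLM (K := 𝕜)).hasDerivAt (x := s)).hasDerivWithinAt
    · exact hasDerivWithinAt_const _ _ _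
  · exact ((isLipschitzField_augField hF j).hasDerivWithinAt_timeRemainder hk _ x.1 hx hxh s
      hs).const_mul _

theorem correction_zero (B : Matrix (Fin d) (Fin d) 𝕜) (F : State 𝕜 d → ℝ → State 𝕜 d) (T : ℝ)
    (x : State 𝕜 d × ℝ) (α : Multiset (Fin (d + 1))) : correction k B F T x 0 α = 0 := by
  refine entrySum_eq_zero fun i _ => ?_
  have h : ∀ (g : State 𝕜 d × ℝ → 𝕜) (m : ℕ), timeRemainder T g m x 0 = 0 := fun g m => by
    simp [timeRemainder, Finset.sum_range_succ', iterPartialD]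
  simp [h]

/-- The error family, corrected so that its residual is small. -/
def correctedError (k : ℕ) (A B : Matrix (Fin d) (Fin d) 𝕜) (F : State 𝕜 d → ℝ → State 𝕜 d)
    (T ε : ℝ) (u : ℝ → State 𝕜 d) (x : State 𝕜 d × ℝ) (s : ℝ) (α : Multiset (Fin (d + 1))) : 𝕜 :=
  errorFamily k A F T ε u x s α + ε * correction k B F T x s α

/-- The non-oscillatory part of the derivative of `correctedError`. -/
def correctedResidual (k : ℕ) (A B : Matrix (Fin d) (Fin d) 𝕜) (F : State 𝕜 d → ℝ → State 𝕜 d)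
    (T ε : ℝ) (u : ℝ → State 𝕜 d) (x : State 𝕜 d × ℝ) (s : ℝ) (α : Multiset (Fin (d + 1))) : 𝕜 :=
  entrySum (fun i χ =>
    (∑ m, augMatrix A i m * ((ε⁻¹ : ℝ) * augCoord x m)) * errorFamily k A F T ε u x s χ +
    ∑ γ ∈ multiIndices d (k - χ.card),
      taylorCoeff T (augField F i) x γ * errorFamily k A F T ε u x s (χ + γ) +
    (monom (displacement u x s) χ * taylorRemainder F T u x s i (k - χ.card) -
      timeMonom d (s : 𝕜) χ * timeRemainder T (augField F i) (k - χ.card) x s)) α +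
  ε * correctionDeriv k B F T x s α

/-- The factors ε and 1/ε cancel in the action of A₁/ε on ε w. Completing the oscillatory term for
the corrected error therefore subtracts exactly the slow part of the forcing, and ε w' is the only
new term. -/
theorem hasDerivWithinAt_correctedError {A B : Matrix (Fin d) (Fin d) 𝕜} (hAB : A * B = 1)
    {F : State 𝕜 d → ℝ → State 𝕜 d} {T ε : ℝ} (hε : ε ≠ 0)
    (hF : LipschitzDerivatives k T F) (hk : 1 ≤ k) {u₀ : State 𝕜 d} {u : ℝ → State 𝕜 d}
    (hu : IsSolution A F T ε u₀ u) {x : State 𝕜 d × ℝ} (hx : 0 ≤ x.2) {h : ℝ} (hxh : x.2 + h ≤ T)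
    {s : ℝ} (hs : s ∈ Set.Icc 0 h) {α : Multiset (Fin (d + 1))} (hα : α.card ≤ k) :
    HasDerivWithinAt (fun τ => correctedError k A B F T ε u x τ α)
      ((ε⁻¹ : ℝ) * linearAction (augMatrix A) (correctedError k A B F T ε u x s) α +
        correctedResidual k A B F T ε u x s α) (Set.Icc 0 h) s := by
  refine ((hasDerivWithinAt_errorFamily hu hx hxh hs hα).add
    ((hasDerivWithinAt_correction hF hk B hx hxh hs α).const_mul (ε : 𝕜))).congr_deriv ?_
  have h1 : linearAction (augMatrix A) (correctedError k A B F T ε u x s) α =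
      entrySum (fun i χ => ∑ m, augMatrix A i m * errorFamily k A F T ε u x s (m ::ₘ χ)) α +
      ε * linearAction (augMatrix A) (correction k B F T x s) α := by
    rw [linearAction, linearAction, ← entrySum_mul_left, ← entrySum_add]
    refine entrySum_congr fun i _ => ?_
    rw [Finset.mul_sum, ← Finset.sum_add_distrib]
    refine Finset.sum_congr rfl fun m _ => ?_
    rw [correctedError]; ring
  have hε' : (ε : 𝕜) ≠ 0 := by exact_mod_cast hε
  rw [h1, linearAction_correction hAB, mul_add, ← mul_assoc, RCLike.ofReal_inv,
    inv_mul_cancel₀ hε', one_mul, ← entrySum_mul_left, ← entrySum_add, correctedResidual,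
    ← add_assoc, ← entrySum_add]
  congr 1
  refine entrySum_congr fun i _ => ?_
  have e1 : ∀ e : Multiset (Fin (d + 1)) → 𝕜,
      ∑ m, augMatrix A i m * (e (m ::ₘ α.erase i) + augCoord x m * e (α.erase i)) =
        ∑ m, augMatrix A i m * e (m ::ₘ α.erase i) +
          (∑ m, augMatrix A i m * augCoord x m) * e (α.erase i) := fun e => by
    rw [Finset.sum_mul, ← Finset.sum_add_distrib]
    exact Finset.sum_congr rfl fun m _ => by ring
  have e2 : ∑ m, augMatrix A i m * ((ε : 𝕜)⁻¹ * augCoord x m) =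
      (ε : 𝕜)⁻¹ * ∑ m, augMatrix A i m * augCoord x m := by
    rw [Finset.mul_sum]
    exact Finset.sum_congr rfl fun m _ => by ring
  rw [truncatedField, RCLike.ofReal_inv, e1, e2]
  ring

theorem correctedError_zero (A B : Matrix (Fin d) (Fin d) 𝕜) (F : State 𝕜 d → ℝ → State 𝕜 d)
    (T ε : ℝ) (u : ℝ → State 𝕜 d) (x : State 𝕜 d × ℝ) {α : Multiset (Fin (d + 1))}
    (hα : α.card ≤ k) :
    correctedError k A B F T ε u x 0 α =
      if α = 0 then 0 else monom (displacement u x 0) α := by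
  rw [correctedError, correction_zero, errorFamily, numFamily_zero _ _ _ _ _ hα]
  split_ifs with h
  · subst h; simp [monom]
  · simp

/-! ### Bound of the residual -/

theorem norm_taylorCoeff_le {T : ℝ} {g : State 𝕜 d × ℝ → 𝕜} {x : State 𝕜 d × ℝ} {L : ℝ}
    (hL : ∀ α : List (Fin (d + 1)), α.length ≤ k → ‖iterPartialD T α g x‖ ≤ L)
    {γ : Multiset (Fin (d + 1))} (hγ : γ.card ≤ k) : ‖taylorCoeff T g x γ‖ ≤ L := by
  rw [taylorCoeff, norm_div, RCLike.norm_natCast]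
  refine (div_le_self (norm_nonneg _) ?_).trans (hL _ (by rwa [Multiset.length_sort]))
  exact_mod_cast Finset.prod_pos fun i _ => Nat.factorial_pos _

theorem card_multiIndices_mono {m : ℕ} (hm : m ≤ k) :
    (multiIndices d m).card ≤ (multiIndices d k).card :=
  Finset.card_le_card fun _ hγ => mem_multiIndices.2 ((mem_multiIndices.1 hγ).trans hm)

theorem norm_sum_mul_le {n : Type*} [Fintype n] {B : Matrix n n 𝕜} {β b : ℝ}
    (hB : ∀ i, ∑ j, ‖B i j‖ ≤ β) (hb : 0 ≤ b) {v : n → 𝕜} (hv : ∀ j, ‖v j‖ ≤ b) (i : n) :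
    ‖∑ j, B i j * v j‖ ≤ β * b := by
  calc ‖∑ j, B i j * v j‖ ≤ ∑ j, ‖B i j‖ * b := by
        refine norm_sum_le_of_le _ fun j _ => ?_
        rw [norm_mul]
        exact mul_le_mul_of_nonneg_left (hv j) (norm_nonneg _)
    _ ≤ β * b := by
        rw [← Finset.sum_mul]
        exact mul_le_mul_of_nonneg_right (hB i) hb

theorem card_erase_lt {α : Multiset (Fin (d + 1))} (hα : α.card ≤ k) {i : Fin (d + 1)}
    (hi : i ∈ α) : (α.erase i).card + 1 ≤ k := by
  rw [Multiset.card_erase_add_one hi]; exact hα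

section Bounds

variable {A B : Matrix (Fin d) (Fin d) 𝕜} {F : State 𝕜 d → ℝ → State 𝕜 d} {T R L β : ℝ}
  {x : State 𝕜 d × ℝ} {s : ℝ}

theorem norm_correction_le (hF : LipschitzDerivatives k T F) (hL0 : 0 ≤ L)
    (hL : ∀ i, HasLipschitzBound k T (augField F i) R L)
    (hB : ∀ i, ∑ j, ‖augMatrix B i j‖ ≤ β) (hxR : ‖x.1‖ ≤ R) (hx : 0 ≤ x.2) (hs : 0 ≤ s)
    (hxs : x.2 + s ≤ T) {α : Multiset (Fin (d + 1))} (hα : α.card ≤ k) :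
    ‖correction k B F T x s α‖ ≤ k * (β * L * s ^ (k + 1)) := by
  have hβ : 0 ≤ β := (Finset.sum_nonneg fun j _ => norm_nonneg _).trans (hB 0)
  refine (norm_entrySum_le (b := β * L * s ^ (k + 1)) fun i hi => ?_).trans ?_
  · have hc := card_erase_lt hα hi
    set χ := α.erase i
    rw [norm_mul]
    have h1 := norm_timeMonom_le (s : 𝕜) χ
    rw [RCLike.norm_ofReal, abs_of_nonneg hs] at h1
    have h2 := norm_sum_mul_le hB (b := L * s ^ (k - χ.card + 1)) (by positivity)
      (v := fun j => timeRemainder T (augField F j) (k - χ.card) x s) (fun j =>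
        (isLipschitzField_augField hF j).norm_timeRemainder_le (hL j) hL0 (Nat.sub_le _ _) hxR hx
          hs hxs) i
    calc _ ≤ s ^ χ.card * (β * (L * s ^ (k - χ.card + 1))) :=
          mul_le_mul h1 h2 (norm_nonneg _) (by positivity)
      _ = β * L * (s ^ χ.card * s ^ (k - χ.card + 1)) := by ring
      _ = β * L * s ^ (k + 1) := by
          rw [← pow_add]; congr 2; omega
  · gcongr

theorem norm_correctionDeriv_le (hF : LipschitzDerivatives k T F) (hL0 : 0 ≤ L)
    (hL : ∀ i, HasLipschitzBound k T (augField F i) R L)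
    (hB : ∀ i, ∑ j, ‖augMatrix B i j‖ ≤ β) (hxR : ‖x.1‖ ≤ R) (hx : 0 ≤ x.2) (hs : 0 ≤ s)
    (hxs : x.2 + s ≤ T) {α : Multiset (Fin (d + 1))} (hα : α.card ≤ k) :
    ‖correctionDeriv k B F T x s α‖ ≤ k * ((k + 1) * (β * L * s ^ k)) := by
  have hβ : 0 ≤ β := (Finset.sum_nonneg fun j _ => norm_nonneg _).trans (hB 0)
  refine (norm_entrySum_le (b := (k + 1) * (β * L * s ^ k)) fun i hi => ?_).trans ?_
  · have hc := card_erase_lt hα hi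
    set χ := α.erase i
    have h1 := norm_timeMonom_le (s : 𝕜) χ
    rw [RCLike.norm_ofReal, abs_of_nonneg hs] at h1
    have h2 := norm_sum_mul_le hB (b := L * s ^ (k - χ.card + 1)) (by positivity)
      (v := fun j => timeRemainder T (augField F j) (k - χ.card) x s) (fun j =>
        (isLipschitzField_augField hF j).norm_timeRemainder_le (hL j) hL0 (Nat.sub_le _ _) hxR hx
          hs hxs) i
    have h3 := norm_sum_mul_le hB (b := L * s ^ (k - χ.card)) (by positivity)
      (v := fun j => timeRemainderDeriv T (augField F j) (k - χ.card) x s) (fun j =>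
        (isLipschitzField_augField hF j).norm_timeRemainderDeriv_le (hL j) hL0 (by omega)
          (Nat.sub_le _ _) hxR hx hs hxs) i
    -- Differentiating the monomial in time loses one power of `s`. The factor `s` that restores it
    -- is taken from the bound of the time remainder, of order k - |χ| + 1.
    have h4 : ‖entrySum (fun l β => timeMonom d (s : 𝕜) β *
        (Pi.single (Fin.last d) 1 : Fin (d + 1) → 𝕜) l) χ‖ * s ≤ k * s ^ χ.card := by
      have h5 : ∀ l ∈ χ, ‖timeMonom d (s : 𝕜) (χ.erase l) *
          (Pi.single (Fin.last d) 1 : Fin (d + 1) → 𝕜) l‖ ≤ s ^ (χ.card - 1) := fun l hl => by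
        rw [norm_mul]
        have h6 := norm_timeMonom_le (s : 𝕜) (χ.erase l)
        rw [RCLike.norm_ofReal, abs_of_nonneg hs, Multiset.card_erase_of_mem hl] at h6
        have h7 := norm_single_last_le (1 : 𝕜) l
        rw [norm_one] at h7
        exact (mul_le_mul h6 h7 (norm_nonneg _) (by positivity)).trans (by simp)
      have h8 := norm_entrySum_le (κ := fun l β => timeMonom d (s : 𝕜) β *
        (Pi.single (Fin.last d) 1 : Fin (d + 1) → 𝕜) l) h5
      rcases Nat.eq_zero_or_pos χ.card with h0 | h0
      · rw [h0, Nat.cast_zero, zero_mul] at h8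
        rw [le_antisymm h8 (norm_nonneg _), zero_mul]
        positivity
      · calc _ ≤ χ.card * s ^ (χ.card - 1) * s := by gcongr
          _ = χ.card * s ^ χ.card := by
            rw [mul_assoc, ← pow_succ, Nat.sub_add_cancel h0]
          _ ≤ k * s ^ χ.card := by gcongr; omega
    have h9 : s ^ χ.card * s ^ (k - χ.card) = s ^ k := by
      rw [← pow_add]; congr 1; omega
    refine (norm_add_le _ _).trans ?_
    rw [norm_mul, norm_mul, add_mul, one_mul]
    refine add_le_add ?_ ?_
    · calc _ ≤ ‖entrySum (fun l β => timeMonom d (s : 𝕜) β *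
              (Pi.single (Fin.last d) 1 : Fin (d + 1) → 𝕜) l) χ‖ *
              (β * (L * s ^ (k - χ.card + 1))) := by gcongr
        _ = (‖entrySum (fun l β => timeMonom d (s : 𝕜) β *
              (Pi.single (Fin.last d) 1 : Fin (d + 1) → 𝕜) l) χ‖ * s) *
              (β * (L * s ^ (k - χ.card))) := by rw [pow_succ]; ring
        _ ≤ (k * s ^ χ.card) * (β * (L * s ^ (k - χ.card))) := by gcongr
        _ = k * (β * L * (s ^ χ.card * s ^ (k - χ.card))) := by ring
        _ = _ := by rw [h9]
    · calc _ ≤ s ^ χ.card * (β * (L * s ^ (k - χ.card))) :=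
            mul_le_mul h1 h3 (norm_nonneg _) (by positivity)
        _ = β * L * (s ^ χ.card * s ^ (k - χ.card)) := by ring
        _ = _ := by rw [h9]
  · gcongr

/-- Two scales are kept apart: `θ` bounds the displacement of the state and will be O(ε), while `η`
bounds all displacements, time included, and will be O(h). The coefficient terms involve the
uncorrected error, which is the corrected one minus ε w; this explains the term added to `D`. -/
theorem norm_correctedResidual_le (hF : LipschitzDerivatives k T F) (hL0 : 0 ≤ L)
    (hL : ∀ i, HasLipschitzBound k T (augField F i) R L)
    (htc : ∀ i, ∀ γ : Multiset (Fin (d + 1)), γ.card ≤ k → ‖taylorCoeff T (augField F i) x γ‖ ≤ L)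
    (hB : ∀ i, ∑ j, ‖augMatrix B i j‖ ≤ β) {ε a θ η D : ℝ} (hε : 0 ≤ ε)
    (ha : ∀ i, ‖∑ m, augMatrix A i m * (((ε⁻¹ : ℝ) : 𝕜) * augCoord x m)‖ ≤ a)
    {u : ℝ → State 𝕜 d} (huR : ‖u (x.2 + s)‖ + ‖x.1‖ ≤ R)
    (hθ : ‖u (x.2 + s) - x.1‖ ≤ θ) (hθη : θ ≤ η) (hsη : s ≤ η)
    (hx : 0 ≤ x.2) (hs : 0 ≤ s) (hxs : x.2 + s ≤ T)
    (hD : ∀ α : Multiset (Fin (d + 1)), α.card ≤ k → ‖correctedError k A B F T ε u x s α‖ ≤ D)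
    {α : Multiset (Fin (d + 1))} (hα : α.card ≤ k) :
    ‖correctedResidual k A B F T ε u x s α‖ ≤
      k * ((a + (multiIndices d k).card * L) * (D + ε * (k * (β * L * s ^ (k + 1)))) +
        (2 + d * (multiIndices d k).card + k) * L * θ * η ^ k) +
      ε * (k * ((k + 1) * (β * L * s ^ k))) := by
  have hxR : ‖x.1‖ ≤ R := by linarith [norm_nonneg (u (x.2 + s))]
  have hθ0 : 0 ≤ θ := (norm_nonneg _).trans hθ
  have hη0 : 0 ≤ η := hθ0.trans hθη
  have ha0 : 0 ≤ a := (norm_nonneg _).trans (ha 0)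
  set n := (multiIndices d k).card with hn
  set D' := D + ε * (k * (β * L * s ^ (k + 1))) with hD'
  have hE : ∀ γ : Multiset (Fin (d + 1)), γ.card ≤ k → ‖errorFamily k A F T ε u x s γ‖ ≤ D' := by
    intro γ hγ
    have h1 : errorFamily k A F T ε u x s γ =
        correctedError k A B F T ε u x s γ - ε * correction k B F T x s γ := by
      rw [correctedError]; ring
    rw [h1]
    refine norm_sub_le_of_le (hD γ hγ) ?_
    rw [norm_mul, RCLike.norm_ofReal, abs_of_nonneg hε]
    exact mul_le_mul_of_nonneg_left (norm_correction_le hF hL0 hL hB hxR hx hs hxs hγ) hε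
  have hD'0 : 0 ≤ D' := (norm_nonneg _).trans (hE 0 (by simp))
  have hξp : ∀ p : Fin d, displacement u x s p.castSucc = (u (x.2 + s) - x.1) p := fun p => by
    simp [displacement, augCoord]
  have hξt : displacement u x s (Fin.last d) = (s : 𝕜) := by simp [displacement, augCoord]
  have hξη : ∀ i, ‖displacement u x s i‖ ≤ η := fun i => by
    induction i using Fin.lastCases with
    | last => rwa [hξt, RCLike.norm_ofReal, abs_of_nonneg hs]
    | cast p => rw [hξp]; exact (PiLp.norm_apply_le _ p).trans (hθ.trans hθη)
  have hτη : ∀ i, ‖(Pi.single (Fin.last d) (s : 𝕜) : Fin (d + 1) → 𝕜) i‖ ≤ η := fun i =>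
    (norm_single_last_le _ i).trans (by rwa [RCLike.norm_ofReal, abs_of_nonneg hs])
  have hξτ : ∀ i, ‖displacement u x s i -
      (Pi.single (Fin.last d) (s : 𝕜) : Fin (d + 1) → 𝕜) i‖ ≤ θ := fun i => by
    induction i using Fin.lastCases with
    | last => simpa [hξt] using hθ0
    | cast p =>
      rw [hξp, Pi.single_eq_of_ne (Fin.castSucc_lt_last p).ne, sub_zero]
      exact (PiLp.norm_apply_le _ p).trans hθ
  refine norm_add_le_of_le ?_ ?_
  · refine (norm_entrySum_le (b := (a + n * L) * D' + (2 + d * n + k) * L * θ * η ^ k)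
      fun i hi => ?_).trans ?_
    · have hc := card_erase_lt hα hi
      set χ := α.erase i
      rw [add_mul a]
      refine norm_add_le_of_le (norm_add_le_of_le ?_ ?_) ?_
      · rw [norm_mul]
        exact mul_le_mul (ha i) (hE χ (by omega)) (norm_nonneg _) ha0
      · have h1 : ∀ γ ∈ multiIndices d (k - χ.card), ‖taylorCoeff T (augField F i) x γ *
            errorFamily k A F T ε u x s (χ + γ)‖ ≤ L * D' := fun γ hγ => by
          rw [mem_multiIndices] at hγ
          rw [norm_mul]
          exact mul_le_mul (htc i γ (by omega)) (hE _ (by rw [Multiset.card_add]; omega))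
            (norm_nonneg _) hL0
        refine (norm_sum_le_of_le _ h1).trans ?_
        rw [Finset.sum_const, nsmul_eq_mul, mul_assoc]
        gcongr
        exact card_multiIndices_mono (Nat.sub_le _ _)
      · have hρ := (isLipschitzField_augField hF i).norm_timeRemainder_le (hL i) hL0
          (Nat.sub_le k χ.card) hxR hx hs hxs
        have hr := (isLipschitzField_augField hF i).norm_taylorRemainder_sub_le (hL i) hL0
          (Nat.sub_le k χ.card) huR hx hs hxs (hθ.trans hθη) hsη (ξ := displacement u x s) rfl
        -- Both differences, of the remainders and of the monomials, supply a factor `θ`.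
        have hsplit : monom (displacement u x s) χ * taylorRemainder F T u x s i (k - χ.card) -
            timeMonom d (s : 𝕜) χ * timeRemainder T (augField F i) (k - χ.card) x s =
            monom (displacement u x s) χ * (taylorRemainder F T u x s i (k - χ.card) -
              timeRemainder T (augField F i) (k - χ.card) x s) +
            (monom (displacement u x s) χ - timeMonom d (s : 𝕜) χ) *
              timeRemainder T (augField F i) (k - χ.card) x s := by ring
        have hpow : η ^ χ.card * η ^ (k - χ.card) = η ^ k := by
          rw [← pow_add]; congr 1; omega
        have h1 : ‖monom (displacement u x s) χ * (taylorRemainder F T u x s i (k - χ.card) -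
            timeRemainder T (augField F i) (k - χ.card) x s)‖ ≤ (2 + d * n) * L * θ * η ^ k := by
          rw [norm_mul]
          calc _ ≤ η ^ χ.card * ((2 + d * n) * L * θ * η ^ (k - χ.card)) := by
                refine mul_le_mul (norm_monom_le hξη χ) (hr.trans ?_) (norm_nonneg _)
                  (by positivity)
                gcongr
                exact card_multiIndices_mono (Nat.sub_le _ _)
            _ = (2 + d * n) * L * θ * (η ^ χ.card * η ^ (k - χ.card)) := by ring
            _ = _ := by rw [hpow]
        have h2 : ‖(monom (displacement u x s) χ - timeMonom d (s : 𝕜) χ) *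
            timeRemainder T (augField F i) (k - χ.card) x s‖ ≤ k * L * θ * η ^ k := by
          rw [norm_mul]
          have h3 := norm_monom_sub_mul_le hξη hτη hξτ χ
          calc _ ≤ ‖monom (displacement u x s) χ - timeMonom d (s : 𝕜) χ‖ *
                (L * η ^ (k - χ.card + 1)) := by
                gcongr
                exact hρ.trans (by gcongr)
            _ = (‖monom (displacement u x s) χ - timeMonom d (s : 𝕜) χ‖ * η) *
                (L * η ^ (k - χ.card)) := by rw [pow_succ]; ring
            _ ≤ (χ.card * θ * η ^ χ.card) * (L * η ^ (k - χ.card)) :=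
                mul_le_mul_of_nonneg_right h3 (by positivity)
            _ = χ.card * L * θ * (η ^ χ.card * η ^ (k - χ.card)) := by ring
            _ ≤ k * L * θ * η ^ k := by
                rw [hpow]
                gcongr
                omega
        rw [hsplit]
        refine (norm_add_le_of_le h1 h2).trans (le_of_eq (by ring))
    · gcongr
  · rw [norm_mul, RCLike.norm_ofReal, abs_of_nonneg hε]
    exact mul_le_mul_of_nonneg_left (norm_correctionDeriv_le hF hL0 hL hB hxR hx hs hxs hα) hε

end Bounds

/-! ### Diagonalization of the augmented matrix -/

/-- The embedding of `𝕜` into `ℂ`. -/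
def toComplex (𝕜 : Type*) [RCLike 𝕜] : 𝕜 →+* ℂ where
  toFun := RCLike.map 𝕜 ℂ
  map_zero' := map_zero _
  map_add' := map_add _
  map_one' := by simp [RCLike.map_apply]
  map_mul' z w := by
    apply Complex.ext <;> simp [RCLike.map_apply]

theorem toComplex_eq (z : 𝕜) : toComplex 𝕜 z = RCLike.map 𝕜 ℂ z := rfl

theorem norm_toComplex (z : 𝕜) : ‖toComplex 𝕜 z‖ = ‖z‖ := by
  rw [← sq_eq_sq₀ (norm_nonneg _) (norm_nonneg _), ← RCLike.normSq_eq_def', ← RCLike.normSq_eq_def',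
    RCLike.normSq_apply, RCLike.normSq_apply]
  simp [toComplex_eq, RCLike.map_apply]

theorem toComplex_ofReal (r : ℝ) : toComplex 𝕜 (r : 𝕜) = r := by
  simp [toComplex_eq, RCLike.map_apply]

theorem hasDerivWithinAt_toComplex {f : ℝ → 𝕜} {f' : 𝕜} {I : Set ℝ} {s : ℝ}
    (h : HasDerivWithinAt f f' I s) :
    HasDerivWithinAt (fun τ => toComplex 𝕜 (f τ)) (toComplex 𝕜 f') I s :=
  (RCLike.map 𝕜 ℂ).hasFDerivAt.comp_hasDerivWithinAt s h

theorem toComplex_linearAction {n : Type*} [Fintype n] [DecidableEq n] (A : Matrix n n 𝕜)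
    (e : Multiset n → 𝕜) (α : Multiset n) :
    toComplex 𝕜 (linearAction A e α) =
      linearAction (A.map (toComplex 𝕜)) (fun α => toComplex 𝕜 (e α)) α := by
  have := map_entrySum (toComplex 𝕜 : 𝕜 →+ ℂ) (fun i χ => ∑ m, A i m * e (m ::ₘ χ)) α
  refine this.trans (entrySum_congr fun i _ => ?_)
  simp [map_sum, map_mul]

theorem toComplex_monom {n : Type*} (ξ : n → 𝕜) (α : Multiset n) :
    toComplex 𝕜 (monom ξ α) = monom (fun i => toComplex 𝕜 (ξ i)) α := by
  simp only [monom, map_multiset_prod, Multiset.map_map, Function.comp_def]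

/-- A matrix with blocks `Q, 0` and `0, 1`. -/
def bordered (Q : Matrix (Fin d) (Fin d) ℂ) : Matrix (Fin (d + 1)) (Fin (d + 1)) ℂ :=
  augMatrix Q + Matrix.single (Fin.last d) (Fin.last d) 1

theorem bordered_castSucc_castSucc (Q : Matrix (Fin d) (Fin d) ℂ) (p q : Fin d) :
    bordered Q p.castSucc q.castSucc = Q p q := by
  simp [bordered, augMatrix_castSucc_castSucc, (Fin.castSucc_lt_last p).ne']

theorem bordered_castSucc_last (Q : Matrix (Fin d) (Fin d) ℂ) (p : Fin d) :
    bordered Q p.castSucc (Fin.last d) = 0 := by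
  simp [bordered, augMatrix_castSucc_last, (Fin.castSucc_lt_last p).ne']

theorem bordered_last_castSucc (Q : Matrix (Fin d) (Fin d) ℂ) (q : Fin d) :
    bordered Q (Fin.last d) q.castSucc = 0 := by
  simp [bordered, augMatrix_last, (Fin.castSucc_lt_last q).ne']

theorem bordered_last_last (Q : Matrix (Fin d) (Fin d) ℂ) :
    bordered Q (Fin.last d) (Fin.last d) = 1 := by
  simp [bordered, augMatrix_last]

theorem bordered_mul (P Q : Matrix (Fin d) (Fin d) ℂ) :
    bordered P * bordered Q = bordered (P * Q) := by
  ext i j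
  rw [Matrix.mul_apply, Fin.sum_univ_castSucc]
  induction i using Fin.lastCases <;> induction j using Fin.lastCases <;>
    simp [bordered_castSucc_castSucc, bordered_castSucc_last, bordered_last_castSucc,
      bordered_last_last, Matrix.mul_apply]

theorem bordered_one : bordered (1 : Matrix (Fin d) (Fin d) ℂ) = 1 := by
  ext i j
  induction i using Fin.lastCases <;> induction j using Fin.lastCases <;>
    simp [bordered_castSucc_castSucc, bordered_castSucc_last, bordered_last_castSucc,
      bordered_last_last, Matrix.one_apply, (Fin.castSucc_lt_last _).ne,
      (Fin.castSucc_lt_last _).ne']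

theorem augMatrix_map (A : Matrix (Fin d) (Fin d) 𝕜) :
    (augMatrix A).map (toComplex 𝕜) = augMatrix (complexify A) := by
  ext i j
  induction i using Fin.lastCases <;> induction j using Fin.lastCases <;>
    simp [augMatrix_castSucc_castSucc, augMatrix_castSucc_last, augMatrix_last, complexify,
      toComplex_eq]

theorem bordered_mul_augMatrix (P A : Matrix (Fin d) (Fin d) ℂ) :
    bordered P * augMatrix A = augMatrix (P * A) := by
  ext i j
  rw [Matrix.mul_apply, Fin.sum_univ_castSucc]
  induction i using Fin.lastCases <;> induction j using Fin.lastCases <;>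
    simp [bordered_castSucc_castSucc, bordered_castSucc_last, bordered_last_castSucc,
      bordered_last_last, augMatrix_castSucc_castSucc, augMatrix_castSucc_last, augMatrix_last,
      Matrix.mul_apply]

theorem diagonal_mul_bordered (Λ : Fin d → ℂ) (P : Matrix (Fin d) (Fin d) ℂ) :
    Matrix.diagonal (Fin.snoc (α := fun _ => ℂ) Λ 0) * bordered P =
      augMatrix (Matrix.diagonal Λ * P) := by
  ext i j
  rw [Matrix.diagonal_mul]
  induction i using Fin.lastCases <;> induction j using Fin.lastCases <;>
    simp [bordered_castSucc_castSucc, bordered_castSucc_last, augMatrix_castSucc_castSucc,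
      augMatrix_castSucc_last, augMatrix_last]

theorem exists_diagonalization {A : Matrix (Fin d) (Fin d) 𝕜}
    (hdiag : IsDiagonalizable (complexify A)) (himag : HasPurelyImaginarySpectrum (complexify A)) :
    ∃ (P Q : Matrix (Fin d) (Fin d) ℂ) (Λ : Fin d → ℂ), Q * P = 1 ∧
      P * complexify A = Matrix.diagonal Λ * P ∧ ∀ i, (Λ i).re = 0 := by
  obtain ⟨Q, Λ, hQ, h⟩ := hdiag
  have hdet : IsUnit Q.det := (Matrix.isUnit_iff_isUnit_det Q).1 hQ
  refine ⟨Q⁻¹, Q, Λ, Matrix.mul_nonsing_inv Q hdet, ?_, fun i => ?_⟩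
  · rw [← h, Matrix.mul_assoc _ Q, Matrix.mul_nonsing_inv Q hdet, Matrix.mul_one]
  · refine (himag (Λ i) ?_).1
    have h1 : spectrum ℂ (Q⁻¹ * complexify A * Q) = spectrum ℂ (complexify A) := by
      obtain ⟨v, rfl⟩ := hQ
      rw [← Matrix.coe_units_inv]
      exact spectrum.units_conjugate'
    rw [← h1, h, spectrum_diagonal]
    exact ⟨i, rfl⟩

theorem exists_right_inverse {A : Matrix (Fin d) (Fin d) 𝕜}
    (himag : HasPurelyImaginarySpectrum (complexify A)) :
    ∃ B : Matrix (Fin d) (Fin d) 𝕜, A * B = 1 := by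
  have h0 : (0 : ℂ) ∉ spectrum ℂ (complexify A) := fun h => (himag 0 h).2 rfl
  rw [spectrum.zero_notMem_iff, Matrix.isUnit_iff_isUnit_det] at h0
  have h1 : (complexify A).det = toComplex 𝕜 A.det := ((toComplex 𝕜).map_det A).symm
  have h2 : A.det ≠ 0 := by
    intro h
    rw [h1, h, map_zero] at h0
    exact not_isUnit_zero h0
  exact ⟨A⁻¹, Matrix.mul_nonsing_inv A h2.isUnit⟩

/-! ### The adapted norm -/

/-- The maximum norm in the coordinates given by `P`. -/
def adaptedNorm (P : Matrix (Fin d) (Fin d) ℂ) (v : Fin d → 𝕜) : ℝ :=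
  ‖P.mulVec fun p => toComplex 𝕜 (v p)‖

theorem adaptedNorm_nonneg (P : Matrix (Fin d) (Fin d) ℂ) (v : Fin d → 𝕜) :
    0 ≤ adaptedNorm P v := norm_nonneg _

theorem adaptedNorm_le {P : Matrix (Fin d) (Fin d) ℂ} {p b : ℝ} (hP : ∀ i, ∑ j, ‖P i j‖ ≤ p)
    (hp : 0 ≤ p) (hb : 0 ≤ b) {v : Fin d → 𝕜} (hv : ∀ i, ‖v i‖ ≤ b) :
    adaptedNorm P v ≤ p * b :=
  (pi_norm_le_iff_of_nonneg (by positivity)).2 fun i =>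
    norm_sum_mul_le hP hb (v := fun i => toComplex 𝕜 (v i)) (fun j => by rw [norm_toComplex]; exact hv j) i

theorem norm_apply_le_adaptedNorm {P Q : Matrix (Fin d) (Fin d) ℂ} (hQP : Q * P = 1) {q : ℝ}
    (hQ : ∀ i, ∑ j, ‖Q i j‖ ≤ q) (v : Fin d → 𝕜) (i : Fin d) : ‖v i‖ ≤ q * adaptedNorm P v := by
  have h1 : Q.mulVec (P.mulVec fun p => toComplex 𝕜 (v p)) = fun p => toComplex 𝕜 (v p) := by
    rw [Matrix.mulVec_mulVec, hQP, Matrix.one_mulVec]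
  rw [← norm_toComplex, ← congrFun h1 i]
  exact norm_sum_mul_le hQ (norm_nonneg _) (fun j => norm_le_pi_norm _ j) i

theorem adaptedNorm_add_le (P : Matrix (Fin d) (Fin d) ℂ) (v w : Fin d → 𝕜) :
    adaptedNorm P (fun i => v i + w i) ≤ adaptedNorm P v + adaptedNorm P w := by
  have h1 : (fun p => toComplex 𝕜 (v p + w p)) =
      (fun p => toComplex 𝕜 (v p)) + fun p => toComplex 𝕜 (w p) := by
    funext p; exact map_add _ _ _
  rw [adaptedNorm, h1, Matrix.mulVec_add]
  exact norm_add_le _ _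

theorem norm_state_le {b : ℝ} (hb : 0 ≤ b) {v : State 𝕜 d} (hv : ∀ p, ‖v p‖ ≤ b) :
    ‖v‖ ≤ d * b := by
  refine le_of_sq_le_sq ?_ (by positivity)
  rw [EuclideanSpace.norm_sq_eq]
  calc ∑ p, ‖v p‖ ^ 2 ≤ ∑ _p : Fin d, b ^ 2 := by
        gcongr with p
        exact hv p
    _ = d * b ^ 2 := by simp
    _ ≤ (d * d) * b ^ 2 := by
        gcongr
        exact_mod_cast Nat.le_mul_self d
    _ = (d * b) ^ 2 := by ring

theorem exists_row_bound {n R : Type*} [Fintype n] [SeminormedAddCommGroup R] (B : Matrix n n R) :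
    ∃ β : ℝ, 1 ≤ β ∧ ∀ i, ∑ j, ‖B i j‖ ≤ β :=
  ⟨1 + ∑ i, ∑ j, ‖B i j‖, le_add_of_nonneg_right (by positivity), fun i =>
    (Finset.single_le_sum (f := fun i => ∑ j, ‖B i j‖) (fun _ _ => by positivity)
      (Finset.mem_univ i)).trans (le_add_of_nonneg_left zero_le_one)⟩

theorem exists_uniform_bound {F : State 𝕜 d → ℝ → State 𝕜 d} {T : ℝ} (hT : 0 ≤ T)
    (hF : LipschitzDerivatives k T F) (R : ℝ) :
    ∃ L : ℝ, 0 ≤ L ∧ (∀ i, HasLipschitzBound k T (augField F i) R L) ∧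
      ∀ i, ∀ α : List (Fin (d + 1)), α.length ≤ k → ∀ u : State 𝕜 d, ‖u‖ ≤ R →
        ∀ s ∈ Set.Icc (0 : ℝ) T, ‖iterPartialD T α (augField F i) (u, s)‖ ≤ L := by
  choose L hL0 hL using fun i => (isLipschitzField_augField hF i).exists_bound hT R
  have hle : ∀ i, L i ≤ ∑ i, L i := fun i =>
    Finset.single_le_sum (fun j _ => hL0 j) (Finset.mem_univ i)
  refine ⟨∑ i, L i, Finset.sum_nonneg fun i _ => hL0 i, fun i α hα u v hu hv s hs t ht => ?_,
    fun i α hα u hu s hs => ((hL i α hα).2 u hu s hs).trans (hle i)⟩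
  refine ((hL i α hα).1 u v hu hv s hs t ht).trans ?_
  gcongr
  exact hle i

/-- Used for the initial data of the higher monomials: while the incoming error is at most 1 in
eigencoordinates, none of its monomials of positive degree exceeds it. -/
theorem norm_list_prod_le {l : List ℂ} (hl : l ≠ []) {b : ℝ} (hb : b ≤ 1)
    (h : ∀ z ∈ l, ‖z‖ ≤ b) : ‖l.prod‖ ≤ b := by
  cases l with
  | nil => exact absurd rfl hl
  | cons a l =>
    have h1 : ∀ l : List ℂ, (∀ z ∈ l, ‖z‖ ≤ b) → ‖l.prod‖ ≤ 1 := by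
      intro l
      induction l with
      | nil => simp
      | cons a l ih =>
        intro h
        rw [List.prod_cons, norm_mul]
        exact mul_le_one₀ ((h a (by simp)).trans hb) (norm_nonneg _)
          (ih fun z hz => h z (by simp [hz]))
    rw [List.prod_cons, norm_mul]
    exact (mul_le_of_le_one_right (norm_nonneg _) (h1 l fun z hz => h z (by simp [hz]))).trans
      (h a (by simp))

/-! ### The error after one step -/

theorem norm_sum_augMatrix_augCoord_le {A : Matrix (Fin d) (Fin d) 𝕜} {a K ε : ℝ}
    (ha : ∀ i, ∑ j, ‖augMatrix A i j‖ ≤ a) (hε : 0 < ε) {x : State 𝕜 d × ℝ}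
    (hx : ‖x.1‖ ≤ K * ε) (i : Fin (d + 1)) :
    ‖∑ m, augMatrix A i m * (((ε⁻¹ : ℝ) : 𝕜) * augCoord x m)‖ ≤ a * K := by
  have hK : 0 ≤ K := nonneg_of_mul_nonneg_left ((norm_nonneg _).trans hx) hε
  refine (norm_sum_le_of_le (n := fun m => ‖augMatrix A i m‖ * K) _ fun m _ => ?_).trans ?_
  · rw [norm_mul, norm_mul, RCLike.norm_ofReal, abs_of_pos (inv_pos.2 hε)]
    induction m using Fin.lastCases with
    | last =>
      have h0 : augMatrix A i (Fin.last d) = 0 := by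
        induction i using Fin.lastCases with
        | last => exact augMatrix_last A _
        | cast p => exact augMatrix_castSucc_last A p
      simp [h0]
    | cast m =>
      have h2 : ‖augCoord x m.castSucc‖ ≤ K * ε := by
        rw [augCoord, Fin.snoc_castSucc]
        exact (PiLp.norm_apply_le x.1 m).trans hx
      gcongr
      rw [inv_mul_le_iff₀ hε]
      linarith
  · rw [← Finset.sum_mul]
    exact mul_le_mul_of_nonneg_right (ha i) hK

-- The numerical step starts at `x` and not on the exact trajectory, so stability and consistency
-- are obtained at once. The norm in eigencoordinates is used because the incoming error is then
-- multiplied by exp(C h) without a further constant, which could not be iterated over T/h steps.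
set_option maxHeartbeats 1000000 in
theorem exists_step_bound {A B : Matrix (Fin d) (Fin d) 𝕜} (hAB : A * B = 1)
    {P Q : Matrix (Fin d) (Fin d) ℂ} {Λ : Fin d → ℂ} (hQP : Q * P = 1)
    (hPA : P * complexify A = Matrix.diagonal Λ * P) (hΛ : ∀ i, (Λ i).re = 0)
    {F : State 𝕜 d → ℝ → State 𝕜 d} {T : ℝ} (hT : 0 ≤ T) (hk : 1 ≤ k)
    (hF : LipschitzDerivatives k T F) {c K : ℝ} (hc : 0 ≤ c) (hK : 0 ≤ K) :
    ∃ C : ℝ, 0 < C ∧ ∀ ε h : ℝ, 0 < ε → ε ≤ 1 → 0 ≤ h → ε ≤ c * h → h ≤ T →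
      ∀ (u₀ : State 𝕜 d) (u : ℝ → State 𝕜 d), IsSolution A F T ε u₀ u →
      (∀ t ∈ Set.Icc 0 T, ‖u t‖ ≤ K * ε) →
      ∀ x : State 𝕜 d × ℝ, 0 ≤ x.2 → x.2 + h ≤ T → ‖x.1‖ ≤ K * ε →
      adaptedNorm P (u x.2 - x.1) ≤ 1 →
      adaptedNorm P (u (x.2 + h) - (step hk A F T ε h x).1) ≤
        Real.exp (C * h) * (adaptedNorm P (u x.2 - x.1) + C * ε * h ^ (k + 1)) := by
  -- The radius 2K covers ‖u‖ + ‖x̂‖, which bounds the intermediate states of the telescoping Taylor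
  -- expansion.
  obtain ⟨L, hL0, hL, hLb⟩ := exists_uniform_bound hT hF (2 * K)
  obtain ⟨β, hβ1, hβ⟩ := exists_row_bound (augMatrix B)
  obtain ⟨a, ha1, ha⟩ := exists_row_bound (augMatrix A)
  obtain ⟨p, hp1, hp⟩ := exists_row_bound (bordered P)
  obtain ⟨q, hq1, hq⟩ := exists_row_bound (bordered Q)
  have hQP' : bordered Q * bordered P = 1 := by rw [bordered_mul, hQP, bordered_one]
  set Λ' : Fin (d + 1) → ℂ := Fin.snoc (α := fun _ => ℂ) Λ 0 with hΛ'
  have hΛ're : ∀ i, (Λ' i).re = 0 := fun i => by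
    induction i using Fin.lastCases with
    | last => simp [hΛ']
    | cast i => simp [hΛ', hΛ]
  have hPA' : bordered P * (augMatrix A).map (toComplex 𝕜) =
      Matrix.diagonal Λ' * bordered P := by
    rw [augMatrix_map, bordered_mul_augMatrix, hPA, diagonal_mul_bordered]
  set n : ℝ := ((multiIndices d k).card : ℝ) with hn
  -- Chosen so that C₁ h dominates both h and the displacement 2 K ε ≤ 2 K c h.
  set C₁ : ℝ := 1 + 2 * K * c with hC₁
  have hC₁0 : 1 ≤ C₁ := by have : 0 ≤ 2 * K * c := by positivity
                           linarith
  set M : ℝ := k * ((a * K + n * L) * (k * (β * L * T)) +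
    (2 + d * n + k) * L * (2 * K) * C₁ ^ k) + k * ((k + 1) * (β * L)) with hM
  set Lip : ℝ := p ^ k * (k * ((a * K + n * L) * q ^ k)) with hLip
  have hn0 : 0 ≤ n := by positivity
  have hM0 : 0 ≤ M := by positivity
  have hLip0 : 0 ≤ Lip := by positivity
  set C : ℝ := 1 + Lip + p ^ k * M + p * (k * (β * L)) with hC
  have hC0 : 0 < C := by positivity
  refine ⟨C, hC0, ?_⟩
  intro ε h hε hε1 hh hεh hhT u₀ u hu huK x hx hxh hxK hN
  have hfin : Finite {l : List (Fin (d + 1)) // l.length ≤ k} := List.finite_length_le _ _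
  let := Fintype.ofFinite {l : List (Fin (d + 1)) // l.length ≤ k}
  have hKε : K * ε ≤ K := mul_le_of_le_one_right hK hε1
  have hmem : ∀ s ∈ Set.Icc 0 h, x.2 + s ∈ Set.Icc 0 T := fun s hs =>
    ⟨add_nonneg hx hs.1, by linarith [hs.2]⟩
  -- All eigencoordinates of degree at most `k` of the corrected error. Lists represent each
  -- multi-index repeatedly, which does not affect the maximum norm.
  set G : ℝ → {l : List (Fin (d + 1)) // l.length ≤ k} → ℂ := fun s l =>
    coordChange (bordered P) (fun α => toComplex 𝕜 (correctedError k A B F T ε u x s α)) l.1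
    with hG
  set b : ℝ → {l : List (Fin (d + 1)) // l.length ≤ k} → ℂ := fun s l =>
    coordChange (bordered P) (fun α => toComplex 𝕜 (correctedResidual k A B F T ε u x s α)) l.1
    with hb
  have hGd : ∀ s ∈ Set.Icc 0 h, ∀ l, HasDerivWithinAt (fun τ => G τ l)
      ((ε⁻¹ : ℝ) * (l.1.map Λ').sum * G s l + b s l) (Set.Icc 0 h) s := by
    intro s hs l
    have h1 := hasDerivWithinAt_coordChange (P := bordered P) (l := l.1) (s := s)
      (I := Set.Icc 0 h)
      (e := fun s α => toComplex 𝕜 (correctedError k A B F T ε u x s α))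
      (fun α hα => hasDerivWithinAt_toComplex (hasDerivWithinAt_correctedError hAB hε.ne' hF hk hu
        hx hxh hs (hα.le.trans l.2)))
    refine h1.congr_deriv ?_
    simp only [map_add, map_mul, toComplex_ofReal, toComplex_linearAction, coordChange_add,
      coordChange_mul, coordChange_linearAction hPA', hG, hb, mul_assoc]
  have hE : ∀ s, ∀ α : Multiset (Fin (d + 1)), α.card ≤ k →
      ‖correctedError k A B F T ε u x s α‖ ≤ q ^ k * ‖G s‖ := by
    intro s α hα
    have hlen : α.toList.length ≤ k := by rwa [Multiset.length_toList]
    have h1 := norm_le_of_coordChange_le hQP' hq (b := ‖G s‖) (l := α.toList)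
      (e := fun α => toComplex 𝕜 (correctedError k A B F T ε u x s α))
      fun l' hl' => norm_le_pi_norm (G s) ⟨l', by omega⟩
    rw [Multiset.coe_toList, norm_toComplex] at h1
    refine h1.trans ?_
    gcongr
  have hbb : ∀ s ∈ Set.Ico 0 h, ∀ l, ‖b s l‖ ≤ Lip * ‖G s‖ + p ^ k * M * (ε * h ^ k) := by
    intro s hs l
    have hs' : s ∈ Set.Icc 0 h := ⟨hs.1, hs.2.le⟩
    have hus := huK _ (hmem s hs')
    have hη : 2 * K * ε ≤ C₁ * h := by
      rw [hC₁, add_mul, one_mul]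
      have : 2 * K * ε ≤ 2 * K * (c * h) := by gcongr
      linarith
    have hr : ∀ α : Multiset (Fin (d + 1)), α.card ≤ k →
        ‖correctedResidual k A B F T ε u x s α‖ ≤
          k * ((a * K + n * L) * q ^ k) * ‖G s‖ + M * (ε * h ^ k) := by
      intro α hα
      have h1 := norm_correctedResidual_le (A := A) (a := a * K) (u := u) (θ := 2 * K * ε)
        (η := C₁ * h) hF hL0 hL (fun i γ hγ => norm_taylorCoeff_le (fun α hα =>
          hLb i α hα x.1 (by linarith) x.2 ⟨hx, by linarith⟩) hγ) hβ hε.le (norm_sum_augMatrix_augCoord_le ha hε hxK)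
        (by linarith) ((norm_sub_le _ _).trans (by linarith)) hη
        (hs.2.le.trans (le_mul_of_one_le_left hh hC₁0)) hx hs.1 (hmem s hs').2 (hE s) hα
      refine h1.trans ?_
      have h2 : s ^ k ≤ h ^ k := pow_le_pow_left₀ hs.1 hs.2.le k
      have h3 : s ^ (k + 1) ≤ T * h ^ k := by
        rw [pow_succ, mul_comm]
        exact mul_le_mul (hs.2.le.trans hhT) h2 (pow_nonneg hs.1 k) hT
      calc _ ≤ k * ((a * K + n * L) * (q ^ k * ‖G s‖ + ε * (k * (β * L * (T * h ^ k)))) +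
            (2 + d * n + k) * L * (2 * K * ε) * (C₁ * h) ^ k) +
            ε * (k * ((k + 1) * (β * L * h ^ k))) := by gcongr
        _ = _ := by rw [hM, mul_pow]; ring
    have hr0 : 0 ≤ k * ((a * K + n * L) * q ^ k) * ‖G s‖ + M * (ε * h ^ k) := by positivity
    have h4 := norm_coordChange_le hp (l := l.1)
      (e := fun α => toComplex 𝕜 (correctedResidual k A B F T ε u x s α))
      (fun α hα => by rw [norm_toComplex]; exact hr α (hα.le.trans l.2))
    refine h4.trans ?_
    calc _ ≤ p ^ k * (k * ((a * K + n * L) * q ^ k) * ‖G s‖ + M * (ε * h ^ k)) := by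
          gcongr
          exact l.2
      _ = _ := by rw [hLip]; ring
  -- The correction vanishes at time 0 and the numerical monomials start at e₁. So degree 0 cancels,
  -- and the other coordinates are products of eigencoordinates of the incoming error.
  have hG0 : ‖G 0‖ ≤ adaptedNorm P (u x.2 - x.1) := by
    refine (pi_norm_le_iff_of_nonneg (adaptedNorm_nonneg _ _)).2 fun l => ?_
    obtain ⟨l, hl⟩ := l
    have h1 : G 0 ⟨l, hl⟩ = coordChange (bordered P) (fun α => if α = 0 then 0 else
        monom (fun i => toComplex 𝕜 (displacement u x 0 i)) α) l := by
      refine coordChange_congr _ _ fun α hα => ?_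
      rw [correctedError_zero _ _ _ _ _ _ _ (hα.le.trans hl), ← toComplex_monom]
      split_ifs <;> simp
    rw [h1]
    by_cases hnil : l = []
    · subst hnil
      simpa [coordChange] using adaptedNorm_nonneg P (u x.2 - x.1)
    · rw [coordChange_congr (e' := monom fun i => toComplex 𝕜 (displacement u x 0 i)) _ _
        fun α hα => if_neg fun h0 => hnil (List.length_eq_zero_iff.1 (by rw [← hα, h0]; rfl)),
        coordChange_monom]
      refine norm_list_prod_le (by simpa using hnil) hN fun z hz => ?_
      obtain ⟨i, _, rfl⟩ := List.mem_map.1 hz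
      have h2 : displacement u x 0 (Fin.last d) = 0 := by simp [displacement, augCoord]
      have h3 : ∀ p : Fin d, displacement u x 0 p.castSucc = (u x.2 - x.1) p := fun p => by
        simp [displacement, augCoord]
      simp only [Matrix.mulVec, dotProduct, Fin.sum_univ_castSucc, h2, h3, map_zero, mul_zero,
        add_zero]
      induction i using Fin.lastCases with
      | last =>
        simpa [bordered_last_castSucc] using adaptedNorm_nonneg P (u x.2 - x.1)
      | cast i =>
        simp only [bordered_castSucc_castSucc]
        exact norm_le_pi_norm (P.mulVec fun p => toComplex 𝕜 ((u x.2 - x.1) p)) i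
  have hgr := norm_le_of_rotating hLip0 (δ := p ^ k * M * (ε * h ^ k)) (by positivity)
    (ω := fun l : {l : List (Fin (d + 1)) // l.length ≤ k} =>
      (ε⁻¹ : ℝ) * (l.1.map Λ').sum) (fun l => by
        have h1 : ∀ l : List (Fin (d + 1)), (l.map Λ').sum.re = 0 := fun l => by
          induction l with
          | nil => simp
          | cons i l ih => simp [ih, hΛ're]
        rw [Complex.re_ofReal_mul, h1, mul_zero]) (G := G) (b := b)
    (fun l s hs => (hGd s hs l).continuousWithinAt)
    (fun s hs l => hGd s ⟨hs.1, hs.2.le⟩ l) hbb h ⟨hh, le_rfl⟩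
  have hend : ∀ i, (u (x.2 + h) - (step hk A F T ε h x).1) i =
      correctedError k A B F T ε u x h {i.castSucc} +
        -(ε * correction k B F T x h {i.castSucc}) := fun i => by
    have h1 : monom (displacement u x h) {i.castSucc} = u (x.2 + h) i - x.1 i := by
      simp [monom, displacement, augCoord]
    rw [correctedError, errorFamily, h1, PiLp.sub_apply, step_fst_apply]
    ring
  have hfirst : adaptedNorm P (fun i => correctedError k A B F T ε u x h {i.castSucc}) ≤ ‖G h‖ := by
    refine (pi_norm_le_iff_of_nonneg (norm_nonneg _)).2 fun i => ?_
    have h1 := norm_le_pi_norm (G h) ⟨[i.castSucc], by simpa using hk⟩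
    refine le_trans (le_of_eq ?_) h1
    simp [hG, coordChange, Fin.sum_univ_castSucc, bordered_castSucc_castSucc,
      bordered_castSucc_last, Matrix.mulVec, dotProduct]
  have hsecond : adaptedNorm P (fun i : Fin d => -((ε : 𝕜) * correction k B F T x h {i.castSucc}))
      ≤ p * (ε * (k * (β * L * h ^ (k + 1)))) := by
    refine adaptedNorm_le (fun i => ?_) (by positivity) (by positivity) fun i => ?_
    · refine le_trans ?_ (hp i.castSucc)
      rw [Fin.sum_univ_castSucc]
      simp [bordered_castSucc_castSucc]
    · rw [norm_neg, norm_mul, RCLike.norm_ofReal, abs_of_pos hε]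
      gcongr
      exact norm_correction_le hF hL0 hL hβ (by linarith) hx hh hxh (by simpa using hk)
  have hsum := adaptedNorm_add_le P (fun i => correctedError k A B F T ε u x h {i.castSucc})
    (fun i : Fin d => -((ε : 𝕜) * correction k B F T x h {i.castSucc}))
  rw [show adaptedNorm P (u (x.2 + h) - (step hk A F T ε h x).1) = _ from
    congrArg (adaptedNorm P) (funext hend)]
  refine hsum.trans ?_
  set N₀ := adaptedNorm P (u x.2 - x.1) with hN₀
  have hN₀0 : 0 ≤ N₀ := adaptedNorm_nonneg _ _
  have hexp : 1 ≤ Real.exp (Lip * h) := Real.one_le_exp (by positivity)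
  have hLC : Lip ≤ C := by
    have : 0 ≤ p ^ k * M + p * (k * (β * L)) := by positivity
    linarith
  calc _ ≤ Real.exp (Lip * h) * (N₀ + p ^ k * M * (ε * h ^ k) * h) +
        Real.exp (Lip * h) * (p * (ε * (k * (β * L * h ^ (k + 1))))) := by
        refine add_le_add (hfirst.trans (hgr.trans ?_))
          (hsecond.trans (le_mul_of_one_le_left (by positivity) hexp))
        gcongr
    _ = Real.exp (Lip * h) * (N₀ + (p ^ k * M + p * (k * (β * L))) * ε * h ^ (k + 1)) := by ring
    _ ≤ Real.exp (C * h) * (N₀ + C * ε * h ^ (k + 1)) := by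
        gcongr
        rw [hC]
        linarith

/-! ### The exact solution is small -/

theorem hasDerivWithinAt_mulVec {n : Type*} [Fintype n] (P : Matrix n n 𝕜) {w : ℝ → n → 𝕜}
    {w' : n → 𝕜} {I : Set ℝ} {s : ℝ} (h : ∀ p, HasDerivWithinAt (fun s => w s p) (w' p) I s)
    (a : n) : HasDerivWithinAt (fun s => P.mulVec (w s) a) (P.mulVec w' a) I s := by
  simp only [Matrix.mulVec, dotProduct]
  exact HasDerivWithinAt.fun_sum fun p _ => (h p).const_mul _

/-- The same correction in its simplest form: v = u + ε A⁻¹ F(0, t) satisfies v' = A v/ε + (F(u, t)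
- F(0, t)) + ε A⁻¹ ∂F/∂t(0, t), whose forcing is O(‖u‖ + ε). Gronwall in eigencoordinates gives u =
O(ε) while ‖u‖ ≤ 1, and a continuity argument shows that this persists. -/
theorem exists_solution_bound {A B : Matrix (Fin d) (Fin d) 𝕜} (hAB : A * B = 1)
    {P Q : Matrix (Fin d) (Fin d) ℂ} {Λ : Fin d → ℂ} (hQP : Q * P = 1)
    (hPA : P * complexify A = Matrix.diagonal Λ * P) (hΛ : ∀ i, (Λ i).re = 0)
    {F : State 𝕜 d → ℝ → State 𝕜 d} {T : ℝ} (hT : 0 ≤ T) (hk : 1 ≤ k)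
    (hF : LipschitzDerivatives k T F) {r : ℝ} (hr : 0 ≤ r) :
    ∃ K : ℝ, 1 ≤ K ∧ ∀ ε : ℝ, 0 < ε → K * ε ≤ 1 / 2 →
      ∀ (u₀ : State 𝕜 d) (u : ℝ → State 𝕜 d), ‖u₀‖ ≤ r * ε → IsSolution A F T ε u₀ u →
      ∀ t ∈ Set.Icc 0 T, ‖u t‖ ≤ K * ε := by
  obtain ⟨L, hL0, hL, hLb⟩ := exists_uniform_bound hT hF 1
  obtain ⟨β, hβ1, hβ⟩ := exists_row_bound B
  obtain ⟨p, hp1, hp⟩ := exists_row_bound P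
  obtain ⟨q, hq1, hq⟩ := exists_row_bound Q
  set Lip : ℝ := p * L * d * q with hLip
  set M : ℝ := p * (L * d * (β * L) + β * L) with hM
  set K : ℝ := 1 + d * (q * (Real.exp (Lip * T) * (p * (r + β * L) + M * T)) + β * L) with hK
  have hLip0 : 0 ≤ Lip := by positivity
  have hM0 : 0 ≤ M := by positivity
  refine ⟨K, by rw [hK]; exact le_add_of_nonneg_right (by positivity), ?_⟩
  intro ε hε hεK u₀ u hu₀ hu
  have hlocal : ∀ τ ∈ Set.Icc 0 T, (∀ t ∈ Set.Ico 0 τ, ‖u t‖ ≤ 1) →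
      ∀ t ∈ Set.Icc 0 τ, ‖u t‖ ≤ K * ε := by
    intro τ hτ hu1 t ht
    have hsub : Set.Icc 0 τ ⊆ Set.Icc 0 T := Set.Icc_subset_Icc_right hτ.2
    set f : ℝ → Fin d → 𝕜 := fun s p => F 0 s p with hf
    set v : ℝ → Fin d → 𝕜 := fun s p => u s p + ε * B.mulVec (f s) p with hv
    set f' : ℝ → Fin d → 𝕜 := fun s p => iterPartialD T [Fin.last d] (augField F p.castSucc) (0, s)
      with hf'
    set ρ : ℝ → Fin d → 𝕜 := fun s p => F (u s) s p - f s p + ε * B.mulVec (f' s) p with hρ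
    set G : ℝ → Fin d → ℂ := fun s => P.mulVec fun p => toComplex 𝕜 (v s p) with hG
    set b : ℝ → Fin d → ℂ := fun s => P.mulVec fun p => toComplex 𝕜 (ρ s p) with hb
    have hfn : ∀ s ∈ Set.Icc 0 T, ∀ p, ‖f s p‖ ≤ L := fun s hs p => by
      simpa [iterPartialD, augField, hf] using hLb p.castSucc [] (by simp) 0 (by simp) s hs
    have hf'n : ∀ s ∈ Set.Icc 0 T, ∀ p, ‖f' s p‖ ≤ L := fun s hs p =>
      hLb p.castSucc [Fin.last d] (by simpa using hk) 0 (by simp) s hs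
    have hBf : ∀ s ∈ Set.Icc 0 T, ∀ p, ‖(ε : 𝕜) * B.mulVec (f s) p‖ ≤ ε * (β * L) :=
      fun s hs p => by
        rw [norm_mul, RCLike.norm_ofReal, abs_of_pos hε]
        exact mul_le_mul_of_nonneg_left (norm_sum_mul_le hβ hL0 (hfn s hs) p) hε.le
    have hBf' : ∀ s ∈ Set.Icc 0 T, ∀ p, ‖(ε : 𝕜) * B.mulVec (f' s) p‖ ≤ ε * (β * L) :=
      fun s hs p => by
        rw [norm_mul, RCLike.norm_ofReal, abs_of_pos hε]
        exact mul_le_mul_of_nonneg_left (norm_sum_mul_le hβ hL0 (hf'n s hs) p) hε.le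
    have hun : ∀ s ∈ Set.Icc 0 T, ‖u s‖ ≤ d * (q * ‖G s‖ + ε * (β * L)) := fun s hs => by
      refine norm_state_le (by positivity) fun p => ?_
      have h1 : u s p = v s p - ε * B.mulVec (f s) p := by simp [hv]
      rw [h1]
      exact norm_sub_le_of_le (norm_apply_le_adaptedNorm hQP hq (v s) p) (hBf s hs p)
    have hvd : ∀ s ∈ Set.Icc 0 τ, ∀ p, HasDerivWithinAt (fun s => v s p)
        ((ε⁻¹ : ℝ) * A.mulVec (v s) p + ρ s p) (Set.Icc 0 τ) s := by
      intro s hs p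
      have h1 := (PiLp.proj (𝕜 := ℝ) 2 (fun _ : Fin d => 𝕜)
        p).hasFDerivAt.comp_hasDerivWithinAt s (hu.2 s (hsub hs))
      have h2 : HasDerivWithinAt (fun s => B.mulVec (f s) p) (B.mulVec (f' s) p)
          (Set.Icc 0 T) s := by
        refine hasDerivWithinAt_mulVec B (fun j => ?_) p
        have h3 := (isLipschitzField_augField hF j.castSucc).hasDerivWithinAt_time (α := [])
          (by simpa using Nat.lt_of_lt_of_le Nat.zero_lt_one hk) 0 (hsub hs)
        simpa [iterPartialD, augField, hf, hf'] using h3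
      refine ((h1.add (h2.const_mul (ε : 𝕜))).mono hsub).congr_deriv ?_
      have h4 : A.mulVec (v s) p = A.mulVec (u s) p + ε * f s p := by
        have h5 : v s = (fun p => u s p) + (ε : 𝕜) • B.mulVec (f s) := by
          funext p; simp [hv, RCLike.real_smul_eq_coe_mul]
        rw [h5, Matrix.mulVec_add, Matrix.mulVec_smul, Matrix.mulVec_mulVec, hAB,
          Matrix.one_mulVec]
        simp [RCLike.real_smul_eq_coe_mul]
      have hε' : (ε : 𝕜) ≠ 0 := by exact_mod_cast hε.ne'
      have h6 : (PiLp.proj (𝕜 := ℝ) 2 (fun _ : Fin d => 𝕜) p)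
          (ε⁻¹ • Matrix.toEuclideanLin A (u s) + F (u s) s) =
          (ε : 𝕜)⁻¹ * A.mulVec (u s) p + F (u s) s p := by
        simp [RCLike.real_smul_eq_coe_mul, Matrix.toLpLin_apply]
      rw [h6, h4, RCLike.ofReal_inv, mul_add, inv_mul_cancel_left₀ hε']
      simp only [hρ]
      ring
    have hGd : ∀ s ∈ Set.Icc 0 τ, ∀ a, HasDerivWithinAt (fun s => G s a)
        ((ε⁻¹ : ℝ) * Λ a * G s a + b s a) (Set.Icc 0 τ) s := by
      intro s hs a
      have h1 : HasDerivWithinAt (fun s => G s a)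
          (P.mulVec (fun p => toComplex 𝕜 ((ε⁻¹ : ℝ) * A.mulVec (v s) p + ρ s p)) a)
          (Set.Icc 0 τ) s :=
        hasDerivWithinAt_mulVec P (fun p => hasDerivWithinAt_toComplex (hvd s hs p)) a
      refine h1.congr_deriv ?_
      have h2 : (fun p => toComplex 𝕜 ((ε⁻¹ : ℝ) * A.mulVec (v s) p + ρ s p)) =
          ((ε⁻¹ : ℝ) : ℂ) • (complexify A).mulVec (fun p => toComplex 𝕜 (v s p)) +
            fun p => toComplex 𝕜 (ρ s p) := by
        funext p
        have h3 : toComplex 𝕜 (A.mulVec (v s) p) =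
            (complexify A).mulVec (fun p => toComplex 𝕜 (v s p)) p :=
          RingHom.map_mulVec (toComplex 𝕜) A (v s) p
        rw [map_add, map_mul, toComplex_ofReal, h3]
        rfl
      rw [h2, Matrix.mulVec_add, Matrix.mulVec_smul, Matrix.mulVec_mulVec, hPA,
        ← Matrix.mulVec_mulVec, Pi.add_apply, Pi.smul_apply, Matrix.mulVec_diagonal, smul_eq_mul,
        mul_assoc]
    have hbb : ∀ s ∈ Set.Ico 0 τ, ∀ a, ‖b s a‖ ≤ Lip * ‖G s‖ + M * ε := by
      intro s hs a
      have hs' : s ∈ Set.Icc 0 T := hsub ⟨hs.1, hs.2.le⟩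
      have hρn : ∀ p, ‖ρ s p‖ ≤ L * (d * (q * ‖G s‖ + ε * (β * L))) + ε * (β * L) := fun p => by
        refine norm_add_le_of_le ?_ (hBf' s hs' p)
        have h1 := hL p.castSucc [] (by simp) (u s) 0 (hu1 s hs) (by simp) s hs' s hs'
        simp only [iterPartialD, List.foldr_nil, augField, Fin.snoc_castSucc, sub_zero, sub_self,
          abs_zero, norm_nonneg, max_eq_left] at h1
        exact h1.trans (mul_le_mul_of_nonneg_left (hun s hs') hL0)
      refine (norm_sum_mul_le hp (b := L * (d * (q * ‖G s‖ + ε * (β * L))) + ε * (β * L))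
        (by positivity) (v := fun p => toComplex 𝕜 (ρ s p))
        (fun p => by rw [norm_toComplex]; exact hρn p) a).trans (le_of_eq ?_)
      rw [hLip, hM]; ring
    have hG0 : ‖G 0‖ ≤ ε * (p * (r + β * L)) := by
      have h0 : (0 : ℝ) ∈ Set.Icc 0 T := ⟨le_rfl, hT⟩
      refine (adaptedNorm_le (b := r * ε + ε * (β * L)) hp (by positivity) (by positivity)
        (v := v 0) fun i => norm_add_le_of_le ?_ (hBf 0 h0 i)).trans (le_of_eq (by ring))
      rw [hu.1]
      exact (PiLp.norm_apply_le u₀ i).trans hu₀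
    have hgr := norm_le_of_rotating hLip0 (δ := M * ε) (by positivity)
      (ω := fun a => (ε⁻¹ : ℝ) * Λ a) (fun a => by rw [Complex.re_ofReal_mul, hΛ, mul_zero])
      (G := G) (b := b) (fun a s hs => (hGd s hs a).continuousWithinAt)
      (fun s hs a => hGd s ⟨hs.1, hs.2.le⟩ a) hbb t ht
    have htT : t ≤ T := ht.2.trans hτ.2
    have ht0 : 0 ≤ t := ht.1
    calc ‖u t‖ ≤ d * (q * ‖G t‖ + ε * (β * L)) := hun t (hsub ht)
      _ ≤ d * (q * (Real.exp (Lip * T) * (ε * (p * (r + β * L)) + M * ε * T)) + ε * (β * L)) := by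
          gcongr
          exact hgr.trans (by gcongr)
      _ = (K - 1) * ε := by rw [hK]; ring
      _ ≤ K * ε := by gcongr; linarith
  have hcont : ContinuousOn u (Set.Icc 0 T) := fun t ht => (hu.2 t ht).continuousWithinAt
  -- If ‖u‖ reached 1, then at the first such time the bound already proved would give ‖u‖ ≤ K ε ≤
  -- 1/2.
  set S : Set ℝ := {t ∈ Set.Icc 0 T | 1 ≤ ‖u t‖} with hS
  have hScl : IsClosed S := hcont.norm.preimage_isClosed_of_isClosed isClosed_Icc isClosed_Ici
  have hSc : IsCompact S := isCompact_Icc.of_isClosed_subset hScl fun t ht => ht.1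
  have hSe : S = ∅ := by
    by_contra hne
    obtain ⟨τ, hτ, hmin⟩ := hSc.exists_isLeast (Set.nonempty_iff_ne_empty.2 hne)
    have h1 := hlocal τ hτ.1 (fun t ht => by
      by_contra hlt
      exact absurd (hmin ⟨⟨ht.1, ht.2.le.trans hτ.1.2⟩, (not_le.1 hlt).le⟩) (not_le.2 ht.2))
      τ ⟨hτ.1.1, le_rfl⟩
    have h2 : (1 : ℝ) ≤ ‖u τ‖ := hτ.2
    linarith
  exact hlocal T ⟨hT, le_rfl⟩ fun t ht => by
    by_contra hlt
    exact Set.eq_empty_iff_forall_notMem.1 hSe t ⟨⟨ht.1, ht.2.le⟩, (not_le.1 hlt).le⟩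

/-! ### Accumulation of the errors -/

/-- If the error after one step is controlled with a constant that depends on the size of the error,
then the errors are controlled globally. -/
theorem exists_accumulated_bound (hk : 1 ≤ k) {T : ℝ} (hT : 0 < T) {c : ℝ → ℝ}
    (hc : ∀ G, 0 ≤ G → 0 < c G) :
    ∃ S : ℝ, 1 ≤ S ∧ ∀ (ε h : ℝ) (N : ℕ) (e : ℕ → ℝ), 0 < ε → S * ε ≤ 1 → 0 < h → N * h = T →
      e 0 = 0 →
      (∀ G, 0 ≤ G → ∀ n < N, e n ≤ G * ε → e n ≤ 1 →
        e (n + 1) ≤ Real.exp (c G * h) * (e n + c G * ε * h ^ (k + 1))) →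
      ∀ n ≤ N, e n ≤ S * ε * h ^ k := by
  set c₁ := c 1 with hc₁
  have hc₁0 : 0 < c₁ := hc 1 zero_le_one
  set H : ℝ := Real.exp (c₁ * T) * (c₁ * T) with hH
  have hH0 : 0 < H := by positivity
  -- A bound after a fixed number of steps, with a constant depending on that number but not on ε or
  -- h. It may grow uncontrollably with `n`.
  have hfew : ∀ n : ℕ, ∃ G : ℝ, 0 ≤ G ∧ ∀ (ε h : ℝ) (N : ℕ) (e : ℕ → ℝ), 0 < ε → G * ε ≤ 1 →
      0 < h → N * h = T → e 0 = 0 →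
      (∀ G, 0 ≤ G → ∀ n < N, e n ≤ G * ε → e n ≤ 1 →
        e (n + 1) ≤ Real.exp (c G * h) * (e n + c G * ε * h ^ (k + 1))) →
      n ≤ N → e n ≤ G * ε := by
    intro n
    induction n with
    | zero => exact ⟨0, le_rfl, fun ε h N e _ _ _ _ h0 _ _ => by rw [h0, zero_mul]⟩
    | succ n ih =>
      obtain ⟨G, hG0, hG⟩ := ih
      have hcG := hc G hG0
      refine ⟨max G (Real.exp (c G * T) * (G + c G * T ^ (k + 1))), le_max_of_le_left hG0, ?_⟩
      intro ε h N e hε hGε hh hN h0 hstep hn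
      have h1 : G * ε ≤ 1 := le_trans (by gcongr; exact le_max_left _ _) hGε
      have h2 := hG ε h N e hε h1 hh hN h0 hstep (by omega)
      have hhT : h ≤ T := by
        rw [← hN]
        refine le_mul_of_one_le_left hh.le ?_
        exact_mod_cast (by omega : 1 ≤ N)
      calc e (n + 1) ≤ Real.exp (c G * h) * (e n + c G * ε * h ^ (k + 1)) :=
            hstep G hG0 n (by omega) h2 (h2.trans h1)
        _ ≤ Real.exp (c G * h) * (G * ε + c G * ε * h ^ (k + 1)) := by gcongr
        _ ≤ Real.exp (c G * T) * (G * ε + c G * ε * T ^ (k + 1)) := by gcongr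
        _ = Real.exp (c G * T) * (G + c G * T ^ (k + 1)) * ε := by ring
        _ ≤ _ := by gcongr; exact le_max_right _ _
  choose G hG0 hG using hfew
  -- Below this step size H h^k ≤ 1, since h^k ≤ h; at or above it at most `N₀` steps fit into [0,
  -- T].
  set h₀ : ℝ := min 1 H⁻¹ with hh₀
  have hh₀0 : 0 < h₀ := lt_min one_pos (by positivity)
  set N₀ : ℕ := ⌈T / h₀⌉₊ with hN₀
  set Gm : ℝ := ∑ n ∈ Finset.range (N₀ + 1), G n with hGm
  have hGle : ∀ n ≤ N₀, G n ≤ Gm := fun n hn =>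
    Finset.single_le_sum (f := G) (fun i _ => hG0 i) (Finset.mem_range.2 (by omega))
  have hGm0 : 0 ≤ Gm := Finset.sum_nonneg fun i _ => hG0 i
  set S : ℝ := 1 + H + Gm + Gm * H with hS
  have hS1 : 1 ≤ S := by have : 0 ≤ H + Gm + Gm * H := by positivity
                         linarith
  refine ⟨S, hS1, ?_⟩
  intro ε h N e hε hSε hh hN h0 hstep
  have hGmH : 0 ≤ Gm * H := by positivity
  -- In the first case the accumulated bound H h^k ε is at most ε, so the constant `c 1` applies at
  -- every step. In the second, 1 < H h^k converts the bound O(ε) into O(ε h^k).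
  by_cases hsmall : H * h ^ k ≤ 1
  · have hε1 : ε ≤ 1 := le_trans (le_mul_of_one_le_left hε.le hS1) hSε
    have hmain : ∀ n ≤ N, Real.exp (c₁ * (n * h)) * (n * (c₁ * ε * h ^ (k + 1))) ≤
        H * h ^ k * ε := by
      intro n hn
      have hnh : n * h ≤ T := by
        rw [← hN]; gcongr
      have h1 : Real.exp (c₁ * (n * h)) * (c₁ * (n * h)) ≤ H := by
        rw [hH]; gcongr
      calc _ = Real.exp (c₁ * (n * h)) * (c₁ * (n * h)) * h ^ k * ε := by ring
        _ ≤ _ := by gcongr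
    have hind : ∀ n ≤ N, e n ≤ Real.exp (c₁ * (n * h)) * (n * (c₁ * ε * h ^ (k + 1))) := by
      intro n
      induction n with
      | zero => intro _; simp [h0]
      | succ n ih =>
        intro hn
        have h1 := ih (by omega)
        have h2 : e n ≤ 1 * ε :=
          h1.trans ((hmain n (by omega)).trans (mul_le_mul_of_nonneg_right hsmall hε.le))
        refine (hstep 1 zero_le_one n (by omega) h2 (by linarith)).trans ?_
        have h3 : Real.exp (c₁ * ((n + 1 : ℕ) * h)) =
            Real.exp (c₁ * h) * Real.exp (c₁ * (n * h)) := by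
          rw [← Real.exp_add]; congr 1; push_cast; ring
        rw [h3, mul_assoc (Real.exp (c₁ * h)) (Real.exp _)]
        refine mul_le_mul_of_nonneg_left ?_ (Real.exp_pos _).le
        have h4 : (1 : ℝ) ≤ Real.exp (c₁ * (n * h)) := Real.one_le_exp (by positivity)
        have h5 : c₁ * ε * h ^ (k + 1) ≤ Real.exp (c₁ * (n * h)) * (c₁ * ε * h ^ (k + 1)) :=
          le_mul_of_one_le_left (by positivity) h4
        push_cast
        rw [add_mul, mul_add, one_mul]
        exact add_le_add h1 h5
    intro n hn
    calc e n ≤ H * h ^ k * ε := (hind n hn).trans (hmain n hn)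
      _ = H * ε * h ^ k := by ring
      _ ≤ S * ε * h ^ k := by gcongr; linarith
  · intro n hn
    have h1 : 1 < H * h ^ k := not_le.1 hsmall
    have h2 : h₀ ≤ h := by
      by_contra hlt
      rw [not_le, hh₀, lt_min_iff] at hlt
      have h3 : h ^ k ≤ h := pow_le_of_le_one hh.le hlt.1.le (by omega)
      have h4 : H * h ^ k ≤ H * H⁻¹ := by gcongr; exact h3.trans hlt.2.le
      rw [mul_inv_cancel₀ hH0.ne'] at h4
      linarith
    have h3 : N ≤ N₀ := by
      have h4 : (N : ℝ) ≤ T / h₀ := by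
        rw [le_div_iff₀ hh₀0, ← hN]
        gcongr
      exact_mod_cast h4.trans (Nat.le_ceil _)
    have h5 := hGle n (hn.trans h3)
    have h6 : G n * ε ≤ 1 := by
      refine le_trans ?_ hSε
      gcongr
      linarith
    calc e n ≤ G n * ε := hG n ε h N e hε h6 hh hN h0 hstep hn
      _ ≤ Gm * ε := by gcongr
      _ ≤ Gm * ε * (H * h ^ k) := le_mul_of_one_le_right (by positivity) h1.le
      _ = Gm * H * ε * h ^ k := by ring
      _ ≤ S * ε * h ^ k := by gcongr; linarith

end

end LLE

end

/-! ### The global error estimate -/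

theorem theorem4p3 {𝕜 : Type*} [RCLike 𝕜] {d k : ℕ} (hk : 1 ≤ k)
    (A : Matrix (Fin d) (Fin d) 𝕜)
    (hdiag : LLE.IsDiagonalizable (LLE.complexify A))
    (himag : LLE.HasPurelyImaginarySpectrum (LLE.complexify A))
    (μ : ℝ) (hμ : IsLeast ((fun z : ℂ => ‖z‖) '' spectrum ℂ (LLE.complexify A)) μ)
    (T : ℝ) (hT : 0 < T)
    (F : LLE.State 𝕜 d → ℝ → LLE.State 𝕜 d) (hF : LLE.LipschitzDerivatives k T F)
    (uin : LLE.State 𝕜 d) :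
    ∃ C : ℝ, 0 < C ∧ ∀ (ν ε : ℝ), 1 ≤ ν → 0 < ε →
      ∀ u : ℝ → LLE.State 𝕜 d, LLE.IsSolution A F T ε ((ε ^ ν) • uin) u →
      ∀ (N : ℕ) (h : ℝ), 0 < N → h = T / N →
        2 * Real.pi * ε / μ < h → h < (C * ε)⁻¹ →
        ∀ n : ℕ, n ≤ N →
          ‖LLE.numSol hk A F T ε h ((ε ^ ν) • uin) n - u (n * h)‖ ≤ C * ε * h ^ k := by
  open LLE in
  obtain ⟨P, Q, Λ, hQP, hPA, hΛ⟩ := exists_diagonalization hdiag himag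
  obtain ⟨B, hAB⟩ := exists_right_inverse himag
  obtain ⟨q, hq1, hq⟩ := exists_row_bound Q
  obtain ⟨K, hK1, hK⟩ := exists_solution_bound hAB hQP hPA hΛ hT.le hk hF (norm_nonneg uin)
  have hμ0 : 0 < μ := by
    obtain ⟨z, hz, rfl⟩ := hμ.1
    exact norm_pos_iff.2 (himag z hz).2
  have hpi := Real.pi_pos
  -- The lower restriction on the step size is ε < c h.
  set c : ℝ := μ / (2 * Real.pi) with hc
  have hc0 : 0 < c := by positivity
  set w : ℝ := d * q with hw
  have hw0 : 0 ≤ w := by positivity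
  have hwn : ∀ v : State 𝕜 d, ‖v‖ ≤ w * adaptedNorm P v := fun v => by
    have h1 := adaptedNorm_nonneg P (v : Fin d → 𝕜)
    rw [hw, mul_assoc]
    exact norm_state_le (by positivity) fun p => norm_apply_le_adaptedNorm hQP hq v p
  -- An iterate within G ε of the exact solution in the adapted norm has norm at most (K + w G) ε.
  -- The step constant thus becomes a function of `G`; its value at negative `G` is a dummy.
  have hstep : ∀ G : ℝ, ∃ C : ℝ, 0 ≤ G → 0 < C ∧ ∀ ε h : ℝ, 0 < ε → ε ≤ 1 → 0 ≤ h → ε ≤ c * h →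
      h ≤ T → ∀ (u₀ : State 𝕜 d) (u : ℝ → State 𝕜 d), IsSolution A F T ε u₀ u →
      (∀ t ∈ Set.Icc 0 T, ‖u t‖ ≤ (K + w * G) * ε) →
      ∀ x : State 𝕜 d × ℝ, 0 ≤ x.2 → x.2 + h ≤ T → ‖x.1‖ ≤ (K + w * G) * ε →
      adaptedNorm P (u x.2 - x.1) ≤ 1 →
      adaptedNorm P (u (x.2 + h) - (step hk A F T ε h x).1) ≤
        Real.exp (C * h) * (adaptedNorm P (u x.2 - x.1) + C * ε * h ^ (k + 1)) := fun G => by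
    by_cases hG : 0 ≤ G
    · obtain ⟨C, hC⟩ := exists_step_bound hAB hQP hPA hΛ hT.le hk hF hc0.le
        (K := K + w * G) (by positivity)
      exact ⟨C, fun _ => hC⟩
    · exact ⟨0, fun h => absurd h hG⟩
  choose C hC using hstep
  obtain ⟨S, hS1, hS⟩ := exists_accumulated_bound hk hT fun G hG => (hC G hG).1
  -- S' ε ≤ 1 ensures both S ε ≤ 1 for the accumulation and K ε ≤ 1/2 for the bound of the exact
  -- solution.
  set S' : ℝ := S + 2 * K with hS'
  have hS'0 : 0 < S' := by positivity
  refine ⟨1 + c * S' ^ 2 + w * S, by positivity, ?_⟩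
  intro ν ε hν hε u hu N h hN hhN hh1 hh2 n hn
  have hN' : (0 : ℝ) < N := by exact_mod_cast hN
  have hh : 0 < h := by rw [hhN]; positivity
  have hNh : N * h = T := by rw [hhN]; field_simp
  have hεh : ε ≤ c * h := by
    rw [div_lt_iff₀ hμ0] at hh1
    rw [hc, div_mul_eq_mul_div, le_div_iff₀ (by positivity)]
    linarith
  have hhT : h ≤ T := by
    rw [← hNh]
    exact le_mul_of_one_le_left hh.le (by exact_mod_cast hN)
  -- One factor ε of (S' ε)² is replaced by c h, and the upper restriction on h bounds c S'² ε h by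
  -- 1. This is the role of c S'² in the final constant.
  have hsmall : S' * ε ≤ 1 := by
    have h1 : h * ((1 + c * S' ^ 2 + w * S) * ε) < 1 := by
      rwa [lt_inv_comm₀ hh (by positivity), ← one_div, lt_div_iff₀ hh, mul_comm] at hh2
    have h2 : c * (S' * ε) ^ 2 ≤ c * 1 := by
      calc c * (S' * ε) ^ 2 = c * S' ^ 2 * ε * ε := by ring
        _ ≤ c * S' ^ 2 * ε * (c * h) := by gcongr
        _ ≤ c * (h * ((1 + c * S' ^ 2 + w * S) * ε)) := by
            have h3 : 0 ≤ h * ((1 + w * S) * ε) := by positivity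
            have h4 : c * (h * ((1 + c * S' ^ 2 + w * S) * ε)) =
              c * S' ^ 2 * ε * (c * h) + c * (h * ((1 + w * S) * ε)) := by ring
            rw [h4]
            exact le_add_of_nonneg_right (by positivity)
        _ ≤ c * 1 := by gcongr
    have h5 : (S' * ε) ^ 2 ≤ 1 := le_of_mul_le_mul_left h2 hc0
    exact (sq_le_one_iff₀ (by positivity)).1 h5
  have hSε : S * ε ≤ 1 := le_trans (by gcongr; linarith) hsmall
  have hε1 : ε ≤ 1 := le_trans (le_mul_of_one_le_left hε.le hS1) hSε
  have hu₀ : ‖(ε ^ ν) • uin‖ ≤ ‖uin‖ * ε := by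
    have h1 : ε ^ ν ≤ ε := by
      simpa using Real.rpow_le_rpow_of_exponent_ge hε hε1 hν
    rw [norm_smul, Real.norm_of_nonneg (Real.rpow_nonneg hε.le ν), mul_comm]
    gcongr
  have huK := hK ε hε (by nlinarith) _ u hu₀ hu
  set X : ℕ → State 𝕜 d × ℝ := augNumSol hk A F T ε h ((ε ^ ν) • uin) with hX
  have hXs : ∀ n, X (n + 1) = step hk A F T ε h (X n) := fun n =>
    Function.iterate_succ_apply' _ _ _
  have hXt : ∀ n, (X n).2 = n * h := fun n => by
    induction n with
    | zero => simp [hX, augNumSol]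
    | succ n ih => rw [hXs, step_snd, ih]; push_cast; ring
  have hfinal := hS ε h N (fun n => adaptedNorm P (u (n * h) - (X n).1)) hε hSε hh hNh
    (by
      simp only [hX, augNumSol, hu.1, adaptedNorm, Function.iterate_zero, id_eq, Nat.cast_zero,
        zero_mul, sub_self, PiLp.zero_apply, map_zero]
      exact norm_eq_zero.2 (Matrix.mulVec_zero P))
    (fun G hG n hn hGn hn1 => by
      have hnh : (n : ℝ) * h + h ≤ T := by
        rw [← hNh]
        have : ((n + 1 : ℕ) : ℝ) ≤ N := by exact_mod_cast hn
        push_cast at this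
        nlinarith
      have hmem : (n : ℝ) * h ∈ Set.Icc 0 T := ⟨by positivity, by linarith⟩
      have hle : K * ε ≤ (K + w * G) * ε := by
        gcongr
        exact le_add_of_nonneg_right (by positivity)
      have hXn : ‖(X n).1‖ ≤ (K + w * G) * ε := by
        have h1 := norm_le_norm_add_norm_sub (u (n * h)) (X n).1
        have h2 := hwn (u (n * h) - (X n).1)
        have h3 := huK _ hmem
        have h4 : w * adaptedNorm P (u (n * h) - (X n).1) ≤ w * (G * ε) := by gcongr
        linarith
      have h1 := (hC G hG).2 ε h hε hε1 hh.le hεh hhT _ u hu (fun t ht => (huK t ht).trans hle)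
        (X n) (by rw [hXt]; exact hmem.1) (by rw [hXt]; exact hnh) hXn (by rw [hXt]; exact hn1)
      rw [hXt, ← hXs] at h1
      push_cast
      rw [add_mul, one_mul]
      exact h1) n hn
  rw [norm_sub_rev]
  calc ‖u (n * h) - numSol hk A F T ε h ((ε ^ ν) • uin) n‖
      ≤ w * adaptedNorm P (u (n * h) - (X n).1) := hwn _
    _ ≤ w * (S * ε * h ^ k) := by gcongr
    _ = w * S * ε * h ^ k := by ring
    _ ≤ (1 + c * S' ^ 2 + w * S) * ε * h ^ k := by
        gcongr
        exact le_add_of_nonneg_left (by positivity)
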